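/- **Proposition (asymptotics of $I_1$).** For a positive integer $n$ and $\operatorname{Re}\epsilon>0$ let $$Z_n(\mathbf s;\epsilon)=\frac{(2\pi)^{-n}\epsilon^{-1/12}}{\mathrm{Vol}(n)}\int_{\mathcal H(n)}e^{-\frac1\epsilon\mathrm{tr}\left(\frac12M^2-\sum_{j\ge1}s_jM^j\right)}dM,\qquad \mathrm{Vol}(n)=\frac{\pi^{n(n-1)/2}}{\prod_{k=1}^{n-1}k!},$$ be the GUE partition function, where $\mathcal H(n)$ is the space of $n\times n$ Hermitian matrices, $dM=\prod_i dM_{ii}\prod_{i<j}d\mathrm{Re}M_{ij}\,d\mathrm{Im}M_{ij}$, and $Z_n$ is understood as a formal power series in $\mathbf s=(s_1,s_2,\dots)$ (expand the integrand in powers of $\mathbf s$ and integrate term by term). Let $\langle\mathrm{tr}M^i\rangle_c(n)=\partial_{s_i}\log Z_n(\mathbf s;\epsilon)|_{\mathbf s=0}$. For each $i\ge1$ there is a unique polynomial in $(n,\epsilon)$ with complex coefficients that equals $\epsilon\langle\mathrm{tr}M^i\rangle_c(n)$ for all integers $n\ge1$ and all $\epsilon$ with $\operatorname{Re}\epsilon>0$.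 Use it to define $\epsilon\langle\mathrm{tr}M^i\rangle_c(n)$ for all $n,\epsilon\in\mathbb C$, and put $$C_1(n;\lambda;\epsilon)=\epsilon\sum_{i\ge1}\frac{\langle\mathrm{tr}M^i\rangle_c(n)}{\lambda^{i+1}},$$ a formal power series in $\lambda^{-1}$. For $\nu\in\mathbb C$ let $\mathrm{He}_\nu(z)$ be the Hermite function $$\mathrm{He}_\nu(z)=-\frac{\Gamma(\nu+1)}{2\pi \mathrm i}\int_C e^{-zt-t^2/2}(-t)^{-\nu-1}\,dt,\qquad|\arg(-t)|<\pi,$$ where $C$ comes from $+\infty$ above the positive real axis, encircles the origin once in the positive direction and returns to $+\infty$ below the positive real axis; for $\nu=-1,-2,\dots$ the right-hand side is replaced by its limit as the index tends to $\nu$. Let $n,\epsilon\in\mathbb C$ with $\epsilon\ne0$, let $\sqrt\epsilon$ be either square root of $\epsilon$, and let $w\in\mathbb C\setminus\{0\}$ satisfy $-\frac{3\pi}4<\arg\frac w{\sqrt\epsilon}<\frac\pi4$ (arguments are taken in $(-\pi,\pi]$). Then for every $\lambda$ in the sector $-\frac{3\pi}4<\arg\frac\lambda{\sqrt\epsilon}<\frac\pi4$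 the integral $$I_1(n;\lambda;\epsilon)=\frac{\mathrm i^{n+1}n}{\epsilon}\int_\lambda^{\infty}\mathrm{He}_{n-1}\Big(\frac\mu{\sqrt\epsilon}\Big)\mathrm{He}_{-n-1}\Big(\mathrm i\frac\mu{\sqrt\epsilon}\Big)d\mu$$ along the ray $\mu=\lambda+tw$, $t\ge0$, converges absolutely (the direction $w=1$, whenever it is admissible, gives the path from $\lambda$ to $+\infty$ parallel to the real axis, and $w=\sqrt\epsilon$ is always admissible), and $$I_1(n;\lambda;\epsilon)-\frac n\lambda\;\sim\;C_1(n;\lambda;\epsilon)$$ to all orders as $\lambda\to\infty$ in the sector, uniformly in closed subsectors: for all $\alpha>-\frac{3\pi}4$, $\beta<\frac\pi4$ and $N\ge0$, the difference of the left-hand side and the truncation of $C_1$ to powers $\lambda^{-j}$ with $j<N$ is $O(|\lambda|^{-N})$ as $\lambda\to\infty$ with $\alpha\le\arg\frac\lambda{\sqrt\epsilon}\le\beta$. -/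

import Mathlib

open Complex MeasureTheory Filter Topology Asymptotics Set

noncomputable section

namespace GUE

/-! ### Hermitian matrices and the GUE partition function -/

/-- The Hermitian matrix with real coordinates `a`: the diagonal entries are `a i i` and, for
`i < j`, the real and imaginary parts of the `(i, j)` entry are `a i j` and `a j i`. This identifies
the space of Hermitian `n × n` matrices with `Fin n → Fin n → ℝ`, and the measure
`dM = ∏ᵢ dMᵢᵢ ∏_{i<j} dRe(Mᵢⱼ) dIm(Mᵢⱼ)` with `volume`. -/
def hermitianOf {n : ℕ} (a : Fin n → Fin n → ℝ) : Matrix (Fin n) (Fin n) ℂ :=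
  Matrix.of fun i j =>
    if i < j then (a i j : ℂ) + I * (a j i : ℂ)
    else if j < i then (a j i : ℂ) - I * (a i j : ℂ)
    else (a i i : ℂ)

/-- `G(n+1) = ∏_{k=1}^{n-1} k!`. -/
def barnesG (n : ℕ) : ℕ := ∏ k ∈ Finset.Icc 1 (n - 1), k.factorial

/-- `Vol(n) = π^{n(n-1)/2} / G(n+1)`. -/
def vol (n : ℕ) : ℂ := (Real.pi : ℂ) ^ (n * (n - 1) / 2) / (barnesG n : ℂ)

/-- The GUE partition function
`Zₙ(s;ε) = (2π)^{-n} ε^{-1/12} / Vol(n) ∫ exp(-(1/ε) tr (M²/2 - ∑_{j ≥ 1} s_j M^j)) dM`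
as a formal power series in `s = (s₁, s₂, …)`: the factor `exp((1/ε) ∑ s_j tr M^j)` is expanded in
powers of `s` and integrated term by term. The integrals converge absolutely for `0 < Re ε`. -/
def partitionFunction (n : ℕ) (ε : ℂ) : MvPowerSeries ℕ+ ℂ := fun m =>
  ((2 * Real.pi : ℂ) ^ n)⁻¹ * ε ^ (-(1 / 12) : ℂ) / vol n *
    ∫ a : Fin n → Fin n → ℝ,
      (m.prod fun j k =>
        ((hermitianOf a ^ (j : ℕ)).trace / ε) ^ k / (k.factorial : ℂ)) *
      exp (-((hermitianOf a ^ 2).trace / (2 * ε)))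

/-- The one-point connected GUE correlator `⟨tr M^i⟩_c(n) = ∂ log Zₙ(s;ε) / ∂s_i` at `s = 0`,
i.e. the coefficient of `s_i` in `Zₙ` divided by the constant coefficient. -/
def correlator (n : ℕ) (ε : ℂ) (i : ℕ+) : ℂ :=
  MvPowerSeries.coeff (Finsupp.single i 1) (partitionFunction n ε) /
    MvPowerSeries.constantCoeff (partitionFunction n ε)

/-- `P`, a polynomial in two variables, continues `ε ⟨tr M^i⟩_c(n)` from positive integers `n` and
`ε` with `0 < Re ε` to all complex values of `n` and `ε`. -/
def IsCorrelatorContinuation (i : ℕ+) (P : MvPolynomial (Fin 2) ℂ) : Prop :=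
  ∀ n : ℕ, 1 ≤ n → ∀ ε : ℂ, 0 < ε.re →
    MvPolynomial.eval ![(n : ℂ), ε] P = ε * correlator n ε i

/-- The one-point series `C₁(n;λ;ε) = ε ∑_{i ≥ 1} ⟨tr M^i⟩_c(n) / λ^{i+1}`, as a formal power series
in `λ⁻¹`, where `P i` is the polynomial in `(n, ε)` that gives `ε ⟨tr M^i⟩_c(n)`. -/
def C₁ (P : ℕ+ → MvPolynomial (Fin 2) ℂ) (n ε : ℂ) : PowerSeries ℂ :=
  PowerSeries.mk fun
    | 0 => 0
    | 1 => 0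
    | i + 2 => MvPolynomial.eval ![n, ε] (P i.succPNat)

/-! ### Hermite functions and the function `I₁` -/

/-- The integral of `f` over the contour that runs from `+∞ + i` to `-1 + i`, on to `-1 - i`, and
back to `+∞ - i`: it encircles the origin once in the positive direction. -/
def contourIntegral (f : ℂ → ℂ) : ℂ :=
  -(∫ x in Ioi (-1 : ℝ), f ((x : ℂ) + I))
    - I * (∫ y in (-1 : ℝ)..1, f (-1 + (y : ℂ) * I))
    + ∫ x in Ioi (-1 : ℝ), f ((x : ℂ) - I)

/-- `-(Γ(ν+1) / 2πi) ∫_C e^{-zt-t²/2} (-t)^{-ν-1} dt` with `|arg(-t)| < π`, meaningful for `ν` not a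
negative integer. -/
def hermiteContour (ν z : ℂ) : ℂ :=
  -(Gamma (ν + 1) / (2 * Real.pi * I)) *
    contourIntegral fun t => exp (-z * t - t ^ 2 / 2) * (-t) ^ (-ν - 1)

/-- The Hermite function `He_ν(z)` for all complex `ν`: the contour integral formula, extended by
continuity in `ν` to the negative integers, where `Γ(ν+1)` has poles and the integral vanishes. -/
def hermiteFun (ν z : ℂ) : ℂ := limUnder (𝓝[≠] ν) fun μ => hermiteContour μ z

/-- The integrand `He_{n-1}(μ/σ) He_{-n-1}(iμ/σ)`, with `σ` a square root of `ε`. -/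
def integrand (n σ μ : ℂ) : ℂ :=
  hermiteFun (n - 1) (μ / σ) * hermiteFun (-n - 1) (I * (μ / σ))

/-- `I₁(n;λ;ε) = (i^{n+1} n / ε) ∫_λ^∞ He_{n-1}(μ/√ε) He_{-n-1}(iμ/√ε) dμ`, where `σ = √ε` and the
path of integration is the ray `μ = λ + t w`, `t ≥ 0`; the path to `+∞` parallel to the real axis is
`w = 1`. -/
def I₁ (n ε σ w l : ℂ) : ℂ :=
  I ^ (n + 1) * n / ε * ∫ t in Ioi (0 : ℝ), integrand n σ (l + (t : ℂ) * w) * w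

/-! ### Asymptotic expansions in a sector -/

/-- The sector `-3π/4 < arg(λ/σ) < π/4`. -/
def sector (σ : ℂ) : Set ℂ :=
  {l | -(3 * Real.pi / 4) < (l / σ).arg ∧ (l / σ).arg < Real.pi / 4}

/-- `f(λ)` is asymptotic to the formal series `∑ c_j λ^{-j}` to all orders as `λ → ∞` within the
sector `-3π/4 < arg(λ/σ) < π/4` (uniformly in every closed subsector, as usual). -/
def IsAsymptoticTo (f : ℂ → ℂ) (c : PowerSeries ℂ) (σ : ℂ) : Prop :=
  ∀ α β : ℝ, -(3 * Real.pi / 4) < α → β < Real.pi / 4 → ∀ N : ℕ,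
    (fun l : ℂ => f l - ∑ j ∈ Finset.range N, PowerSeries.coeff j c * l⁻¹ ^ j)
      =O[Bornology.cobounded ℂ ⊓ 𝓟 {l | α ≤ (l / σ).arg ∧ (l / σ).arg ≤ β}]
    fun l : ℂ => l⁻¹ ^ N

end GUE

end

open Complex MeasureTheory Filter Topology Asymptotics Set

noncomputable section

/-! Both sides are expanded explicitly in powers of `λ⁻¹` and the coefficients agree term by term.

Matrix side. The power sum `tr M^k` is the alternating sum of the hook Schur functions of size `k`.
Up to sign these are the coefficients `h a b` of `s = Σ h a b v^a u^b`, where `det(1 - uM) / det(1 -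
vM) = 1 + (v - u) s`. Euler's relation writes `(a + b + 1) h a b` as `tr (M K)`, where `K` is a
coefficient of `R (1 - uM)⁻¹ (1 - vM)⁻¹` and `R` is the quotient of determinants (`hook_euler`).
Gaussian integration by parts replaces `tr (M K)` by `ε` times the matrix divergence of `K`, and
this divergence is a second order operator in `(u, v)` acting on `s` (`hook_laplace`). Expectations
of hooks therefore satisfy a recursion lowering arm or leg by two. Its solution is a constant times
`∏ (n + j)` over `-b ≤ j ≤ a` (`hookMoment_recursion`, `gaussian_functional_trace_pow`). Summing
over hooks gives `ε ⟨tr M^k⟩` as the explicit polynomial `traceMoment` in `n` and `ε`; uniqueness of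
the continuation is density of the integer points.

Analytic side. For `re ν < -1` the contour collapses onto the positive axis and the Hermite function
becomes `Γ(-ν)⁻¹ ∫₀^∞ e^{-zt-t²/2} t^{-ν-1} dt` (`contourIntegral_eq`, `hermiteContour_eq_laplace`).
Rotating the path by less than `π/4` and expanding `e^{-t²/2}` gives Watson's expansion in a rotated
half-plane (`hermiteLaplace_expansion`). The recurrence `He_{ν+1} = z He_ν - ν He_{ν-1}` carries
existence of the limit, continuity and expansion to every `ν` (`induction_on_re`). In the product
`He_{n-1}(u) He_{-n-1}(iu)` the complex powers combine to `u⁻²`. The first factor bounds `arg u`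
below by `-3π/4`, the second bounds it above by `π/4`: this is the sector. It is a half-plane, so
its closed subcones are convex and contain the rays of integration, and the expansion may be
integrated termwise (`integral_ray_expansion`).

The two sides meet in `traceMoment_two_mul_eq_productCoeff`: the sum over hooks is the Cauchy
product of the two Hermite series, and the factor `2q + 1` is the one produced by integrating
`u^{-2q-2}`. The term `q = 0` is the subtracted `n / λ`. -/

/-! ### Derivations, determinants and power series -/

/-- Derivation of a finite product. -/
theorem Derivation.leibniz_finset_prod {R A ι : Type*} [CommSemiring R] [CommRing A] [Algebra R A]
    [DecidableEq ι] (D : Derivation R A A) (s : Finset ι) (f : ι → A) :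
    D (∏ i ∈ s, f i) = ∑ i ∈ s, (∏ j ∈ s.erase i, f j) * D (f i) := by
  induction s using Finset.induction_on with
  | empty => simp
  | insert a s ha ih =>
    rw [Finset.prod_insert ha, Derivation.leibniz, ih, Finset.sum_insert ha,
      Finset.erase_insert ha, smul_eq_mul, smul_eq_mul, add_comm, Finset.mul_sum]
    congr 1
    refine Finset.sum_congr rfl fun i hi => ?_
    have hne : a ≠ i := fun h => ha (h ▸ hi)
    rw [Finset.erase_insert_of_ne hne, Finset.prod_insert (fun h => ha (Finset.mem_of_mem_erase h))]
    ring

/-- Jacobi's formula for a derivation. -/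
theorem Derivation.det_eq_trace_adjugate_mul {R A ι : Type*} [CommSemiring R] [CommRing A]
    [Algebra R A] [Fintype ι] [DecidableEq ι] (D : Derivation R A A) (N : Matrix ι ι A) :
    D N.det = (N.adjugate * N.map D).trace := by
  have key : ∀ i : ι, (N.adjugate * N.map D) i i
      = ∑ σ : Equiv.Perm ι, Equiv.Perm.sign σ • ((∏ j ∈ Finset.univ.erase i, N (σ j) j) *
        D (N (σ i) i)) := by
    intro i
    have h1 : (N.adjugate * N.map D) i i = (N.updateCol i fun k => D (N k i)).det := by
      rw [Matrix.mul_apply, ← Matrix.cramer_apply, Matrix.cramer_eq_adjugate_mulVec]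
      rfl
    rw [h1, Matrix.det_apply]
    refine Finset.sum_congr rfl fun σ _ => ?_
    rw [← Finset.prod_erase_mul _ _ (Finset.mem_univ i), Matrix.updateCol_self]
    congr 2
    refine Finset.prod_congr rfl fun j hj => ?_
    rw [Matrix.updateCol_ne (Finset.ne_of_mem_erase hj)]
  simp only [Matrix.trace, Matrix.diag]
  simp_rw [key]
  rw [Finset.sum_comm, Matrix.det_apply, map_sum]
  refine Finset.sum_congr rfl fun σ _ => ?_
  have h2 : D (Equiv.Perm.sign σ • ∏ i, N (σ i) i) = Equiv.Perm.sign σ • D (∏ i, N (σ i) i) := by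
    rcases Int.units_eq_one_or (Equiv.Perm.sign σ) with h | h <;> rw [h] <;> simp
  rw [h2, Derivation.leibniz_finset_prod, Finset.smul_sum]

/-- The coefficientwise extension of a derivation to power series. -/
def Derivation.mapPowerSeries {R A : Type*} [CommRing R] [CommRing A] [Algebra R A]
    (D : Derivation R A A) : Derivation R (PowerSeries A) (PowerSeries A) where
  toFun f := PowerSeries.mk fun k => D (PowerSeries.coeff k f)
  map_add' f g := by ext; simp
  map_smul' r f := by
    ext k
    simp [PowerSeries.coeff_mk]
  map_one_eq_zero' := by
    ext k
    simp only [LinearMap.coe_mk, AddHom.coe_mk, PowerSeries.coeff_mk, PowerSeries.coeff_one]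
    split_ifs <;> simp
  leibniz' f g := by
    ext k
    simp only [LinearMap.coe_mk, AddHom.coe_mk, PowerSeries.coeff_mk, PowerSeries.coeff_mul,
      map_sum, Derivation.leibniz, smul_eq_mul, map_add, Finset.sum_add_distrib]
    congr 1
    rw [← Finset.Nat.sum_antidiagonal_swap]
    rfl

@[simp] theorem Derivation.coeff_mapPowerSeries {R A : Type*} [CommRing R] [CommRing A] [Algebra R A]
    (D : Derivation R A A) (k : ℕ) (f : PowerSeries A) :
    PowerSeries.coeff k (D.mapPowerSeries f) = D (PowerSeries.coeff k f) :=
  PowerSeries.coeff_mk k fun j => D (PowerSeries.coeff j f)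

theorem Derivation.mapPowerSeries_X {R A : Type*} [CommRing R] [CommRing A] [Algebra R A]
    (D : Derivation R A A) : D.mapPowerSeries PowerSeries.X = 0 := by
  ext k
  rw [Derivation.coeff_mapPowerSeries, PowerSeries.coeff_X]
  split_ifs <;> simp

theorem Derivation.mapPowerSeries_C {R A : Type*} [CommRing R] [CommRing A] [Algebra R A]
    (D : Derivation R A A) (a : A) : D.mapPowerSeries (PowerSeries.C a) = PowerSeries.C (D a) := by
  ext k
  rw [Derivation.coeff_mapPowerSeries, PowerSeries.coeff_C, PowerSeries.coeff_C]
  split_ifs <;> simp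

/-- The Euler derivation `X d/dX` of the power series ring. -/
def PowerSeries.eulerDerivation (R A : Type*) [CommRing R] [CommRing A] [Algebra R A] :
    Derivation R (PowerSeries A) (PowerSeries A) where
  toFun f := PowerSeries.mk fun k => (k : A) * PowerSeries.coeff k f
  map_add' f g := by ext; simp [mul_add]
  map_smul' r f := by
    ext k
    simp
  map_one_eq_zero' := by
    ext k
    simp only [LinearMap.coe_mk, AddHom.coe_mk, PowerSeries.coeff_mk, PowerSeries.coeff_one]
    split_ifs with h <;> simp [h]
  leibniz' f g := by
    ext k
    simp only [LinearMap.coe_mk, AddHom.coe_mk, PowerSeries.coeff_mk, PowerSeries.coeff_mul,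
      smul_eq_mul, map_add]
    rw [← Finset.Nat.sum_antidiagonal_swap (f := fun p => PowerSeries.coeff p.1 g * _),
      ← Finset.sum_add_distrib, Finset.mul_sum]
    refine Finset.sum_congr rfl fun p hp => ?_
    rw [← Finset.HasAntidiagonal.mem_antidiagonal.1 hp]
    simp only [Prod.fst_swap, Prod.snd_swap, Nat.cast_add]
    ring

@[simp] theorem PowerSeries.coeff_eulerDerivation {R A : Type*} [CommRing R] [CommRing A]
    [Algebra R A] (k : ℕ) (f : PowerSeries A) :
    PowerSeries.coeff k (PowerSeries.eulerDerivation R A f) = (k : A) * PowerSeries.coeff k f :=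
  PowerSeries.coeff_mk k fun j => (j : A) * PowerSeries.coeff j f

theorem PowerSeries.eulerDerivation_X {R A : Type*} [CommRing R] [CommRing A] [Algebra R A] :
    PowerSeries.eulerDerivation R A PowerSeries.X = PowerSeries.X := by
  ext k
  rw [PowerSeries.coeff_eulerDerivation, PowerSeries.coeff_X]
  split_ifs with h <;> simp [h]

theorem PowerSeries.eulerDerivation_C {R A : Type*} [CommRing R] [CommRing A] [Algebra R A]
    (a : A) : PowerSeries.eulerDerivation R A (PowerSeries.C a) = 0 := by
  ext k
  rw [PowerSeries.coeff_eulerDerivation, PowerSeries.coeff_C]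
  split_ifs with h <;> simp [h]

/-! ### Matrices over a differential ring -/

section MatrixDerivation

variable {S T ι : Type*} [CommRing S] [CommRing T] [Algebra S T]

theorem Matrix.map_derivation_mul [Fintype ι] (D : Derivation S T T) (M N : Matrix ι ι T) :
    (M * N).map D = M.map D * N + M * N.map D := by
  ext i j
  simp only [Matrix.map_apply, Matrix.mul_apply, Matrix.add_apply, map_sum, Derivation.leibniz,
    smul_eq_mul, Finset.sum_add_distrib]
  rw [add_comm]
  congr 1
  exact Finset.sum_congr rfl fun k _ => mul_comm _ _

theorem Matrix.map_derivation_one_sub [DecidableEq ι] (D : Derivation S T T) (M : Matrix ι ι T) :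
    (1 - M).map D = -M.map D := by
  ext i j
  simp only [Matrix.map_apply, Matrix.sub_apply, Matrix.neg_apply, map_sub, Matrix.one_apply]
  split_ifs <;> simp

theorem Matrix.map_derivation_inv [Fintype ι] [DecidableEq ι] (D : Derivation S T T) {Y A : Matrix ι ι T}
    (hA : A * (1 - Y) = 1) : A.map D = A * Y.map D * A := by
  have hA' : (1 - Y) * A = 1 := mul_eq_one_comm.1 hA
  have h := congrArg (fun M => M.map D) hA
  simp only [Matrix.map_derivation_mul, Matrix.map_derivation_one_sub] at h
  have h1 : (1 : Matrix ι ι T).map D = 0 := by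
    ext i j
    simp only [Matrix.map_apply, Matrix.one_apply, Matrix.zero_apply]
    split_ifs <;> simp
  rw [h1] at h
  have h2 : A.map D * (1 - Y) = A * Y.map D := by
    rw [Matrix.mul_neg] at h
    exact add_neg_eq_zero.1 h
  calc A.map D = A.map D * ((1 - Y) * A) := by rw [hA', mul_one]
    _ = A * Y.map D * A := by rw [← mul_assoc, h2]

theorem Derivation.trace_map [Fintype ι] (D : Derivation S T T) (M : Matrix ι ι T) :
    D M.trace = (M.map D).trace := by
  simp [Matrix.trace]

/-- The logarithmic derivative of `det(1 - Y) / det(1 - W)`. -/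
theorem Derivation.det_ratio [Fintype ι] [DecidableEq ι] (D : Derivation S T T) {Y W A B : Matrix ι ι T} {R : T}
    (hA : A * (1 - Y) = 1) (hB : B * (1 - W) = 1) (hR : R * (1 - W).det = (1 - Y).det) :
    D R = R * ((B * W.map D).trace - (A * Y.map D).trace) := by
  have key : ∀ {Y A : Matrix ι ι T}, A * (1 - Y) = 1 →
      D (1 - Y).det = -((1 - Y).det * (A * Y.map D).trace) := by
    intro Y A h
    -- The adjugate is the determinant times the inverse, which turns Jacobi's formula into a
    -- logarithmic derivative.
    have hadj : (1 - Y).adjugate = (1 - Y).det • A := by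
      calc (1 - Y).adjugate = A * (1 - Y) * (1 - Y).adjugate := by rw [h, one_mul]
        _ = _ := by rw [mul_assoc, Matrix.mul_adjugate]; simp
    rw [Derivation.det_eq_trace_adjugate_mul, hadj, Matrix.map_derivation_one_sub]
    simp
  have hu : IsUnit (1 - W).det := by
    rw [← Matrix.isUnit_iff_isUnit_det]
    exact IsUnit.of_mul_eq_one _ (mul_eq_one_comm.1 hB)
  have h := congrArg D hR
  rw [Derivation.leibniz, key hA, key hB, smul_eq_mul, smul_eq_mul] at h
  apply hu.mul_right_cancel
  linear_combination h + (A * Y.map D).trace * hR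

end MatrixDerivation

/-! ### Differential equations for the generating function of hook Schur functions -/

section HookGeneratingFunction

variable {S T : Type*} [CommRing S] [CommRing T] [Algebra S T] {n : ℕ}
  {X A B : Matrix (Fin n) (Fin n) T} {u v R s : T} {dU dV : Derivation S T T}
  {D : Fin n → Fin n → Derivation S T T}

/-- Resolvent identity: `v - u` equals `v (1 - uX) - u (1 - vX)`, and each of the two factors
cancels against one resolvent. It trades traces of mixed products for traces in which `u` and `v`
are separated. -/
theorem Matrix.sub_smul_mul_resolvents (hA : A * (1 - u • X) = 1) (hB : B * (1 - v • X) = 1) :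
    (v - u) • (A * B) = v • B - u • A := by
  have hB' : (1 - v • X) * B = 1 := mul_eq_one_comm.1 hB
  have h : (v - u) • (1 : Matrix (Fin n) (Fin n) T) = v • (1 - u • X) - u • (1 - v • X) := by
    rw [smul_sub, smul_sub, smul_smul, smul_smul, mul_comm u v, sub_smul]
    abel
  calc (v - u) • (A * B) = A * ((v - u) • (1 : Matrix (Fin n) (Fin n) T)) * B := by simp
    _ = v • (A * (1 - u • X) * B) - u • (A * ((1 - v • X) * B)) := by
        rw [h, mul_sub, sub_mul]; simp [mul_assoc]
    _ = v • B - u • A := by rw [hA, hB', one_mul, mul_one]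

theorem Matrix.resolvent_smul_mul (hA : A * (1 - u • X) = 1) : A * (u • X) = A - 1 := by
  rw [mul_sub, mul_one] at hA
  rw [← hA]; abel

/-- The Euler operator applied to the generating function of hook Schur functions. -/
theorem hook_euler [IsDomain T] (huv : v - u ≠ 0) (hA : A * (1 - u • X) = 1) (hB : B * (1 - v • X) = 1)
    (hR : R * (1 - v • X).det = (1 - u • X).det) (hs : R = 1 + (v - u) * s)
    (hUX : (u • X).map dU = u • X) (hUX' : (v • X).map dU = 0)
    (hVX : (v • X).map dV = v • X) (hVX' : (u • X).map dV = 0)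
    (hUu : dU u = u) (hUv : dU v = 0) (hVu : dV u = 0) (hVv : dV v = v) :
    s + dU s + dV s = (X * (R • (A * B))).trace := by
  have h1 := dU.det_ratio hA hB hR
  have h2 := dV.det_ratio hA hB hR
  rw [hUX, hUX', Matrix.resolvent_smul_mul hA] at h1
  rw [hVX, hVX', Matrix.resolvent_smul_mul hB] at h2
  have h3 : (v - u) * (X * (R • (A * B))).trace = R * (B.trace - A.trace) := by
    have h4 : (v - u) * (X * (R • (A * B))).trace = R * (X * ((v - u) • (A * B))).trace := by
      simp only [Matrix.mul_smul, Matrix.trace_smul, smul_eq_mul]; ring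
    have hXA : u * (X * A).trace = (A - 1).trace := by
      rw [← Matrix.resolvent_smul_mul hA, Matrix.trace_mul_comm X A]; simp
    have hXB : v * (X * B).trace = (B - 1).trace := by
      rw [← Matrix.resolvent_smul_mul hB, Matrix.trace_mul_comm X B]; simp
    rw [h4, Matrix.sub_smul_mul_resolvents hA hB, mul_sub, Matrix.trace_sub, Matrix.mul_smul,
      Matrix.mul_smul, Matrix.trace_smul, Matrix.trace_smul, smul_eq_mul, smul_eq_mul, hXA, hXB,
      Matrix.trace_sub, Matrix.trace_sub]
    ring
  rw [hs] at h1 h2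
  simp only [map_add, Derivation.map_one_eq_zero, Derivation.leibniz, map_sub, smul_eq_mul, hUu,
    hUv, hVu, hVv, mul_zero, Matrix.trace_zero, Matrix.trace_sub] at h1 h2
  -- Since `v - u` is homogeneous of degree one, the Euler operator applied to `1 + (v - u) s` gives
  -- `v - u` times the left-hand side; the extra `s` comes from differentiating `v - u`.
  apply mul_left_cancel₀ huv
  rw [h3, hs]
  linear_combination h1 + h2

/-- The matrix divergence of `R (1 - uX)⁻¹ (1 - vX)⁻¹`, in terms of resolvent traces. -/
theorem hook_divergence (hA : A * (1 - u • X) = 1) (hB : B * (1 - v • X) = 1)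
    (hR : R * (1 - v • X).det = (1 - u • X).det)
    (hDu : ∀ i j, (u • X).map (D i j) = u • Matrix.single i j 1)
    (hDv : ∀ i j, (v • X).map (D i j) = v • Matrix.single i j 1) :
    ∑ i, ∑ j, D i j ((R • (A * B)) i j) = R * ((v - u) * (A * B * (A * B)).trace
      + u * A.trace * (A * B).trace + v * (A * B).trace * B.trace) := by
  -- A matrix unit between two matrices separates the indices, so the double sum over `i, j` becomes
  -- a product of two traces.
  have hsand : ∀ (M N : Matrix (Fin n) (Fin n) T) (i j : Fin n),
      (M * Matrix.single i j 1 * N : Matrix (Fin n) (Fin n) T) i j = M i i * N j j := by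
    intro M N i j
    rw [Matrix.mul_apply, Finset.sum_eq_single j]
    · simp
    · intro k _ hk
      rw [Matrix.mul_single_apply_of_ne _ _ _ _ _ hk, zero_mul]
    · simp
  -- The logarithmic derivative of `R` is the `(j, i)` entry of `vB - uA`, which the resolvent
  -- identity makes divisible by `v - u`.
  have hDR : ∀ i j, D i j R = R * ((v - u) * (A * B) j i) := by
    intro i j
    rw [(D i j).det_ratio hA hB hR, hDu, hDv]
    have : ∀ M : Matrix (Fin n) (Fin n) T, (M * Matrix.single i j 1).trace = M j i := by
      intro M; simp [Matrix.trace_mul_single]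
    have h := congrFun (congrFun (Matrix.sub_smul_mul_resolvents hA hB) j) i
    simp only [Matrix.smul_apply, Matrix.sub_apply, smul_eq_mul] at h
    rw [h, Matrix.mul_smul, Matrix.mul_smul, Matrix.trace_smul, Matrix.trace_smul, this, this]
    simp
  have hterm : ∀ i j, D i j ((R • (A * B)) i j) = R * ((v - u) * ((A * B) i j * (A * B) j i)
      + u * (A i i * (A * B) j j) + v * ((A * B) i i * B j j)) := by
    intro i j
    have h := congrFun (congrFun (Matrix.map_derivation_mul (D i j) A B) i) j
    rw [Matrix.map_derivation_inv _ hA, Matrix.map_derivation_inv _ hB, hDu, hDv,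
      Matrix.map_apply] at h
    rw [Matrix.smul_apply, smul_eq_mul, Derivation.leibniz, hDR, h]
    have e1 : (A * u • Matrix.single i j 1 * A * B : Matrix (Fin n) (Fin n) T) i j = u * (A i i * (A * B) j j) := by
      rw [Matrix.mul_smul, Matrix.smul_mul, Matrix.smul_mul, mul_assoc _ A B, Matrix.smul_apply,
        hsand, smul_eq_mul]
    have e2 : (A * (B * v • Matrix.single i j 1 * B) : Matrix (Fin n) (Fin n) T) i j = v * ((A * B) i i * B j j) := by
      rw [Matrix.mul_smul, Matrix.smul_mul, Matrix.mul_smul, ← mul_assoc, ← mul_assoc,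
        Matrix.smul_apply, hsand, smul_eq_mul]
    rw [Matrix.add_apply, e1, e2, smul_eq_mul, smul_eq_mul]
    ring
  simp_rw [hterm, ← Finset.mul_sum, Finset.sum_add_distrib, ← Finset.mul_sum]
  have t1 : (A * B * (A * B)).trace = ∑ i, ∑ j, (A * B) i j * (A * B) j i := by
    simp only [Matrix.trace, Matrix.diag, Matrix.mul_apply (M := A * B) (N := A * B)]
  have t2 : ∀ M N : Matrix (Fin n) (Fin n) T, M.trace * N.trace = ∑ i, ∑ j, M i i * N j j := by
    intro M N
    simp only [Matrix.trace, Matrix.diag]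
    rw [Finset.sum_mul_sum]
  rw [t1, mul_assoc u, mul_assoc v, t2, t2]
  simp only [Finset.mul_sum]

/-- The divergence of `R (1 - uX)⁻¹ (1 - vX)⁻¹` is a second order differential operator in
`(u, v)` applied to the generating function `s` of hook Schur functions. -/
theorem hook_laplace [IsDomain T] (huv : v - u ≠ 0) (hA : A * (1 - u • X) = 1) (hB : B * (1 - v • X) = 1)
    (hR : R * (1 - v • X).det = (1 - u • X).det) (hs : R = 1 + (v - u) * s)
    (hUX : (u • X).map dU = u • X) (hUX' : (v • X).map dU = 0)
    (hVX : (v • X).map dV = v • X) (hVX' : (u • X).map dV = 0)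
    (hUu : dU u = u) (hUv : dU v = 0) (hVu : dV u = 0) (hVv : dV v = v)
    (hDu : ∀ i j, (u • X).map (D i j) = u • Matrix.single i j 1)
    (hDv : ∀ i j, (v • X).map (D i j) = v • Matrix.single i j 1) :
    ∑ i, ∑ j, D i j ((R • (A * B)) i j) =
      v ^ 2 * ((n + 2) * (n + 1) * s + (2 * n + 3) * dV s + dV (dV s))
      - u ^ 2 * ((n - 1) * (n - 2) * s - (2 * n - 3) * dU s + dU (dU s))
      + n * (n + 1) * v + n * (n - 1) * u := by
  rw [hook_divergence hA hB hR hDu hDv]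
  set a := A.trace with ha
  set b := B.trace with hb
  set P := (A * B).trace with hP
  set Q := (A * B * (A * B)).trace with hQ
  have hres := Matrix.sub_smul_mul_resolvents hA hB
  have eP : (v - u) * P = v * b - u * a := by
    have := congrArg Matrix.trace hres
    simpa using this
  have e1 : ∀ M : Matrix (Fin n) (Fin n) T,
      (v - u) * (M * (A * B)).trace = v * (M * B).trace - u * (M * A).trace := by
    intro M
    have := congrArg (fun N => (M * N).trace) hres
    simpa [mul_sub] using this
  have eQ : (v - u) ^ 2 * Q = v ^ 2 * (B * B).trace + u ^ 2 * (A * A).trace - 2 * u * v * P := by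
    have h1 := e1 (A * B)
    have h2 := e1 B
    have h3 := e1 A
    rw [Matrix.trace_mul_comm (A * B) B, Matrix.trace_mul_comm (A * B) A] at h1
    rw [Matrix.trace_mul_comm B A] at h2
    linear_combination (v - u) * h1 + v * h2 - u * h3
  have hdUa : dU a = (A * A).trace - a := by
    rw [ha, Derivation.trace_map, Matrix.map_derivation_inv _ hA, hUX, Matrix.resolvent_smul_mul hA,
      sub_mul, one_mul, Matrix.trace_sub]
  have hdVb : dV b = (B * B).trace - b := by
    rw [hb, Derivation.trace_map, Matrix.map_derivation_inv _ hB, hVX, Matrix.resolvent_smul_mul hB,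
      sub_mul, one_mul, Matrix.trace_sub]
  have h1 := dU.det_ratio hA hB hR
  have h2 := dV.det_ratio hA hB hR
  rw [hUX, hUX', Matrix.resolvent_smul_mul hA, mul_zero, Matrix.trace_zero, Matrix.trace_sub,
    Matrix.trace_one, Fintype.card_fin, ← ha] at h1
  rw [hVX, hVX', Matrix.resolvent_smul_mul hB, mul_zero, Matrix.trace_zero, Matrix.trace_sub,
    Matrix.trace_one, Fintype.card_fin, ← hb] at h2
  have h11 := congrArg dU h1
  have h22 := congrArg dV h2
  simp only [map_sub, Derivation.leibniz, smul_eq_mul, map_zero, Derivation.map_natCast, h1, h2,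
    hdUa, hdVb] at h11 h22
  have s1 := h1
  have s2 := h2
  rw [hs] at s1 s2
  simp only [map_add, Derivation.map_one_eq_zero, Derivation.leibniz, map_sub, smul_eq_mul, hUu,
    hUv, hVu, hVv] at s1 s2
  have s11 := congrArg dU h1
  have s22 := congrArg dV h2
  rw [hs] at s11 s22
  simp only [map_add, Derivation.map_one_eq_zero, Derivation.leibniz, map_sub, smul_eq_mul, hUu,
    hUv, hVu, hVv, map_zero, Derivation.map_natCast, hdUa, hdVb] at s11 s22
  have hs' : (v - u) * s = R - 1 := by rw [hs]; ring
  -- The first and second Euler derivatives of `R` contain the traces of `A`, `A²`, `B`, `B²`.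
  -- Solved for the derivatives of `s`, they allow every trace to be eliminated.
  have tU : (v - u) * dU s = R * (n - a) + u * s := by
    rw [hs]; linear_combination s1
  have tV : (v - u) * dV s = R * (b - n) - v * s := by
    rw [hs]; linear_combination s2
  have tUU : (v - u) * dU (dU s)
      = R * (n - a) ^ 2 - R * ((A * A).trace - a) + u * s + 2 * u * dU s := by
    rw [hs]; linear_combination s11 + (n - a) * s1
  have tVV : (v - u) * dV (dV s)
      = R * (b - n) ^ 2 + R * ((B * B).trace - b) - v * s - 2 * v * dV s := by
    rw [hs]; linear_combination s22 + (b - n) * s2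
  set w := v - u with hw
  clear_value w a b P Q
  -- Each relation above carries its own power of `v - u`; the cube clears all of them, and with `v
  -- = w + u` the claim is a linear combination of these relations.
  apply mul_left_cancel₀ (pow_ne_zero 3 huv)
  have hv : v = w + u := by rw [hw]; ring
  subst hv
  linear_combination (R * w ^ 2) * eQ
    + (-2 * u * (w + u) * R * w + R * (u * a + (w + u) * b) * w ^ 2) * eP
    - ((w + u) ^ 2 * w ^ 2) * tVV - ((w + u) ^ 2 * (2 * n + 3) * w ^ 2 - 2 * (w + u) ^ 3 * w) * tV
    + (u ^ 2 * w ^ 2) * tUU - (u ^ 2 * (2 * n - 3) * w ^ 2 - 2 * u ^ 3 * w) * tU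
    - ((w + u) ^ 2 * (n ^ 2 + 3 * n + 2) * w ^ 2 - (w + u) ^ 3 * w - (w + u) ^ 3 * (2 * n + 3) * w
      + 2 * (w + u) ^ 4 - u ^ 2 * (n - 1) * (n - 2) * w ^ 2 - u ^ 3 * w + u ^ 3 * (2 * n - 3) * w
      - 2 * u ^ 4) * hs'

end HookGeneratingFunction

/-! ### Hook Schur functions of a matrix -/

section Hooks

open PowerSeries

variable {S : Type*} [CommRing S] {n : ℕ}

/-- The coefficient of `v ^ a * u ^ b` in a power series in `u` over power series in `v`. -/
def biCoeff (a b : ℕ) : PowerSeries (PowerSeries S) →+ S :=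
  (coeff a : PowerSeries S →ₗ[S] S).toAddMonoidHom.comp
    (coeff b : PowerSeries (PowerSeries S) →ₗ[PowerSeries S] PowerSeries S).toAddMonoidHom

theorem biCoeff_apply (a b : ℕ) (f : PowerSeries (PowerSeries S)) :
    biCoeff a b f = coeff a (coeff b f) := rfl

theorem biCoeff_C_C_mul (a b : ℕ) (c : S) (f : PowerSeries (PowerSeries S)) :
    biCoeff a b (C (C c) * f) = c * biCoeff a b f := by
  simp [biCoeff_apply]

theorem biCoeff_X_pow_mul (a b k : ℕ) (f : PowerSeries (PowerSeries S)) :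
    biCoeff a b (X ^ k * f) = if k ≤ b then biCoeff a (b - k) f else 0 := by
  rw [biCoeff_apply, coeff_X_pow_mul']
  split_ifs <;> simp [biCoeff_apply]

theorem biCoeff_C_X_pow_mul (a b k : ℕ) (f : PowerSeries (PowerSeries S)) :
    biCoeff a b (C X ^ k * f) = if k ≤ a then biCoeff (a - k) b f else 0 := by
  rw [biCoeff_apply, ← map_pow, coeff_C_mul, coeff_X_pow_mul']
  rfl

theorem biCoeff_euler_outer [Algebra ℂ S] (a b : ℕ) (f : PowerSeries (PowerSeries S)) :
    biCoeff a b (eulerDerivation ℂ (PowerSeries S) f) = b * biCoeff a b f := by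
  rw [biCoeff_apply, coeff_eulerDerivation, ← nsmul_eq_mul, map_nsmul, nsmul_eq_mul, biCoeff_apply]

theorem biCoeff_euler_inner [Algebra ℂ S] (a b : ℕ) (f : PowerSeries (PowerSeries S)) :
    biCoeff a b ((eulerDerivation ℂ S).mapPowerSeries f) = a * biCoeff a b f := by
  rw [biCoeff_apply, Derivation.coeff_mapPowerSeries, coeff_eulerDerivation, biCoeff_apply]

theorem biCoeff_map_map [Algebra ℂ S] (D : Derivation ℂ S S) (a b : ℕ) (f : PowerSeries (PowerSeries S)) :
    biCoeff a b (D.mapPowerSeries.mapPowerSeries f) = D (biCoeff a b f) := by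
  rw [biCoeff_apply, Derivation.coeff_mapPowerSeries, Derivation.coeff_mapPowerSeries,
    biCoeff_apply]

theorem biCoeff_X (a b : ℕ) :
    biCoeff a b (X : PowerSeries (PowerSeries S)) = if a = 0 ∧ b = 1 then 1 else 0 := by
  rw [biCoeff_apply, coeff_X]
  by_cases hb : b = 1 <;> by_cases ha : a = 0 <;> simp [ha, hb, coeff_one]

theorem biCoeff_C_X (a b : ℕ) :
    biCoeff a b (C X : PowerSeries (PowerSeries S)) = if a = 1 ∧ b = 0 then 1 else 0 := by
  rw [biCoeff_apply, coeff_C]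
  by_cases hb : b = 0 <;> by_cases ha : a = 1 <;> simp [ha, hb, coeff_X]

/-- The sum of the coefficients of total degree `k` of a multiple of `v - u` vanishes. -/
theorem sum_biCoeff_sub_mul (k : ℕ) (f : PowerSeries (PowerSeries S)) :
    ∑ b ∈ Finset.range (k + 1), biCoeff (k - b) b ((C X - X) * f) = 0 := by
  have h : ∀ b, biCoeff (k - b) b ((C X - X) * f)
      = (if 1 ≤ k - b then biCoeff (k - b - 1) b f else 0)
        - (if 1 ≤ b then biCoeff (k - b) (b - 1) f else 0) := by
    intro b
    rw [sub_mul, map_sub]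
    have h1 := biCoeff_C_X_pow_mul (k - b) b 1 f
    have h2 := biCoeff_X_pow_mul (k - b) b 1 f
    rw [pow_one] at h1 h2
    rw [h1, h2]
  simp_rw [h]
  rw [Finset.sum_sub_distrib, Finset.sum_range_succ, Finset.sum_range_succ' (fun b =>
    if 1 ≤ b then biCoeff (k - b) (b - 1) f else 0)]
  simp only [tsub_self, if_false, add_zero, nonpos_iff_eq_zero, one_ne_zero]
  rw [sub_eq_zero]
  refine Finset.sum_congr rfl fun b hb => ?_
  have hb' := Finset.mem_range.1 hb
  rw [if_pos (by omega), if_pos (by omega), Nat.add_sub_cancel, Nat.sub_sub]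

/-- A matrix over `S`, as a matrix over power series in two variables. -/
def Matrix.toBi (M : Matrix (Fin n) (Fin n) S) :
    Matrix (Fin n) (Fin n) (PowerSeries (PowerSeries S)) := M.map fun x => C (C x)

theorem isUnit_one_sub_X_smul {A : Type*} [CommRing A] (M : Matrix (Fin n) (Fin n) (PowerSeries A)) :
    IsUnit (1 - (X : PowerSeries A) • M).det := by
  rw [isUnit_iff_constantCoeff, RingHom.map_det]
  have : (constantCoeff (R := A)).mapMatrix (1 - (X : PowerSeries A) • M) = 1 := by
    refine Matrix.ext fun i j => ?_
    by_cases h : i = j <;> simp [Matrix.one_apply, h]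
  rw [this]
  simp

/-- Here `v` is the inner variable. The outer constant coefficient leaves the matrix unchanged over
series in `v`, where the preceding lemma applies. -/
theorem isUnit_one_sub_C_X_smul (M : Matrix (Fin n) (Fin n) S) :
    IsUnit (1 - (C X : PowerSeries (PowerSeries S)) • M.toBi).det := by
  rw [isUnit_iff_constantCoeff, RingHom.map_det]
  have : (constantCoeff (R := PowerSeries S)).mapMatrix
      (1 - (C X : PowerSeries (PowerSeries S)) • M.toBi)
      = 1 - (X : PowerSeries S) • M.map (C (R := S)) := by
    refine Matrix.ext fun i j => ?_
    by_cases h : i = j <;> simp [h, Matrix.toBi]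
  rw [this]
  exact isUnit_one_sub_X_smul _

/-- Modulo `v - u` the two determinants coincide. This makes the hook generating function a genuine
power series, with no division by `v - u`. -/
theorem sub_dvd_det_sub_det {T : Type*} [CommRing T] (M : Matrix (Fin n) (Fin n) T) (u v : T) :
    v - u ∣ (1 - u • M).det - (1 - v • M).det := by
  rw [← Ideal.mem_span_singleton, ← Ideal.Quotient.mk_eq_mk_iff_sub_mem, RingHom.map_det,
    RingHom.map_det]
  congr 1
  have h : Ideal.Quotient.mk (Ideal.span {v - u}) u = Ideal.Quotient.mk (Ideal.span {v - u}) v := by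
    rw [eq_comm, Ideal.Quotient.mk_eq_mk_iff_sub_mem]
    exact Ideal.mem_span_singleton_self _
  ext i j
  simp [h]

/-- Neumann series, unfolded one term at a time through `B = 1 + X N B`; the exponent `j` is kept
free because each unfolding raises it. -/
theorem coeff_trace_pow_mul_resolvent {A : Type*} [CommRing A] (M : Matrix (Fin n) (Fin n) A)
    (B : Matrix (Fin n) (Fin n) (PowerSeries A))
    (hB : (1 - (X : PowerSeries A) • M.map (C (R := A))) * B = 1) (k j : ℕ) :
    coeff k ((M.map (C (R := A))) ^ j * B).trace = (M ^ (j + k)).trace := by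
  set N := M.map (C (R := A)) with hN
  have hpow : ∀ j, (N ^ j).trace = C (M ^ j).trace := by
    intro j
    have : N ^ j = (M ^ j).map (C (R := A)) := by
      have := map_pow (C (R := A)).mapMatrix M j
      simpa [hN] using this.symm
    rw [this]
    simp [Matrix.trace]
  have hB' : B = 1 + (X : PowerSeries A) • (N * B) := by
    rw [sub_mul, one_mul, Matrix.smul_mul] at hB
    rw [← hB]; abel
  have hstep : ∀ j, (N ^ j * B).trace = C (M ^ j).trace + X * (N ^ (j + 1) * B).trace := by
    intro j
    conv_lhs => rw [hB']
    rw [mul_add, mul_one, Matrix.trace_add, Matrix.mul_smul, Matrix.trace_smul, ← mul_assoc,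
      ← pow_succ, hpow, smul_eq_mul]
  induction k generalizing j with
  | zero => rw [hstep]; simp
  | succ k ih =>
    rw [hstep, map_add, coeff_succ_X_mul, ih, coeff_C]
    simp [add_comm, add_left_comm]

/-- The hook Schur functions (up to sign) of a matrix `M` over a ring on which matrix derivatives
`D i j` act: they sum to the traces of powers, and satisfy a recursion under the Laplacian. -/
theorem exists_hooks [IsDomain S] [Algebra ℂ S] (M : Matrix (Fin n) (Fin n) S)
    (D : Fin n → Fin n → Derivation ℂ S S)
    (hD : ∀ i j, M.map (D i j) = Matrix.single i j 1) :
    ∃ h : ℕ → ℕ → S,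
      (∀ k, ∑ b ∈ Finset.range (k + 1), h (k - b) b = (M ^ (k + 1)).trace) ∧
      ∀ a b : ℕ, ∃ K : Matrix (Fin n) (Fin n) S,
        ((a : S) + b + 1) * h a b = (M * K).trace ∧
        ∑ i, ∑ j, D i j (K i j) =
          (if 2 ≤ a then ((n : S) + a) * (n + a - 1) * h (a - 2) b else 0)
          - (if 2 ≤ b then ((n : S) + 1 - b) * (n - b) * h a (b - 2) else 0)
          + (if a = 1 ∧ b = 0 then (n : S) * (n + 1) else 0)
          + (if a = 0 ∧ b = 1 then (n : S) * (n - 1) else 0) := by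
  set u : PowerSeries (PowerSeries S) := X with hu
  set v : PowerSeries (PowerSeries S) := C X with hv
  set Y := M.toBi with hY
  set A := (1 - u • Y)⁻¹ with hAdef
  set B := (1 - v • Y)⁻¹ with hBdef
  have uA : IsUnit (1 - u • Y).det := isUnit_one_sub_X_smul _
  have uB : IsUnit (1 - v • Y).det := isUnit_one_sub_C_X_smul _
  have hA : A * (1 - u • Y) = 1 := Matrix.nonsing_inv_mul _ uA
  have hB : B * (1 - v • Y) = 1 := Matrix.nonsing_inv_mul _ uB
  obtain ⟨q, hq⟩ := sub_dvd_det_sub_det Y u v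
  obtain ⟨e, he⟩ := uB
  -- This is `(R - 1) / (v - u)`: the quotient `q` of the difference of determinants, divided by the
  -- unit `det(1 - vM)`.
  set s := q * ↑e⁻¹ with hsdef
  set R := 1 + (v - u) * s with hRdef
  have hR : R * (1 - v • Y).det = (1 - u • Y).det := by
    have h1 : (↑e⁻¹ : PowerSeries (PowerSeries S)) * (1 - v • Y).det = 1 := by
      rw [← he, Units.inv_mul]
    rw [hRdef, hsdef]
    linear_combination (v - u) * q * h1 - hq
  have huv : v - u ≠ 0 := by
    intro h
    have := congrArg (biCoeff 1 0) h
    simp [biCoeff_apply, hu, hv] at this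
  set dU := eulerDerivation ℂ (PowerSeries S) with hdU
  set dV := (eulerDerivation ℂ S).mapPowerSeries with hdV
  set E := fun i j => (D i j).mapPowerSeries.mapPowerSeries with hE
  have hUu : dU u = u := eulerDerivation_X
  have hUv : dU v = 0 := eulerDerivation_C _
  have hVu : dV u = 0 := Derivation.mapPowerSeries_X _
  have hVv : dV v = v := by
    rw [hdV, hv, Derivation.mapPowerSeries_C, eulerDerivation_X]
  have hUY : ∀ i j, dU (Y i j) = 0 := fun i j => eulerDerivation_C _
  have hVY : ∀ i j, dV (Y i j) = 0 := fun i j => by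
    rw [hdV]
    change Derivation.mapPowerSeries _ (C (C (M i j))) = 0
    rw [Derivation.mapPowerSeries_C, eulerDerivation_C, map_zero]
  have hEu : ∀ i j, E i j u = 0 := fun i j => Derivation.mapPowerSeries_X _
  have hEv : ∀ i j, E i j v = 0 := fun i j => by
    rw [hE, hv]
    change Derivation.mapPowerSeries _ (C X) = 0
    rw [Derivation.mapPowerSeries_C, Derivation.mapPowerSeries_X, map_zero]
  have hEY : ∀ i j, Y.map (E i j) = Matrix.single i j 1 := fun i j => by
    refine Matrix.ext fun k l => ?_
    have h := congrFun (congrFun (hD i j) k) l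
    change (D i j).mapPowerSeries.mapPowerSeries (C (C (M k l))) = _
    rw [Derivation.mapPowerSeries_C, Derivation.mapPowerSeries_C]
    rw [Matrix.map_apply] at h
    rw [h, Matrix.single_apply, Matrix.single_apply]
    split_ifs <;> simp
  have hsm : ∀ (d : Derivation ℂ (PowerSeries (PowerSeries S)) (PowerSeries (PowerSeries S)))
      (t : PowerSeries (PowerSeries S)), (t • Y).map d = d t • Y + t • Y.map d := by
    intro d t
    refine Matrix.ext fun i j => ?_
    simp [add_comm, mul_comm]
  have hUY' : Y.map dU = 0 := Matrix.ext hUY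
  have hVY' : Y.map dV = 0 := Matrix.ext hVY
  have hUX : (u • Y).map dU = u • Y := by rw [hsm, hUu, hUY', smul_zero, add_zero]
  have hUX' : (v • Y).map dU = 0 := by rw [hsm, hUv, hUY', smul_zero, add_zero, zero_smul]
  have hVX : (v • Y).map dV = v • Y := by rw [hsm, hVv, hVY', smul_zero, add_zero]
  have hVX' : (u • Y).map dV = 0 := by rw [hsm, hVu, hVY', smul_zero, add_zero, zero_smul]
  have hDu : ∀ i j, (u • Y).map (E i j) = u • Matrix.single i j 1 := fun i j => by
    rw [hsm, hEu, hEY, zero_smul, zero_add]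
  have hDv : ∀ i j, (v • Y).map (E i j) = v • Matrix.single i j 1 := fun i j => by
    rw [hsm, hEv, hEY, zero_smul, zero_add]
  have eul := hook_euler huv hA hB hR hRdef hUX hUX' hVX hVX' hUu hUv hVu hVv
  have lap := hook_laplace huv hA hB hR hRdef hUX hUX' hVX hVX' hUu hUv hVu hVv hDu hDv
  refine ⟨fun a b => biCoeff a b s, fun k => ?_, fun a b =>
    ⟨(R • (A * B)).map (biCoeff a b), ?_, ?_⟩⟩
  · have hdR := dU.det_ratio hA hB hR
    rw [hUX, hUX', mul_zero, Matrix.trace_zero, zero_sub, Matrix.mul_smul, Matrix.trace_smul,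
      smul_eq_mul, Matrix.trace_mul_comm] at hdR
    rw [hRdef] at hdR
    simp only [map_add, Derivation.map_one_eq_zero, Derivation.leibniz, map_sub, smul_eq_mul, hUu,
      hUv] at hdR
    have hu0 : u ≠ 0 := X_ne_zero
    -- On the diagonal `v = u` the series `s` reduces to the resolvent trace. This is read off from
    -- the `u`-derivative of `R` after cancelling `u`, which is possible because `dU s` has no
    -- constant term in `u`.
    obtain ⟨g, hg⟩ : ∃ g, s = (Y * A).trace + (v - u) * g := by
      have h0 : u ∣ (v - u) * dU s := ⟨s - (1 + (v - u) * s) * (Y * A).trace, by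
        linear_combination hdR⟩
      have h1 : u ∣ dU s := by
        rw [hu, X_dvd_iff]
        have : coeff 0 (dU s) = 0 := by simp [hdU]
        simpa using this
      obtain ⟨g', hg'⟩ := h1
      refine ⟨s * (Y * A).trace + g', ?_⟩
      apply mul_left_cancel₀ hu0
      rw [hg'] at hdR
      linear_combination -hdR
    have hsum : ∑ b ∈ Finset.range (k + 1), biCoeff (k - b) b s
        = ∑ b ∈ Finset.range (k + 1), biCoeff (k - b) b (Y * A).trace := by
      conv_lhs => rw [hg]
      simp only [map_add, Finset.sum_add_distrib]
      rw [sum_biCoeff_sub_mul, add_zero]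
    rw [hsum]
    have hA' : (1 - u • (M.map (C (R := S))).map (C (R := PowerSeries S))) * A = 1 :=
      mul_eq_one_comm.1 hA
    -- The resolvent trace does not involve `v`, so among the coefficients of total degree `k` only
    -- `a = 0`, `b = k` survives.
    have hc : ∀ a b, biCoeff a b (Y * A).trace = if a = 0 then (M ^ (b + 1)).trace else 0 := by
      intro a b
      have h := coeff_trace_pow_mul_resolvent _ A hA' b 1
      rw [pow_one] at h
      rw [biCoeff_apply]
      have h2 : (M.map (C (R := S))) ^ (1 + b) = (M ^ (1 + b)).map (C (R := S)) := by
        have := map_pow (C (R := S)).mapMatrix M (1 + b)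
        simpa using this.symm
      have h3 : ((M ^ (1 + b)).map (C (R := S))).trace = C (M ^ (1 + b)).trace := by
        simp [Matrix.trace]
      change coeff a (coeff b (((M.map (C (R := S))).map (C (R := PowerSeries S))) * A).trace) = _
      rw [h, h2, h3, coeff_C, add_comm 1 b]
    simp_rw [hc]
    rw [Finset.sum_range_succ, Finset.sum_eq_zero, zero_add, if_pos (Nat.sub_self k)]
    intro b hb
    rw [if_neg]
    have := Finset.mem_range.1 hb
    omega
  · have h := congrArg (biCoeff a b) eul
    rw [map_add, map_add, hdU, hdV, biCoeff_euler_outer, biCoeff_euler_inner] at h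
    have h2 : biCoeff a b (Y * (R • (A * B))).trace
        = (M * (R • (A * B)).map (biCoeff a b)).trace := by
      simp only [Matrix.trace, Matrix.diag, Matrix.mul_apply (M := Y),
        Matrix.mul_apply (M := M), map_sum]
      refine Finset.sum_congr rfl fun i _ => Finset.sum_congr rfl fun j _ => ?_
      rw [hY]
      change biCoeff a b (C (C (M i j)) * _) = _
      rw [biCoeff_C_C_mul]
      rfl
    rw [← h2, ← h]
    ring
  · have h := congrArg (biCoeff a b) lap
    simp only [map_sum] at h
    have h1 : ∀ i j, biCoeff a b (E i j ((R • (A * B)) i j))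
        = D i j ((R • (A * B)).map (biCoeff a b) i j) := fun i j => biCoeff_map_map _ _ _ _
    simp_rw [h1] at h
    rw [h]
    have hofNat2 : C (C (2 : S)) = 2 := by rw [map_ofNat, map_ofNat]
    have hofNat3 : C (C (3 : S)) = 3 := by rw [map_ofNat, map_ofNat]
    -- The coefficients in `n` are rewritten as constant series so that `biCoeff` can extract them
    -- as scalars.
    have c1 : ((n : PowerSeries (PowerSeries S)) + 2) * (n + 1) = C (C (((n : S) + 2) * (n + 1))) := by
      simp [hofNat2]
    have c2 : (2 * (n : PowerSeries (PowerSeries S)) + 3) = C (C (2 * (n : S) + 3)) := by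
      simp [hofNat2, hofNat3]
    have c3 : ((n : PowerSeries (PowerSeries S)) - 1) * (n - 2) = C (C (((n : S) - 1) * (n - 2))) := by
      simp [hofNat2]
    have c4 : (2 * (n : PowerSeries (PowerSeries S)) - 3) = C (C (2 * (n : S) - 3)) := by
      simp [hofNat2, hofNat3]
    have c5 : (n : PowerSeries (PowerSeries S)) * (n + 1) = C (C ((n : S) * (n + 1))) := by simp
    have c6 : (n : PowerSeries (PowerSeries S)) * (n - 1) = C (C ((n : S) * (n - 1))) := by simp
    rw [c1, c2, c3, c4, c5, c6]
    simp only [AddMonoidHom.map_add, AddMonoidHom.map_sub, hu, hv, biCoeff_X_pow_mul, biCoeff_C_X_pow_mul, biCoeff_C_C_mul,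
      biCoeff_X, biCoeff_C_X, hdU, hdV, biCoeff_euler_outer, biCoeff_euler_inner]
    clear_value s
    clear * -
    congr 1
    · congr 1
      · congr 1
        -- On the coefficient of `v^(a-2)` the operator acts by `(n+2)(n+1) + (2n+3)(a-2) + (a-2)²`,
        -- which factors as `(n+a)(n+a-1)`. The leg case below is analogous, with factors `n+1-b`
        -- and `n-b`.
        · split_ifs with h2
          · obtain ⟨a, rfl⟩ := Nat.exists_eq_add_of_le' h2
            rw [Nat.add_sub_cancel]
            push_cast
            ring
          · rfl
        · split_ifs with h2
          · obtain ⟨b, rfl⟩ := Nat.exists_eq_add_of_le' h2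
            rw [Nat.add_sub_cancel]
            push_cast
            ring
          · rfl
      · rw [mul_ite, mul_one, mul_zero]
    · rw [mul_ite, mul_one, mul_zero]

end Hooks

namespace GUE

/-! ### Moments of a Gaussian functional on matrices -/

/-- The product of the consecutive factors `n - b, …, n + a`. -/
def hookProd (n : ℂ) (a b : ℕ) : ℂ :=
  n * (∏ j ∈ Finset.range a, (n + 1 + j)) * ∏ j ∈ Finset.range b, (n - 1 - j)

theorem hookProd_succ_left (n : ℂ) (a b : ℕ) :
    hookProd n (a + 1) b = (n + 1 + a) * hookProd n a b := by
  rw [hookProd, hookProd, Finset.prod_range_succ]; ring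

theorem hookProd_succ_right (n : ℂ) (a b : ℕ) :
    hookProd n a (b + 1) = (n - 1 - b) * hookProd n a b := by
  rw [hookProd, hookProd, Finset.prod_range_succ]; ring

/-- The coefficient `(-1)^m (ε/2)^{l+m} / (l! m!)`. -/
def hookCoeff (ε : ℂ) (l m : ℕ) : ℂ :=
  (-1) ^ m * (ε / 2) ^ (l + m) / (l.factorial * m.factorial)

theorem hookCoeff_succ_left (ε : ℂ) (l m : ℕ) :
    2 * (l + 1) * hookCoeff ε (l + 1) m = ε * hookCoeff ε l m := by
  have h1 : (l.factorial : ℂ) ≠ 0 := by exact_mod_cast l.factorial_ne_zero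
  have h2 : (m.factorial : ℂ) ≠ 0 := by exact_mod_cast m.factorial_ne_zero
  have h3 : ((l : ℂ) + 1) ≠ 0 := by exact_mod_cast l.succ_ne_zero
  rw [hookCoeff, hookCoeff, Nat.factorial_succ, show l + 1 + m = l + m + 1 by ring, pow_succ]
  push_cast
  field_simp

theorem hookCoeff_succ_right (ε : ℂ) (l m : ℕ) :
    2 * (m + 1) * hookCoeff ε l (m + 1) = -ε * hookCoeff ε l m := by
  have h1 : (l.factorial : ℂ) ≠ 0 := by exact_mod_cast l.factorial_ne_zero
  have h2 : (m.factorial : ℂ) ≠ 0 := by exact_mod_cast m.factorial_ne_zero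
  have h3 : ((m : ℂ) + 1) ≠ 0 := by exact_mod_cast m.succ_ne_zero
  rw [hookCoeff, hookCoeff, Nat.factorial_succ, show l + (m + 1) = l + m + 1 by ring, pow_succ,
    pow_succ]
  push_cast
  field_simp

/-- The Gaussian expectation of the hook Schur function with arm `a` and leg `b`. -/
def hookMoment (n ε : ℂ) (a b : ℕ) : ℂ :=
  if Odd (a + b) then
    ε * hookCoeff ε (a / 2) (b / 2) / (2 * ((a / 2 : ℕ) + (b / 2 : ℕ) + 1)) * hookProd n a b
  else 0

theorem hookMoment_even (n ε : ℂ) {a b : ℕ} (h : ¬Odd (a + b)) : hookMoment n ε a b = 0 :=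
  if_neg h

theorem hookMoment_odd_even (n ε : ℂ) (l m : ℕ) :
    hookMoment n ε (2 * l + 1) (2 * m)
      = ε * hookCoeff ε l m / (2 * (l + m + 1)) * hookProd n (2 * l + 1) (2 * m) := by
  rw [hookMoment, if_pos ⟨l + m, by ring⟩, show (2 * l + 1) / 2 = l by omega,
    show 2 * m / 2 = m by omega]

theorem hookMoment_even_odd (n ε : ℂ) (l m : ℕ) :
    hookMoment n ε (2 * l) (2 * m + 1)
      = ε * hookCoeff ε l m / (2 * (l + m + 1)) * hookProd n (2 * l) (2 * m + 1) := by
  rw [hookMoment, if_pos ⟨l + m, by ring⟩, show (2 * m + 1) / 2 = m by omega,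
    show 2 * l / 2 = l by omega]

/-- The two terms are the fractions `l / (l + m)` and `m / (l + m)` of the left-hand side, and they
add up to it. At `l = m = 0` only the source term remains. -/
theorem hookCoeff_recursion (ε : ℂ) (l m : ℕ) :
    hookCoeff ε l m =
      (if 1 ≤ l then ε * hookCoeff ε (l - 1) m / (2 * (l + m)) else 0)
      - (if 1 ≤ m then ε * hookCoeff ε l (m - 1) / (2 * (l + m)) else 0)
      + if l = 0 ∧ m = 0 then 1 else 0 := by
  rcases l with _ | l <;> rcases m with _ | m
  · simp [hookCoeff]
  · have h := hookCoeff_succ_right ε 0 m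
    have h3 : ((m : ℂ) + 1) ≠ 0 := by exact_mod_cast m.succ_ne_zero
    simp
    field_simp
    linear_combination h
  · have h := hookCoeff_succ_left ε l 0
    have h3 : ((l : ℂ) + 1) ≠ 0 := by exact_mod_cast l.succ_ne_zero
    simp
    field_simp
    linear_combination h
  · have h := hookCoeff_succ_left ε l (m + 1)
    have h' := hookCoeff_succ_right ε (l + 1) m
    have h3 : ((l : ℂ) + 1 + (m + 1)) ≠ 0 := by exact_mod_cast (l + 1 + m).succ_ne_zero
    simp
    field_simp
    linear_combination h + h'

/-- This is the recursion that integration by parts imposes on expectations of hooks. The factors in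
`n` are exactly those gained by `hookProd` when arm or leg grows by two, so the numerical part is
`hookCoeff_recursion`. The two source terms start the recursion at the hooks of size two. -/
theorem hookMoment_recursion (n ε : ℂ) (a b : ℕ) :
    ((a : ℂ) + b + 1) * hookMoment n ε a b = ε * (
      (if 2 ≤ a then (n + a) * (n + a - 1) * hookMoment n ε (a - 2) b else 0)
      - (if 2 ≤ b then (n + 1 - b) * (n - b) * hookMoment n ε a (b - 2) else 0)
      + (if a = 1 ∧ b = 0 then n * (n + 1) else 0)
      + (if a = 0 ∧ b = 1 then n * (n - 1) else 0)) := by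
  have key : ∀ l m : ℕ, ((l : ℂ) + m + 1) ≠ 0 := fun l m => by exact_mod_cast (l + m).succ_ne_zero
  by_cases hodd : Odd (a + b)
  swap
  · rw [Nat.odd_iff] at hodd
    have e1 : 2 ≤ a → hookMoment n ε (a - 2) b = 0 := fun h =>
      hookMoment_even n ε (by rw [Nat.odd_iff]; omega)
    have e2 : 2 ≤ b → hookMoment n ε a (b - 2) = 0 := fun h =>
      hookMoment_even n ε (by rw [Nat.odd_iff]; omega)
    rw [hookMoment_even n ε (by rwa [Nat.odd_iff]), if_neg (by omega : ¬ (a = 1 ∧ b = 0)),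
      if_neg (by omega : ¬ (a = 0 ∧ b = 1))]
    split_ifs with h1 h2 h2 <;> simp [*]
  rcases Nat.even_or_odd' a with ⟨l, rfl | rfl⟩ <;> rcases Nat.even_or_odd' b with ⟨m, rfl | rfl⟩
  · exact absurd hodd (by simp [parity_simps])
  · have h0 : (((2 * l : ℕ) : ℂ) + ((2 * m + 1 : ℕ) : ℂ) + 1) * hookMoment n ε (2 * l) (2 * m + 1)
        = ε * hookCoeff ε l m * hookProd n (2 * l) (2 * m + 1) := by
      rw [hookMoment_even_odd]
      have := key l m
      push_cast
      field_simp
      ring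
    rw [h0, hookCoeff_recursion, mul_assoc]
    congr 1
    rw [if_neg (by omega : ¬ (2 * l = 1 ∧ _)), add_zero, add_mul, sub_mul]
    congr 1
    · congr 1
      · rcases l with _ | l
        · simp
        · rw [if_pos (by omega), if_pos (by omega), show 2 * (l + 1) - 2 = 2 * l by omega,
            Nat.add_sub_cancel, hookMoment_even_odd, show 2 * (l + 1) = 2 * l + 1 + 1 by ring,
            hookProd_succ_left, hookProd_succ_left]
          push_cast
          ring
      · rcases m with _ | m
        · simp
        · rw [if_pos (by omega), if_pos (by omega), show 2 * (m + 1) + 1 - 2 = 2 * m + 1 by omega,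
            Nat.add_sub_cancel, hookMoment_even_odd, show 2 * (m + 1) + 1 = 2 * m + 1 + 1 + 1 by ring,
            hookProd_succ_right, hookProd_succ_right n _ (2 * m + 1)]
          push_cast
          ring
    · rcases l with _ | l <;> rcases m with _ | m <;> simp [hookProd]
  · have h0 : (((2 * l + 1 : ℕ) : ℂ) + ((2 * m : ℕ) : ℂ) + 1) * hookMoment n ε (2 * l + 1) (2 * m)
        = ε * hookCoeff ε l m * hookProd n (2 * l + 1) (2 * m) := by
      rw [hookMoment_odd_even]
      have := key l m
      push_cast
      field_simp
      ring
    rw [h0, hookCoeff_recursion, mul_assoc]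
    congr 1
    rw [if_neg (by omega : ¬ (2 * l + 1 = 0 ∧ _)), add_zero, add_mul, sub_mul]
    congr 1
    · congr 1
      · rcases l with _ | l
        · simp
        · rw [if_pos (by omega), if_pos (by omega), show 2 * (l + 1) + 1 - 2 = 2 * l + 1 by omega,
            Nat.add_sub_cancel, hookMoment_odd_even, show 2 * (l + 1) + 1 = 2 * l + 1 + 1 + 1 by ring,
            hookProd_succ_left, hookProd_succ_left n (2 * l + 1)]
          push_cast
          ring
      · rcases m with _ | m
        · simp
        · rw [if_pos (by omega), if_pos (by omega), show 2 * (m + 1) - 2 = 2 * m by omega,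
            Nat.add_sub_cancel, hookMoment_odd_even, show 2 * (m + 1) = 2 * m + 1 + 1 by ring,
            hookProd_succ_right, hookProd_succ_right n _ (2 * m)]
          push_cast
          ring
    · rcases l with _ | l <;> rcases m with _ | m <;> simp [hookProd]
  · exact absurd hodd (by simp [parity_simps])

/-- The Gaussian expectation of `tr M ^ k`, as a polynomial in `n` and `ε`. -/
def traceMoment (n ε : ℂ) (k : ℕ) : ℂ :=
  if Even k then (1 / (k + 1)) * ∑ m ∈ Finset.range (k / 2 + 1),
    hookCoeff ε (k / 2 - m) m * hookProd n (2 * (k / 2 - m)) (2 * m)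
  else 0

theorem traceMoment_two_mul (n ε : ℂ) (q : ℕ) :
    traceMoment n ε (2 * q) = (1 / (2 * q + 1)) * ∑ m ∈ Finset.range (q + 1),
      hookCoeff ε (q - m) m * hookProd n (2 * (q - m)) (2 * m) := by
  rw [traceMoment, if_pos (even_two_mul q), Nat.mul_div_cancel_left q two_pos]
  push_cast
  rfl

theorem sum_range_two_mul {A : Type*} [AddCommMonoid A] (f : ℕ → A) (p : ℕ) :
    ∑ b ∈ Finset.range (2 * p), f b = ∑ m ∈ Finset.range p, (f (2 * m) + f (2 * m + 1)) := by
  induction p with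
  | zero => simp
  | succ p ih =>
    rw [show 2 * (p + 1) = 2 * p + 1 + 1 by ring, Finset.sum_range_succ, Finset.sum_range_succ, ih,
      Finset.sum_range_succ, add_assoc]

/-- Hooks of equal size are grouped in pairs with legs `2m` and `2m + 1`. Each pair contributes to
two consecutive terms of the target sum. -/
theorem sum_hookMoment (n ε : ℂ) (k : ℕ) :
    ∑ b ∈ Finset.range (k + 1), hookMoment n ε (k - b) b = traceMoment n ε (k + 1) := by
  rcases Nat.even_or_odd' k with ⟨p, rfl | rfl⟩
  · rw [traceMoment, if_neg (by simp [parity_simps])]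
    refine Finset.sum_eq_zero fun b hb => hookMoment_even n ε ?_
    rw [Nat.sub_add_cancel (by have := Finset.mem_range.1 hb; omega)]
    simp
  rw [show 2 * p + 1 + 1 = 2 * (p + 1) by ring, sum_range_two_mul, traceMoment_two_mul]
  have hp1 : ((p : ℂ) + 1) ≠ 0 := by exact_mod_cast p.succ_ne_zero
  have hp2 : (2 * ((p + 1 : ℕ) : ℂ) + 1) ≠ 0 := by exact_mod_cast (2 * (p + 1)).succ_ne_zero
  set F := fun m => hookCoeff ε (p + 1 - m) m * hookProd n (2 * (p + 1 - m)) (2 * m) with hF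
  -- The weight `p + 1` of `F m` is split as `(p + 1 - m) + m`: the first part comes from the pair
  -- `m`, the second from the pair `m - 1`.
  have h1 : ((p : ℂ) + 1) * ∑ m ∈ Finset.range (p + 1 + 1), F m
      = ∑ m ∈ Finset.range (p + 1), (((p + 1 - m : ℕ) : ℂ) * F m + (m + 1) * F (m + 1)) := by
    rw [Finset.mul_sum, Finset.sum_add_distrib]
    have : ∀ m ∈ Finset.range (p + 1 + 1),
        ((p : ℂ) + 1) * F m = ((p + 1 - m : ℕ) : ℂ) * F m + m * F m := by
      intro m hm
      rw [Nat.cast_sub (by have := Finset.mem_range.1 hm; omega)]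
      push_cast
      ring
    rw [Finset.sum_congr rfl this, Finset.sum_add_distrib, Finset.sum_range_succ,
      Finset.sum_range_succ' (fun m => (m : ℂ) * F m)]
    simp
  have h2 : ∀ m ∈ Finset.range (p + 1),
      hookMoment n ε (2 * p + 1 - 2 * m) (2 * m)
        + hookMoment n ε (2 * p + 1 - (2 * m + 1)) (2 * m + 1)
      = 1 / (2 * ((p + 1 : ℕ) : ℂ) + 1) / (p + 1) *
        (((p + 1 - m : ℕ) : ℂ) * F m + (m + 1) * F (m + 1)) := by
    intro m hm
    obtain ⟨l, rfl⟩ : ∃ l, p = l + m := ⟨p - m, by have := Finset.mem_range.1 hm; omega⟩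
    have hc1 := hookCoeff_succ_left ε l m
    have hc2 := hookCoeff_succ_right ε l m
    rw [show 2 * (l + m) + 1 - 2 * m = 2 * l + 1 by omega,
      show 2 * (l + m) + 1 - (2 * m + 1) = 2 * l by omega, hookMoment_odd_even,
      hookMoment_even_odd, hF]
    simp only
    rw [show l + m + 1 - m = l + 1 by omega, show l + m + 1 - (m + 1) = l by omega,
      show 2 * (l + 1) = 2 * l + 1 + 1 by ring, show 2 * (m + 1) = 2 * m + 1 + 1 by ring,
      hookProd_succ_left n (2 * l + 1), hookProd_succ_right n _ (2 * m + 1), hookProd_succ_left,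
      hookProd_succ_right]
    push_cast at hp1 hp2 ⊢
    field_simp
    linear_combination
      -((n + 1 + (2 * l + 1)) * (n + 1 + 2 * l)) * hookProd n (2 * l) (2 * m) * hc1
      - ((n - 1 - (2 * m + 1)) * (n - 1 - 2 * m)) * hookProd n (2 * l) (2 * m) * hc2
  rw [Finset.sum_congr rfl h2, ← Finset.mul_sum, ← h1]
  field_simp

/-- The expectation of `tr M ^ k` under a functional satisfying Gaussian integration by parts. -/
theorem gaussian_functional_trace_pow {S : Type*} [CommRing S] [IsDomain S] [Algebra ℂ S] {n : ℕ}
    (ε : ℂ) (M : Matrix (Fin n) (Fin n) S) (D : Fin n → Fin n → Derivation ℂ S S)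
    (hD : ∀ i j, M.map (D i j) = Matrix.single i j 1) (φ : S →ₗ[ℂ] ℂ) (h1 : φ 1 = 1)
    (hφ : ∀ i j f, φ (M i j * f) = ε * φ (D j i f)) (k : ℕ) :
    φ (M ^ (k + 1)).trace = traceMoment n ε (k + 1) := by
  obtain ⟨h, hsum, hrec⟩ := exists_hooks M D hD
  have hcast : ∀ (z : ℂ) (f : S), φ (algebraMap ℂ S z * f) = z * φ f := fun z f => by
    rw [← Algebra.smul_def, map_smul, smul_eq_mul]
  -- Strong induction on `a + b`, since the recursion lowers it by two.
  have key : ∀ N a b, a + b < N → φ (h a b) = hookMoment n ε a b := by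
    intro N
    induction N with
    | zero => intro a b hab; omega
    | succ N ih =>
      intro a b hab
      obtain ⟨K, hK1, hK2⟩ := hrec a b
      have hne : ((a : ℂ) + b + 1) ≠ 0 := by exact_mod_cast (a + b).succ_ne_zero
      apply mul_left_cancel₀ hne
      rw [hookMoment_recursion]
      have e1 : ((a : ℂ) + b + 1) * φ (h a b) = φ (((a : S) + b + 1) * h a b) := by
        rw [← hcast]; simp
      -- Integration by parts in each summand `M i j * K j i` produces `D j i (K j i)`; swapping the
      -- two sums gives the divergence of `K`.
      have e2 : φ (M * K).trace = ε * φ (∑ i, ∑ j, D i j (K i j)) := by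
        simp only [Matrix.trace, Matrix.diag, Matrix.mul_apply, map_sum, hφ, Finset.mul_sum]
        rw [Finset.sum_comm]
      rw [e1, hK1, e2, hK2]
      congr 1
      have hz : ∀ z : ℂ, φ (algebraMap ℂ S z) = z := fun z => by
        have := hcast z 1
        rwa [mul_one, h1, mul_one] at this
      simp only [map_add, map_sub]
      congr 1
      · congr 1
        · congr 1
          · split_ifs with ha
            · rw [← ih _ _ (by omega), ← hcast]; simp
            · simp
          · split_ifs with ha
            · rw [← ih _ _ (by omega), ← hcast]; simp
            · simp
        · split_ifs with ha
          · rw [← hz ((n : ℂ) * (n + 1))]; simp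
          · simp
      · split_ifs with ha
        · rw [← hz ((n : ℂ) * (n - 1))]; simp
        · simp
  rw [← hsum, map_sum, ← sum_hookMoment]
  exact Finset.sum_congr rfl fun b _ => key _ _ _ (Nat.lt_succ_self _)

end GUE

namespace GUE

/-! ### Gaussian integrals of polynomials -/

theorem integrable_pow_mul_cexp_neg_mul_sq {b : ℂ} (hb : 0 < b.re) (m : ℕ) :
    Integrable fun x : ℝ => (x : ℂ) ^ m * cexp (-b * (x : ℂ) ^ 2) := by
  have h := integrable_rpow_mul_exp_neg_mul_sq hb (s := m) (by linarith [m.cast_nonneg (α := ℝ)])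
  refine h.mono (by fun_prop) (ae_of_all _ fun x => le_of_eq ?_)
  rw [norm_mul, norm_pow, norm_mul, Complex.norm_exp, Complex.norm_real, Real.rpow_natCast,
    norm_pow, Real.norm_eq_abs (Real.exp _), Real.abs_exp]
  congr 2
  rw [← ofReal_pow, neg_mul, neg_re, re_mul_ofReal, neg_mul]

/-- The moments of a complex Gaussian weight on the line. -/
def gaussMoment (b : ℂ) (m : ℕ) : ℂ := ∫ x : ℝ, (x : ℂ) ^ m * cexp (-b * (x : ℂ) ^ 2)

/-- The integral over the line of the derivative of `x^m exp(-b x²)` vanishes. For `m = 0` the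
truncated `m - 1` is harmless because of the factor `m`. -/
theorem gaussMoment_succ {b : ℂ} (hb : 0 < b.re) (m : ℕ) :
    2 * b * gaussMoment b (m + 1) = m * gaussMoment b (m - 1) := by
  have h0 : ∀ x : ℝ, HasDerivAt (fun x : ℝ => (x : ℂ) ^ m * cexp (-b * (x : ℂ) ^ 2))
      (m * ((x : ℂ) ^ (m - 1) * cexp (-b * (x : ℂ) ^ 2))
        - 2 * b * ((x : ℂ) ^ (m + 1) * cexp (-b * (x : ℂ) ^ 2))) x := by
    intro x
    have hx : HasDerivAt (fun x : ℝ => (x : ℂ)) 1 x := Complex.ofRealCLM.hasDerivAt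
    have h := (hx.pow m).mul (((hx.pow 2).const_mul (-b)).cexp)
    convert! h using 1
    simp only [Pi.pow_apply]
    rw [pow_succ]
    push_cast
    ring
  have hi := ((integrable_pow_mul_cexp_neg_mul_sq hb (m - 1)).const_mul (m : ℂ))
  have hi' := ((integrable_pow_mul_cexp_neg_mul_sq hb (m + 1)).const_mul (2 * b))
  have h := integral_eq_zero_of_hasDerivAt_of_integrable h0 (hi.sub hi')
    (integrable_pow_mul_cexp_neg_mul_sq hb m)
  rw [integral_sub hi hi', integral_const_mul, integral_const_mul] at h
  exact (sub_eq_zero.1 h).symm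

theorem gaussMoment_zero_ne_zero {b : ℂ} (hb : 0 < b.re) : gaussMoment b 0 ≠ 0 := by
  have hb0 : b ≠ 0 := fun h => by simp [h] at hb
  simp only [gaussMoment, pow_zero, one_mul]
  rw [integral_gaussian_complex hb, Ne, cpow_eq_zero_iff]
  exact fun h => div_ne_zero (ofReal_ne_zero.2 Real.pi_ne_zero) hb0 h.1

section Functional

variable {n : ℕ} {b : Fin n → Fin n → ℂ}

/-- Evaluation of a polynomial at a point with real coordinates. -/
def evalAt (a : Fin n → Fin n → ℝ) : MvPolynomial (Fin n × Fin n) ℂ →+* ℂ :=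
  MvPolynomial.eval fun s => (a s.1 s.2 : ℂ)

/-- The product Gaussian weight with parameters `b`. -/
def gaussWeight (b : Fin n → Fin n → ℂ) (a : Fin n → Fin n → ℝ) : ℂ :=
  ∏ i, ∏ j, cexp (-b i j * (a i j : ℂ) ^ 2)

theorem evalAt_monomial_mul_gaussWeight (m : Fin n × Fin n →₀ ℕ) (a : Fin n → Fin n → ℝ) :
    evalAt a (MvPolynomial.monomial m 1) * gaussWeight b a
      = ∏ i, ∏ j, ((a i j : ℂ) ^ m (i, j) * cexp (-b i j * (a i j : ℂ) ^ 2)) := by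
  rw [evalAt, MvPolynomial.eval_monomial, one_mul, Finsupp.prod_fintype _ _ (fun _ => pow_zero _),
    Fintype.prod_prod_type, gaussWeight, ← Finset.prod_mul_distrib]
  simp_rw [← Finset.prod_mul_distrib]

theorem integrable_evalAt (hb : ∀ i j, 0 < (b i j).re) (q : MvPolynomial (Fin n × Fin n) ℂ) :
    Integrable fun a : Fin n → Fin n → ℝ => evalAt a q * gaussWeight b a := by
  induction q using MvPolynomial.induction_on' with
  | monomial m c =>
    have h1 : (MvPolynomial.monomial m c : MvPolynomial (Fin n × Fin n) ℂ)
        = MvPolynomial.C c * MvPolynomial.monomial m 1 := by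
      rw [MvPolynomial.C_mul_monomial, mul_one]
    have h2 : (fun a : Fin n → Fin n → ℝ => evalAt a (MvPolynomial.monomial m c) * gaussWeight b a)
        = fun a => c * ∏ i, ∏ j, ((a i j : ℂ) ^ m (i, j) * cexp (-b i j * (a i j : ℂ) ^ 2)) := by
      funext a
      rw [h1, map_mul, mul_assoc, evalAt_monomial_mul_gaussWeight]
      simp [evalAt]
    rw [h2]
    refine Integrable.const_mul ?_ c
    exact Integrable.fintype_prod (f := fun i (x : Fin n → ℝ) =>
      ∏ j, ((x j : ℂ) ^ m (i, j) * cexp (-b i j * (x j : ℂ) ^ 2))) fun i =>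
      Integrable.fintype_prod (f := fun j (x : ℝ) => (x : ℂ) ^ m (i, j) *
        cexp (-b i j * (x : ℂ) ^ 2)) fun j => integrable_pow_mul_cexp_neg_mul_sq (hb i j) _
  | add p q hp hq =>
    simp only [map_add, add_mul]
    exact hp.add hq

theorem integral_monomial (m : Fin n × Fin n →₀ ℕ) :
    ∫ a : Fin n → Fin n → ℝ, evalAt a (MvPolynomial.monomial m 1) * gaussWeight b a
      = ∏ s : Fin n × Fin n, gaussMoment (b s.1 s.2) (m s) := by
  simp_rw [evalAt_monomial_mul_gaussWeight]
  rw [integral_fintype_prod_volume_eq_prod (fun i (x : Fin n → ℝ) =>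
    ∏ j, ((x j : ℂ) ^ m (i, j) * cexp (-b i j * (x j : ℂ) ^ 2))), Fintype.prod_prod_type]
  refine Finset.prod_congr rfl fun i _ => ?_
  exact integral_fintype_prod_volume_eq_prod (fun j (x : ℝ) => (x : ℂ) ^ m (i, j) *
    cexp (-b i j * (x : ℂ) ^ 2))

/-- Integration of polynomials against the product Gaussian weight. -/
def gaussFunctional (b : Fin n → Fin n → ℂ) (hb : ∀ i j, 0 < (b i j).re) :
    MvPolynomial (Fin n × Fin n) ℂ →ₗ[ℂ] ℂ where
  toFun q := ∫ a : Fin n → Fin n → ℝ, evalAt a q * gaussWeight b a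
  map_add' p q := by
    simp only [map_add, add_mul]
    exact integral_add (integrable_evalAt hb p) (integrable_evalAt hb q)
  map_smul' c q := by
    simp only [MvPolynomial.smul_eq_C_mul, map_mul, mul_assoc, RingHom.id_apply, smul_eq_mul]
    rw [← integral_const_mul]
    simp [evalAt]

/-- Gaussian integration by parts. On monomials the integral is a product of one-variable moments,
and only the factor of the coordinate `s` changes. -/
theorem gaussFunctional_X_mul (hb : ∀ i j, 0 < (b i j).re) (s : Fin n × Fin n)
    (q : MvPolynomial (Fin n × Fin n) ℂ) :
    2 * b s.1 s.2 * gaussFunctional b hb (MvPolynomial.X s * q)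
      = gaussFunctional b hb (MvPolynomial.pderiv s q) := by
  induction q using MvPolynomial.induction_on' with
  | monomial m c =>
    have h1 : ∀ (m : Fin n × Fin n →₀ ℕ) (c : ℂ),
        gaussFunctional b hb (MvPolynomial.monomial m c)
          = c * ∏ s : Fin n × Fin n, gaussMoment (b s.1 s.2) (m s) := by
      intro m c
      have : (MvPolynomial.monomial m c : MvPolynomial (Fin n × Fin n) ℂ)
          = c • MvPolynomial.monomial m 1 := by
        rw [MvPolynomial.smul_monomial, smul_eq_mul, mul_one]
      rw [this, map_smul, smul_eq_mul]
      congr 1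
      exact integral_monomial m
    rw [MvPolynomial.X, MvPolynomial.monomial_mul, one_mul, MvPolynomial.pderiv_monomial, h1, h1,
      ← Finset.mul_prod_erase _ _ (Finset.mem_univ s),
      ← Finset.mul_prod_erase _ _ (Finset.mem_univ s)]
    have h2 := gaussMoment_succ (hb s.1 s.2) (m s)
    have h3 : ∀ t ∈ Finset.univ.erase s,
        gaussMoment (b t.1 t.2) ((Finsupp.single s 1 + m : Fin n × Fin n →₀ ℕ) t)
          = gaussMoment (b t.1 t.2) ((m - Finsupp.single s 1 : Fin n × Fin n →₀ ℕ) t) := by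
      intro t ht
      have : Finsupp.single s 1 t = 0 := Finsupp.single_eq_of_ne (Finset.ne_of_mem_erase ht)
      rw [Finsupp.add_apply, Finsupp.tsub_apply, this, zero_add, tsub_zero]
    rw [Finset.prod_congr rfl h3, Finsupp.add_apply, Finsupp.tsub_apply, Finsupp.single_eq_same,
      add_comm 1 (m s)]
    linear_combination c * (∏ t ∈ Finset.univ.erase s,
      gaussMoment (b t.1 t.2) ((m - Finsupp.single s 1 : Fin n × Fin n →₀ ℕ) t)) * h2
  | add p q hp hq =>
    rw [mul_add, map_add, map_add, map_add, mul_add, hp, hq]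

theorem gaussFunctional_one_ne_zero (hb : ∀ i j, 0 < (b i j).re) : gaussFunctional b hb 1 ≠ 0 := by
  have : gaussFunctional b hb 1 = ∏ s : Fin n × Fin n, gaussMoment (b s.1 s.2) 0 :=
    integral_monomial 0
  rw [this]
  exact Finset.prod_ne_zero_iff.2 fun s _ => gaussMoment_zero_ne_zero (hb _ _)

end Functional

/-! ### The generic Hermitian matrix -/

section Hermitian

variable {n : ℕ}

open MvPolynomial in
/-- The Hermitian matrix whose real coordinates are indeterminates. -/
def genericHermitian (n : ℕ) : Matrix (Fin n) (Fin n) (MvPolynomial (Fin n × Fin n) ℂ) :=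
  Matrix.of fun i j =>
    if i < j then X (i, j) + C I * X (j, i)
    else if j < i then X (j, i) - C I * X (i, j)
    else X (i, i)

theorem evalAt_genericHermitian (a : Fin n → Fin n → ℝ) :
    (evalAt a).mapMatrix (genericHermitian n) = hermitianOf a := by
  refine Matrix.ext fun i j => ?_
  simp only [RingHom.mapMatrix_apply, Matrix.map_apply, genericHermitian, hermitianOf,
    Matrix.of_apply, evalAt]
  split_ifs <;> simp

theorem evalAt_trace_pow (a : Fin n → Fin n → ℝ) (k : ℕ) :
    evalAt a (genericHermitian n ^ k).trace = (hermitianOf a ^ k).trace := by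
  rw [← evalAt_genericHermitian, ← map_pow, RingHom.mapMatrix_apply]
  simp [Matrix.trace]

open MvPolynomial in
/-- The derivative with respect to the `(i, j)` entry of a Hermitian matrix. -/
def matrixDeriv (i j : Fin n) :
    Derivation ℂ (MvPolynomial (Fin n × Fin n) ℂ) (MvPolynomial (Fin n × Fin n) ℂ) :=
  if i < j then (1 / 2 : ℂ) • (pderiv (i, j) - I • pderiv (j, i))
  else if j < i then (1 / 2 : ℂ) • (pderiv (j, i) + I • pderiv (i, j))
  else pderiv (i, i)

/-- Wirtinger calculus: an entry and its complex conjugate, the transposed entry, behave as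
independent variables under the combinations `(∂_x ∓ i ∂_y) / 2`. -/
theorem map_matrixDeriv (i j : Fin n) :
    (genericHermitian n).map (matrixDeriv i j) = Matrix.single i j 1 := by
  have hI : (MvPolynomial.C I * MvPolynomial.C I : MvPolynomial (Fin n × Fin n) ℂ) = -1 := by
    rw [← MvPolynomial.C_mul, I_mul_I]; simp
  have h2 : (MvPolynomial.C (1 / 2) : MvPolynomial (Fin n × Fin n) ℂ) * 2 = 1 := by
    rw [show (2 : MvPolynomial (Fin n × Fin n) ℂ) = MvPolynomial.C 2 from
      (map_ofNat MvPolynomial.C 2).symm, ← MvPolynomial.C_mul]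
    norm_num
  refine Matrix.ext fun k l => ?_
  rw [Matrix.map_apply, genericHermitian, Matrix.of_apply, matrixDeriv, Matrix.single_apply]
  split_ifs <;>
  simp only [map_add, map_sub, Derivation.smul_apply, Derivation.sub_apply, Derivation.add_apply,
    MvPolynomial.pderiv_C_mul, MvPolynomial.pderiv_X, Pi.single_apply, Prod.mk.injEq,
    MvPolynomial.smul_eq_C_mul] <;>
  split_ifs
  all_goals first
    | (simp only [mul_one, mul_zero, sub_zero, add_zero]; done)
    | (exfalso; grind)
    | (simp only [mul_one, mul_zero, zero_sub, zero_add]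
       first
         | linear_combination h2
         | linear_combination h2 - MvPolynomial.C (1 / 2) * hI
         | linear_combination -MvPolynomial.C (1 / 2) * hI
         | linear_combination MvPolynomial.C (1 / 2) * hI)

/-- The parameters of the Gaussian weight `exp(-tr M² / (2ε))` in real coordinates. -/
def gueParam (n : ℕ) (ε : ℂ) (i j : Fin n) : ℂ := if i = j then 1 / (2 * ε) else 1 / ε

theorem gueParam_re_pos {ε : ℂ} (hε : 0 < ε.re) (i j : Fin n) : 0 < (gueParam n ε i j).re := by
  have hn : 0 < normSq ε := normSq_pos.2 fun h => by simp [h] at hε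
  have h1 : 0 < (1 / ε).re := by
    rw [one_div, inv_re]; positivity
  rw [gueParam]
  split_ifs
  · have h2 : (1 / (2 * ε)).re = (1 / ε).re / 2 := by
      have : 1 / (2 * ε) = ((1 / 2 : ℝ) : ℂ) * (1 / ε) := by
        push_cast; rw [one_div_mul_one_div]
      rw [this, re_ofReal_mul]
      ring
    rw [h2]
    positivity
  · exact h1

/-- Off-diagonal coordinates occur twice in `tr M²`, hence their parameter is twice the diagonal
one. -/
theorem gaussWeight_gueParam (ε : ℂ) (a : Fin n → Fin n → ℝ) :
    gaussWeight (gueParam n ε) a = cexp (-((hermitianOf a ^ 2).trace / (2 * ε))) := by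
  -- For `ε = 0` division by zero makes both exponents vanish, so this case is set apart and closed
  -- trivially.
  have h1 : ∀ i j, hermitianOf a i j * hermitianOf a j i
      = ε * gueParam n ε i j * (a i j : ℂ) ^ 2 + ε * gueParam n ε j i * (a j i : ℂ) ^ 2
        ∨ ε = 0 := by
    intro i j
    by_cases hε : ε = 0
    · exact Or.inr hε
    left
    simp only [hermitianOf, Matrix.of_apply, gueParam]
    rcases lt_trichotomy i j with h | rfl | h
    · rw [if_pos h, if_neg h.not_gt, if_pos h, if_neg h.ne, if_neg h.ne']
      field_simp
      linear_combination -(a j i : ℂ) ^ 2 * I_mul_I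
    · simp only [lt_irrefl, if_false, if_true]
      field_simp
      ring
    · rw [if_neg h.not_gt, if_pos h, if_pos h, if_neg h.ne, if_neg h.ne']
      field_simp
      linear_combination -(a i j : ℂ) ^ 2 * I_mul_I
  rw [gaussWeight]
  simp_rw [← Complex.exp_sum]
  congr 1
  by_cases hε : ε = 0
  · simp [hε, gueParam]
  simp only [hε, or_false] at h1
  have h2 : (hermitianOf a ^ 2).trace = 2 * ∑ i, ∑ j, ε * gueParam n ε i j * (a i j : ℂ) ^ 2 := by
    rw [pow_two, Matrix.trace]
    simp only [Matrix.diag, Matrix.mul_apply, h1, Finset.sum_add_distrib]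
    rw [two_mul]
    congr 1
    exact Finset.sum_comm
  rw [h2]
  simp only [mul_assoc, ← Finset.mul_sum]
  field_simp
  simp

/-- Multiplication by an off-diagonal real coordinate becomes `(ε / 2) ∂`. Thus `x + iy` becomes `(ε
/ 2)(∂_x + i ∂_y)`, which is `ε` times the derivative in the conjugate entry; this is why the
indices are transposed. -/
theorem gaussFunctional_genericHermitian_mul {ε : ℂ} (hε : 0 < ε.re) (i j : Fin n)
    (f : MvPolynomial (Fin n × Fin n) ℂ) :
    gaussFunctional (gueParam n ε) (gueParam_re_pos hε) (genericHermitian n i j * f)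
      = ε * gaussFunctional (gueParam n ε) (gueParam_re_pos hε) (matrixDeriv j i f) := by
  have hε0 : ε ≠ 0 := fun h => by simp [h] at hε
  set φ := gaussFunctional (gueParam n ε) (gueParam_re_pos hε) with hφ
  have hd : φ (MvPolynomial.X (i, i) * f) = ε * φ (MvPolynomial.pderiv (i, i) f) := by
    have h := gaussFunctional_X_mul (gueParam_re_pos hε) (i, i) f
    rw [← hφ] at h
    simp only [gueParam, if_true] at h
    rw [← h]
    field_simp
  have ho : ∀ k l : Fin n, k ≠ l →
      φ (MvPolynomial.X (k, l) * f) = ε / 2 * φ (MvPolynomial.pderiv (k, l) f) := by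
    intro k l hkl
    have h := gaussFunctional_X_mul (gueParam_re_pos hε) (k, l) f
    rw [← hφ] at h
    simp only [gueParam, if_neg hkl] at h
    rw [← h]
    field_simp
  have hC : ∀ (c : ℂ) g, φ (MvPolynomial.C c * g) = c * φ g := fun c g => by
    rw [← MvPolynomial.smul_eq_C_mul, map_smul, smul_eq_mul]
  rw [genericHermitian, Matrix.of_apply, matrixDeriv]
  rcases lt_trichotomy i j with h | rfl | h
  · rw [if_pos h, if_neg h.not_gt, if_pos h, add_mul, map_add, mul_assoc, hC, ho _ _ h.ne,
      ho _ _ h.ne']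
    simp only [Derivation.smul_apply, Derivation.add_apply, map_smul, map_add, smul_eq_mul]
    ring
  · simp only [lt_irrefl, if_false]
    exact hd
  · rw [if_neg h.not_gt, if_pos h, if_pos h, sub_mul, map_sub, mul_assoc, hC, ho _ _ h.ne,
      ho _ _ h.ne']
    simp only [Derivation.smul_apply, Derivation.sub_apply, map_smul, map_sub, smul_eq_mul]
    ring

/-- The one-point correlator of the GUE is an explicit polynomial. -/
theorem mul_correlator_eq {ε : ℂ} (hε : 0 < ε.re) (i : ℕ+) :
    ε * correlator n ε i = traceMoment n ε i := by
  have hε0 : ε ≠ 0 := fun h => by simp [h] at hε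
  set φ := gaussFunctional (gueParam n ε) (gueParam_re_pos hε) with hφ
  have hZ : φ 1 ≠ 0 := gaussFunctional_one_ne_zero _
  have hval : ∀ q, φ q = ∫ a : Fin n → Fin n → ℝ,
      evalAt a q * cexp (-((hermitianOf a ^ 2).trace / (2 * ε))) := by
    intro q
    simp_rw [← gaussWeight_gueParam]
    rfl
  -- The normalisation cancels in the logarithmic derivative; only its being nonzero matters.
  set c : ℂ := ((2 * Real.pi : ℂ) ^ n)⁻¹ * ε ^ (-(1 / 12) : ℂ) / vol n with hc
  have hc0 : c ≠ 0 := by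
    have hpi : (Real.pi : ℂ) ≠ 0 := ofReal_ne_zero.2 Real.pi_ne_zero
    refine div_ne_zero (mul_ne_zero (inv_ne_zero (pow_ne_zero _ (mul_ne_zero two_ne_zero hpi))) ?_)
      (div_ne_zero (pow_ne_zero _ hpi) ?_)
    · rw [Ne, cpow_eq_zero_iff]
      exact fun h => hε0 h.1
    · exact Nat.cast_ne_zero.2 (Finset.prod_ne_zero_iff.2 fun k _ => k.factorial_ne_zero)
  have h0 : MvPowerSeries.constantCoeff (partitionFunction n ε) = c * φ 1 := by
    rw [hval, ← MvPowerSeries.coeff_zero_eq_constantCoeff_apply]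
    change c * _ = _
    congr 1
    refine integral_congr_ae (ae_of_all _ fun a => ?_)
    simp
  have h1 : MvPowerSeries.coeff (Finsupp.single i 1) (partitionFunction n ε)
      = c * (φ (genericHermitian n ^ (i : ℕ)).trace / ε) := by
    rw [hval]
    change c * _ = _
    congr 1
    rw [← integral_div]
    refine integral_congr_ae (ae_of_all _ fun a => ?_)
    simp only [evalAt_trace_pow]
    rw [Finsupp.prod_single_index (by simp)]
    simp
    ring
  -- The functional is divided by its total mass so that it takes the value one at `1`.
  have h2 := gaussian_functional_trace_pow ε (genericHermitian n) matrixDeriv map_matrixDeriv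
    ((φ 1)⁻¹ • φ) (by simp [hZ]) (fun k l f => by
      rw [LinearMap.smul_apply, LinearMap.smul_apply, hφ, gaussFunctional_genericHermitian_mul hε,
        smul_eq_mul, smul_eq_mul]
      ring) (i - 1)
  rw [Nat.sub_add_cancel i.pos, LinearMap.smul_apply, smul_eq_mul] at h2
  rw [correlator, h0, h1, ← h2]
  field_simp

end Hermitian

end GUE

namespace GUE

/-! ### Polynomial continuation of the correlators -/

theorem exists_polynomial_traceMoment (k : ℕ) :
    ∃ P : MvPolynomial (Fin 2) ℂ, ∀ n ε : ℂ, MvPolynomial.eval ![n, ε] P = traceMoment n ε k := by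
  by_cases hk : Even k
  · refine ⟨MvPolynomial.C (1 / ((k : ℂ) + 1)) * ∑ m ∈ Finset.range (k / 2 + 1),
      (MvPolynomial.C ((-1) ^ m * (1 / 2) ^ (k / 2 - m + m)
          / (((k / 2 - m).factorial : ℂ) * m.factorial)) * MvPolynomial.X 1 ^ (k / 2 - m + m))
        * (MvPolynomial.X 0 * (∏ j ∈ Finset.range (2 * (k / 2 - m)),
            (MvPolynomial.X 0 + 1 + MvPolynomial.C (j : ℂ)))
          * ∏ j ∈ Finset.range (2 * m), (MvPolynomial.X 0 - 1 - MvPolynomial.C (j : ℂ))),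
      fun n ε => ?_⟩
    rw [traceMoment, if_pos hk]
    simp only [map_mul, map_sum, MvPolynomial.eval_C, map_pow, MvPolynomial.eval_X, map_prod,
      map_add, map_sub, map_one, Matrix.cons_val_zero, Matrix.cons_val_one]
    congr 1
    refine Finset.sum_congr rfl fun m _ => ?_
    rw [hookProd, hookCoeff, div_eq_mul_one_div ε 2, mul_pow]
    ring
  · exact ⟨0, fun n ε => by rw [traceMoment, if_neg hk, map_zero]⟩

/-- A polynomial in two variables is determined by its values on a product of two infinite sets;
positive integers suffice in both variables. -/
theorem eq_of_eval_eq {P Q : MvPolynomial (Fin 2) ℂ}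
    (h : ∀ n : ℕ, 1 ≤ n → ∀ ε : ℂ, 0 < ε.re →
      MvPolynomial.eval ![(n : ℂ), ε] P = MvPolynomial.eval ![(n : ℂ), ε] Q) : P = Q := by
  refine MvPolynomial.funext_set
    ![Set.range fun n : ℕ => ((n + 1 : ℕ) : ℂ), Set.range fun n : ℕ => ((n + 1 : ℕ) : ℂ)] ?_ ?_
  · have hinf : (Set.range fun n : ℕ => ((n + 1 : ℕ) : ℂ)).Infinite :=
      Set.infinite_range_of_injective fun a b hab => by
        have : a + 1 = b + 1 := by exact_mod_cast hab
        omega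
    intro i
    fin_cases i <;> exact hinf
  · intro x hx
    obtain ⟨n, hn⟩ := hx 0 (Set.mem_univ _)
    obtain ⟨m, hm⟩ := hx 1 (Set.mem_univ _)
    have hx' : x = ![((n + 1 : ℕ) : ℂ), x 1] := by
      funext i
      fin_cases i
      · exact hn.symm
      · rfl
    rw [hx']
    refine h (n + 1) (by omega) (x 1) ?_
    rw [← hm]
    simp only [natCast_re]
    positivity

theorem existsUnique_correlatorContinuation (i : ℕ+) :
    ∃! P : MvPolynomial (Fin 2) ℂ, IsCorrelatorContinuation i P := by
  obtain ⟨P, hP⟩ := exists_polynomial_traceMoment i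
  refine ⟨P, fun n _ ε hε => by rw [hP, mul_correlator_eq hε], fun Q hQ => ?_⟩
  exact eq_of_eval_eq fun n hn ε hε => by rw [hQ n hn ε hε, hP, mul_correlator_eq hε]

theorem IsCorrelatorContinuation.eval_eq {i : ℕ+} {P : MvPolynomial (Fin 2) ℂ}
    (hP : IsCorrelatorContinuation i P) (n ε : ℂ) :
    MvPolynomial.eval ![n, ε] P = traceMoment n ε i := by
  obtain ⟨Q, hQ⟩ := exists_polynomial_traceMoment i
  rw [← hQ]
  congr 1
  exact eq_of_eval_eq fun n hn ε hε => by rw [hP n hn ε hε, hQ, mul_correlator_eq hε]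

/-- The coefficients of the one-point series. -/
theorem coeff_C₁ {P : ℕ+ → MvPolynomial (Fin 2) ℂ} (hP : ∀ i, IsCorrelatorContinuation i (P i))
    (n ε : ℂ) (j : ℕ) :
    PowerSeries.coeff j (C₁ P n ε) = if 2 ≤ j then traceMoment n ε (j - 1) else 0 := by
  rw [C₁, PowerSeries.coeff_mk]
  rcases j with _ | _ | j
  · simp
  · simp
  · simp only [(hP _).eval_eq]
    rw [if_pos (by omega)]
    simp

end GUE

namespace GUE

/-! ### Contour integrals over half-strips -/

theorem integrableOn_Ioi_of_exp_bound {f : ℝ → ℂ} {a C : ℝ} (hf : ContinuousOn f (Ici a))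
    (hC : ∀ x, 1 ≤ x → ‖f x‖ ≤ C * Real.exp (-x)) : IntegrableOn f (Ioi a) := by
  have h1 : IntegrableOn (fun x => ‖f x‖) (Ioi a) := by
    refine integrable_of_isBigO_exp_neg one_pos hf.norm (IsBigO.of_bound C ?_)
    filter_upwards [eventually_ge_atTop 1] with x hx
    rw [norm_norm, Real.norm_eq_abs, Real.abs_exp, neg_one_mul]
    exact hC x hx
  exact (integrable_norm_iff
    ((hf.mono Ioi_subset_Ici_self).aestronglyMeasurable measurableSet_Ioi)).1 h1

/-- Cauchy's theorem for the half-strip `-1 < re`, `c < im < d`. -/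
theorem integral_halfStrip {f : ℂ → ℂ} {c d C : ℝ} (hcd : c ≤ d)
    (hf : ContinuousOn f {t | c ≤ t.im ∧ t.im ≤ d})
    (hd : DifferentiableOn ℂ f {t | c < t.im ∧ t.im < d})
    (hC : ∀ x y : ℝ, 1 ≤ x → c ≤ y → y ≤ d → ‖f (x + y * I)‖ ≤ C * Real.exp (-x)) :
    (∫ x in Ioi (-1 : ℝ), f (x + c * I)) - (∫ x in Ioi (-1 : ℝ), f (x + d * I))
      = I * ∫ y in c..d, f (-1 + y * I) := by
  have hline : ∀ y : ℝ, c ≤ y → y ≤ d →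
      IntegrableOn (fun x : ℝ => f (x + y * I)) (Ioi (-1)) := by
    intro y h1 h2
    refine integrableOn_Ioi_of_exp_bound ?_ fun x hx => hC x y hx h1 h2
    refine Continuous.continuousOn ?_
    rw [← continuousOn_univ]
    exact hf.comp (by fun_prop) fun x _ => by simp [h1, h2]
  have hrect : ∀ X : ℝ, (∫ x in (-1 : ℝ)..X, f (x + c * I)) - (∫ x in (-1 : ℝ)..X, f (x + d * I))
      + I * (∫ y in c..d, f (X + y * I)) = I * ∫ y in c..d, f (-1 + y * I) := by
    intro X
    have h := integral_boundary_rect_eq_zero_of_continuousOn_of_differentiableOn f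
      ((-1 : ℝ) + c * I) (X + d * I) (hf.mono ?_) (hd.mono ?_)
    · simp only [add_re, ofReal_re, mul_re, I_re, mul_zero, ofReal_im, I_im, mul_one, sub_self,
        add_zero, add_im, mul_im, zero_add, smul_eq_mul] at h
      push_cast at h
      linear_combination h
    · intro t ht
      rw [mem_reProdIm] at ht
      simpa [uIcc_of_le hcd] using ht.2
    · intro t ht
      rw [mem_reProdIm] at ht
      simpa [min_eq_left hcd, max_eq_right hcd] using ht.2
  -- The right edge of the rectangle, at real part `X`, contributes at most `C e^{-X} (d - c)`.
  have hlim : Tendsto (fun X : ℝ => (∫ x in (-1 : ℝ)..X, f (x + c * I))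
      - (∫ x in (-1 : ℝ)..X, f (x + d * I)) + I * (∫ y in c..d, f (X + y * I))) atTop
      (𝓝 ((∫ x in Ioi (-1 : ℝ), f (x + c * I)) - (∫ x in Ioi (-1 : ℝ), f (x + d * I)) + I * 0)) := by
    refine ((intervalIntegral_tendsto_integral_Ioi _ (hline c le_rfl hcd) tendsto_id).sub
      (intervalIntegral_tendsto_integral_Ioi _ (hline d hcd le_rfl) tendsto_id)).add
      (tendsto_const_nhds.mul ?_)
    have h0 : Tendsto (fun X : ℝ => C * Real.exp (-X) * |d - c|) atTop (𝓝 (C * 0 * |d - c|)) :=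
      (tendsto_const_nhds.mul (Real.tendsto_exp_neg_atTop_nhds_zero)).mul_const _
    rw [mul_zero, zero_mul] at h0
    refine squeeze_zero_norm' ?_ h0
    filter_upwards [eventually_ge_atTop 1] with X hX
    refine intervalIntegral.norm_integral_le_of_norm_le_const fun y hy => ?_
    rw [uIoc_of_le hcd] at hy
    exact hC X y hX hy.1.le hy.2
  rw [funext hrect, mul_zero, add_zero] at hlim
  exact tendsto_nhds_unique hlim tendsto_const_nhds

/-- The Gaussian factor in the integrand of the Hermite function. -/
def hermiteKernel (z t : ℂ) : ℂ := cexp (-z * t - t ^ 2 / 2)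

/-- The Gaussian beats the exponential and the power uniformly in the strip `|im| ≤ 1`. The
unimodular factor `c` lets one bound serve the branches of `(-t)^s`, `(it)^s` and `(-it)^s`. -/
theorem norm_hermiteKernel_mul_cpow_le (s z : ℂ) : ∃ C : ℝ, ∀ c : ℂ, ‖c‖ = 1 →
    ∀ x y : ℝ, 1 ≤ x → |y| ≤ 1 →
      ‖hermiteKernel z (x + y * I) * (c * (x + y * I)) ^ s‖ ≤ C * Real.exp (-x) := by
  -- All linear growth in `x`, plus one more unit for the decay `e^{-x}`; completing the square in
  -- `x - B` costs the constant `B² / 2`.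
  set B := |z.re| + |s.re| + 1 with hB
  refine ⟨Real.exp (|z.im| + 1 / 2 + B ^ 2 / 2 + |s.re| + Real.pi * |s.im|),
    fun c hc x y hx hy => ?_⟩
  set t : ℂ := x + y * I with ht
  have htre : t.re = x := by simp [ht]
  have htim : t.im = y := by simp [ht]
  have ht1 : 1 ≤ ‖t‖ := hx.trans (by rw [← htre]; exact re_le_norm t)
  have ht2 : ‖t‖ ≤ Real.exp x := by
    have h1 : ‖t‖ ≤ |x| + |y| := by
      rw [← htre, ← htim]; exact norm_le_abs_re_add_abs_im t
    rw [abs_of_nonneg (by linarith)] at h1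
    linarith [Real.add_one_le_exp x]
  have h1 : ‖hermiteKernel z t‖ ≤ Real.exp (|z.re| * x + |z.im| - x ^ 2 / 2 + 1 / 2) := by
    rw [hermiteKernel, Complex.norm_exp, Real.exp_le_exp]
    have : (-z * t - t ^ 2 / 2).re = -(z.re * x) + z.im * y - x ^ 2 / 2 + y ^ 2 / 2 := by
      rw [pow_two t, sub_re, div_ofNat_re, mul_re, mul_re, neg_re, neg_im, htre, htim]
      ring
    rw [this]
    have hy2 : y ^ 2 ≤ 1 := by rw [← sq_abs]; nlinarith [abs_nonneg y]
    have hz1 : -(z.re * x) ≤ |z.re| * x := by nlinarith [neg_abs_le z.re]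
    have hz2 : z.im * y ≤ |z.im| := by
      calc z.im * y ≤ |z.im * y| := le_abs_self _
        _ = |z.im| * |y| := abs_mul _ _
        _ ≤ |z.im| * 1 := by gcongr
        _ = |z.im| := mul_one _
    linarith
  have h2 : ‖(c * t) ^ s‖ ≤ Real.exp (|s.re| * x + Real.pi * |s.im|) := by
    refine (norm_cpow_le _ _).trans ?_
    rw [norm_mul, hc, one_mul, div_eq_mul_inv, ← Real.exp_neg, Real.exp_add]
    gcongr
    · calc ‖t‖ ^ s.re ≤ ‖t‖ ^ |s.re| := Real.rpow_le_rpow_of_exponent_le ht1 (le_abs_self _)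
        _ ≤ Real.exp x ^ |s.re| := Real.rpow_le_rpow (norm_nonneg _) ht2 (abs_nonneg _)
        _ = Real.exp (|s.re| * x) := by rw [← Real.exp_mul, mul_comm]
    · calc -((c * t).arg * s.im) ≤ |(c * t).arg * s.im| := neg_le_abs _
        _ = |(c * t).arg| * |s.im| := abs_mul _ _
        _ ≤ Real.pi * |s.im| := by gcongr; exact abs_arg_le_pi _
  rw [norm_mul]
  refine (mul_le_mul h1 h2 (norm_nonneg _) (Real.exp_pos _).le).trans ?_
  rw [← Real.exp_add, ← Real.exp_add, Real.exp_le_exp]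
  have := sq_nonneg (x - B)
  have h3 := abs_nonneg s.re
  nlinarith

/-- The half-strips have the branch point on their boundary, so continuity is needed on the closed
half-plane, including the origin. -/
theorem continuousAt_const_cpow {w s : ℂ} (hs : 0 < s.re) (hw : 0 ≤ w.re) :
    ContinuousAt (fun w : ℂ => w ^ s) w := by
  by_cases h : w = 0
  · subst h
    exact (continuousAt_cpow_zero_of_re_pos hs).comp
      (f := fun w : ℂ => (w, s)) (continuousAt_id.prodMk continuousAt_const)
  · have hmem : w ∈ slitPlane := by
      by_contra hc
      rw [mem_slitPlane_iff] at hc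
      push Not at hc
      exact h (Complex.ext (le_antisymm hc.1 hw) hc.2)
    exact (hasStrictDerivAt_id w).hasDerivAt.cpow_const hmem |>.continuousAt

theorem mul_cpow_of_arg {p w s : ℂ} (hp : p ≠ 0) (hw : w ≠ 0)
    (h : p.arg + w.arg ∈ Ioc (-Real.pi) Real.pi) : (p * w) ^ s = p ^ s * w ^ s := by
  rw [cpow_def_of_ne_zero (mul_ne_zero hp hw), cpow_def_of_ne_zero hp, cpow_def_of_ne_zero hw,
    Complex.log_mul hp hw h, add_mul, Complex.exp_add]

/-- In the upper half-plane `-it` has positive real part, so `(-it)^s` is a branch that extends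
continuously down to the real axis, across which `(-t)^s` jumps. -/
theorem neg_cpow_upper {t s : ℂ} (h : 0 < t.im ∨ (t.im = 0 ∧ t.re < 0)) :
    (-t) ^ s = (-I) ^ s * (-I * t) ^ s := by
  have h1 : -t = -I * (-I * t) := by linear_combination -t * I_mul_I
  have hne : -I * t ≠ 0 := by
    refine mul_ne_zero (neg_ne_zero.2 I_ne_zero) ?_
    rintro rfl
    simp at h
  conv_lhs => rw [h1]
  refine mul_cpow_of_arg (neg_ne_zero.2 I_ne_zero) hne ?_
  have hre : (-I * t).re = t.im := by simp
  have him : (-I * t).im = -t.re := by simp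
  have h2 : |(-I * t).arg| ≤ Real.pi / 2 := abs_arg_le_pi_div_two_iff.2 (by
    rw [hre]; rcases h with h | h
    · exact h.le
    · exact h.1.ge)
  have h3 : -(Real.pi / 2) < (-I * t).arg := by
    rcases h with h | h
    · exact (abs_lt.1 ((abs_arg_lt_pi_div_two_iff).2 (Or.inl (by rw [hre]; exact h)))).1
    · have : 0 ≤ (-I * t).arg := arg_nonneg_iff.2 (by rw [him]; linarith [h.2])
      linarith [Real.pi_pos]
  rw [arg_neg_I]
  have := abs_le.1 h2
  constructor <;> linarith [Real.pi_pos]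

theorem neg_cpow_lower {t s : ℂ} (h : t.im < 0 ∨ (t.im = 0 ∧ t.re < 0)) :
    (-t) ^ s = I ^ s * (I * t) ^ s := by
  have h1 : -t = I * (I * t) := by linear_combination -t * I_mul_I
  have hne : I * t ≠ 0 := by
    refine mul_ne_zero I_ne_zero ?_
    rintro rfl
    simp at h
  conv_lhs => rw [h1]
  refine mul_cpow_of_arg I_ne_zero hne ?_
  have hre : (I * t).re = -t.im := by simp
  have h2 : |(I * t).arg| ≤ Real.pi / 2 := abs_arg_le_pi_div_two_iff.2 (by
    rw [hre]; rcases h with h | h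
    · linarith
    · linarith [h.1])
  rw [arg_I]
  have := abs_le.1 h2
  constructor <;> linarith [Real.pi_pos]

theorem differentiable_hermiteKernel (z : ℂ) : Differentiable ℂ (hermiteKernel z) := by
  unfold hermiteKernel
  fun_prop

/-- The Laplace-type integral that represents the Hermite functions of negative index. -/
def hermiteLaplace (s z : ℂ) : ℂ := ∫ t in Ioi (0 : ℝ), hermiteKernel z t * (t : ℂ) ^ s

/-- Collapsing the contour onto the positive real axis. -/
theorem contourIntegral_eq {s : ℂ} (hs : 0 < s.re) (z : ℂ) :
    contourIntegral (fun t => hermiteKernel z t * (-t) ^ s)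
      = 2 * I * sin (Real.pi * s) * hermiteLaplace s z := by
  obtain ⟨C, hC⟩ := norm_hermiteKernel_mul_cpow_le s z
  have hcont : ∀ c : ℂ, ∀ t : ℂ, 0 ≤ (c * t).re →
      ContinuousAt (fun t => hermiteKernel z t * (c * t) ^ s) t := fun c t h =>
    (differentiable_hermiteKernel z).continuous.continuousAt.mul
      (ContinuousAt.comp (f := fun t => c * t) (g := fun w : ℂ => w ^ s)
        (continuousAt_const_cpow hs h) (by fun_prop))
  have hdiff : ∀ c : ℂ, ∀ t : ℂ, 0 < (c * t).re →
      DifferentiableAt ℂ (fun t => hermiteKernel z t * (c * t) ^ s) t := fun c t h =>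
    (differentiable_hermiteKernel z).differentiableAt.mul
      (DifferentiableAt.cpow_const (by fun_prop) (Or.inl h))
  -- Cauchy's theorem is applied separately above and below the real axis, each time with a branch
  -- whose cut lies outside the half-strip.
  have hup := integral_halfStrip (f := fun t => hermiteKernel z t * (-I * t) ^ s) (c := 0) (d := 1)
    (C := C) zero_le_one
    (fun t ht => (hcont _ t (by simpa using ht.1)).continuousWithinAt)
    (fun t ht => (hdiff _ t (by simpa using ht.1)).differentiableWithinAt)
    (fun x y hx h1 h2 => hC (-I) (by simp) x y hx (abs_le.2 ⟨by linarith, h2⟩))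
  have hlo := integral_halfStrip (f := fun t => hermiteKernel z t * (I * t) ^ s) (c := -1) (d := 0)
    (C := C) (by norm_num)
    (fun t ht => (hcont _ t (by simpa using ht.2)).continuousWithinAt)
    (fun t ht => (hdiff _ t (by simpa using ht.2)).differentiableWithinAt)
    (fun x y hx h1 h2 => hC I (by simp) x y hx (abs_le.2 ⟨h1, by linarith⟩))
  simp only [ofReal_zero, zero_mul, add_zero, ofReal_one, one_mul, ofReal_neg, neg_mul] at hup hlo
  have e1 : ∫ x in Ioi (-1 : ℝ), hermiteKernel z (x + I) * (-(x + I)) ^ s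
      = (-I) ^ s * ∫ x in Ioi (-1 : ℝ), hermiteKernel z (x + I) * (-(I * (x + I))) ^ s := by
    rw [← integral_const_mul]
    refine integral_congr_ae (ae_of_all _ fun x => ?_)
    simp only
    rw [neg_cpow_upper (Or.inl (by simp)), neg_mul I]
    ring
  have e2 : ∫ x in Ioi (-1 : ℝ), hermiteKernel z (x - I) * (-(x - I)) ^ s
      = I ^ s * ∫ x in Ioi (-1 : ℝ), hermiteKernel z (x + -I) * (I * (x + -I)) ^ s := by
    rw [← integral_const_mul]
    refine integral_congr_ae (ae_of_all _ fun x => ?_)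
    simp only
    rw [neg_cpow_lower (Or.inl (by simp)), ← sub_eq_add_neg]
    ring
  have e3 : ∫ y in (0 : ℝ)..1, hermiteKernel z (-1 + y * I) * (-(-1 + y * I)) ^ s
      = (-I) ^ s * ∫ y in (0 : ℝ)..1, hermiteKernel z (-1 + y * I) * (-(I * (-1 + y * I))) ^ s := by
    rw [← intervalIntegral.integral_const_mul]
    refine intervalIntegral.integral_congr fun y hy => ?_
    rw [uIcc_of_le zero_le_one] at hy
    rw [neg_cpow_upper, neg_mul I]
    · ring
    · rcases hy.1.lt_or_eq with h | h
      · exact Or.inl (by simpa using h)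
      · exact Or.inr (by simp [← h])
  have e4 : ∫ y in (-1 : ℝ)..0, hermiteKernel z (-1 + y * I) * (-(-1 + y * I)) ^ s
      = I ^ s * ∫ y in (-1 : ℝ)..0, hermiteKernel z (-1 + y * I) * (I * (-1 + y * I)) ^ s := by
    rw [← intervalIntegral.integral_const_mul]
    refine intervalIntegral.integral_congr fun y hy => ?_
    rw [uIcc_of_le (by norm_num)] at hy
    rw [neg_cpow_lower]
    · ring
    · rcases hy.2.lt_or_eq with h | h
      · exact Or.inl (by simpa using h)
      · exact Or.inr (by simp [h])
  have hcontE : ∀ a b : ℝ, IntervalIntegrable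
      (fun y : ℝ => hermiteKernel z (-1 + y * I) * (-(-1 + y * I)) ^ s) volume a b := by
    intro a b
    refine Continuous.intervalIntegrable ?_ a b
    refine continuous_iff_continuousAt.2 fun y => ?_
    have h := hcont (-1) (-1 + y * I) (by simp)
    simp only [neg_mul, one_mul] at h
    exact ContinuousAt.comp (f := fun y : ℝ => (-1 + y * I : ℂ))
      (g := fun t : ℂ => hermiteKernel z t * (-t) ^ s) h (by fun_prop)
  have e5 : ∫ y in (-1 : ℝ)..1, hermiteKernel z (-1 + y * I) * (-(-1 + y * I)) ^ s
      = (∫ y in (-1 : ℝ)..0, hermiteKernel z (-1 + y * I) * (-(-1 + y * I)) ^ s)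
        + ∫ y in (0 : ℝ)..1, hermiteKernel z (-1 + y * I) * (-(-1 + y * I)) ^ s :=
    (intervalIntegral.integral_add_adjacent_intervals (hcontE _ _) (hcontE _ _)).symm
  -- On the positive axis `(c x)^s = c^s x^s`, so the edge contributes `c^{2s}` times the Laplace
  -- integral; `c = ± i` yields the phases `e^{± πis}`, whose difference is the sine.
  have hsplit : ∀ c : ℂ, ‖c‖ = 1 → c.re = 0 →
      (c ^ s * ∫ x in Ioi (-1 : ℝ), hermiteKernel z x * (c * x) ^ s)
      = (∫ x in Ioc (-1 : ℝ) 0, c ^ s * (hermiteKernel z x * (c * x) ^ s))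
        + c ^ s * c ^ s * hermiteLaplace s z := by
    intro c hc hre
    have hint : IntegrableOn (fun x : ℝ => hermiteKernel z x * (c * x) ^ s) (Ioi (-1)) := by
      refine integrableOn_Ioi_of_exp_bound (C := C) ?_ fun x hx => ?_
      · refine fun x _ => ContinuousAt.continuousWithinAt ?_
        exact ContinuousAt.comp (f := fun x : ℝ => (x : ℂ))
          (g := fun t : ℂ => hermiteKernel z t * (c * t) ^ s)
          (hcont c x (by simp [hre])) (by fun_prop)
      · have := hC c hc x 0 hx (by simp)
        simpa using this
    rw [← Ioc_union_Ioi_eq_Ioi (show (-1 : ℝ) ≤ 0 by norm_num),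
      setIntegral_union Ioc_disjoint_Ioi_same measurableSet_Ioi
        (hint.mono_set Ioc_subset_Ioi_self) (hint.mono_set (Ioi_subset_Ioi (by norm_num))),
      mul_add, integral_const_mul, mul_assoc, hermiteLaplace]
    congr 2
    rw [← integral_const_mul]
    refine setIntegral_congr_fun measurableSet_Ioi fun x hx => ?_
    have hx0 : (x : ℂ) ≠ 0 := ofReal_ne_zero.2 (ne_of_gt hx)
    have hc0 : c ≠ 0 := norm_ne_zero_iff.1 (by rw [hc]; exact one_ne_zero)
    rw [mul_comm c, mul_cpow_of_arg hx0 hc0]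
    · ring
    · rw [arg_ofReal_of_nonneg (le_of_lt hx), zero_add]
      exact ⟨neg_pi_lt_arg c, arg_le_pi c⟩
  -- On `(-1, 0)` both branches equal `(-x)^s`, so the contributions of the two edges cancel.
  have hA : ∫ x in Ioc (-1 : ℝ) 0, (-I) ^ s * (hermiteKernel z x * (-I * x) ^ s)
      = ∫ x in Ioc (-1 : ℝ) 0, I ^ s * (hermiteKernel z x * (I * x) ^ s) := by
    refine setIntegral_congr_fun measurableSet_Ioc fun x hx => ?_
    rcases hx.2.lt_or_eq with h | h
    · have h1 := neg_cpow_upper (t := (x : ℂ)) (s := s) (Or.inr (by simpa using h))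
      have h2 := neg_cpow_lower (t := (x : ℂ)) (s := s) (Or.inr (by simpa using h))
      linear_combination hermiteKernel z x * (h2 - h1)
    · have hs0 : s ≠ 0 := fun h => by simp [h] at hs
      simp [h, hs0]
  have hp := hsplit I (by simp) (by simp)
  have hm := hsplit (-I) (by simp) (by simp)
  rw [hA] at hm
  simp only [neg_mul I] at hm
  have hpow : I ^ s * I ^ s = cexp (Real.pi * s * I) := by
    rw [cpow_def_of_ne_zero I_ne_zero, log_I, ← Complex.exp_add]
    congr 1; ring
  have hpow' : (-I) ^ s * (-I) ^ s = cexp (-(Real.pi * s) * I) := by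
    rw [cpow_def_of_ne_zero (neg_ne_zero.2 I_ne_zero), log_neg_I, ← Complex.exp_add]
    congr 1; ring
  rw [hpow] at hp
  rw [hpow'] at hm
  rw [contourIntegral, e1, e2, e5, e3, e4, Complex.sin]
  linear_combination (-I) ^ s * hup + I ^ s * hlo - hm + hp
    - (cexp (-(Real.pi * s) * I) - cexp (Real.pi * s * I)) * hermiteLaplace s z * I_mul_I

end GUE

namespace GUE

/-! ### The three-term recurrence for contour integrals -/

/-- Integrability over the contour of `contourIntegral`. -/
def ContourIntegrable (f : ℂ → ℂ) : Prop :=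
  IntegrableOn (fun x : ℝ => f (x + I)) (Ioi (-1)) ∧
  IntervalIntegrable (fun y : ℝ => f (-1 + y * I)) volume (-1) 1 ∧
  IntegrableOn (fun x : ℝ => f (x - I)) (Ioi (-1))

theorem ContourIntegrable.const_mul {f : ℂ → ℂ} (hf : ContourIntegrable f) (c : ℂ) :
    ContourIntegrable fun t => c * f t :=
  ⟨hf.1.const_mul c, hf.2.1.const_mul c, hf.2.2.const_mul c⟩

theorem ContourIntegrable.add {f g : ℂ → ℂ} (hf : ContourIntegrable f) (hg : ContourIntegrable g) :
    ContourIntegrable fun t => f t + g t :=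
  ⟨hf.1.add hg.1, hf.2.1.add hg.2.1, hf.2.2.add hg.2.2⟩

theorem contourIntegral_add {f g : ℂ → ℂ} (hf : ContourIntegrable f) (hg : ContourIntegrable g) :
    contourIntegral (fun t => f t + g t) = contourIntegral f + contourIntegral g := by
  rw [contourIntegral, contourIntegral, contourIntegral, integral_add hf.1 hg.1,
    integral_add hf.2.2 hg.2.2, intervalIntegral.integral_add hf.2.1 hg.2.1]
  ring

theorem contourIntegral_const_mul (f : ℂ → ℂ) (c : ℂ) :
    contourIntegral (fun t => c * f t) = c * contourIntegral f := by
  rw [contourIntegral, contourIntegral, integral_const_mul, integral_const_mul,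
    intervalIntegral.integral_const_mul]
  ring

/-- The contour avoids the branch cut. -/
def onContour (t : ℂ) : Prop := t.im = 1 ∨ t.im = -1 ∨ t.re = -1

theorem onContour.neg_mem_slitPlane {t : ℂ} (h : onContour t) : -t ∈ slitPlane := by
  rw [mem_slitPlane_iff, neg_re, neg_im]
  rcases h with h | h | h <;> simp [h]

theorem hasDerivAt_hermiteKernel_mul_cpow (z s : ℂ) {t : ℂ} (ht : onContour t) :
    HasDerivAt (fun t => hermiteKernel z t * (-t) ^ s)
      ((-z) * (hermiteKernel z t * (-t) ^ s) + (hermiteKernel z t * (-t) ^ (s + 1)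
        + (-s) * (hermiteKernel z t * (-t) ^ (s - 1)))) t := by
  have h0 : -t ≠ 0 := slitPlane_ne_zero ht.neg_mem_slitPlane
  have h1 : HasDerivAt (hermiteKernel z) (hermiteKernel z t * (-z - t)) t := by
    have h : HasDerivAt (fun t : ℂ => -z * t - t ^ 2 / 2) (-z - t) t := by
      have := ((hasDerivAt_id t).const_mul (-z)).sub (((hasDerivAt_id t).pow 2).div_const 2)
      convert! this using 1
      simp
    exact h.cexp
  have h2 : HasDerivAt (fun t : ℂ => (-t) ^ s) (s * (-t) ^ (s - 1) * -1) t :=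
    (hasDerivAt_neg t).cpow_const ht.neg_mem_slitPlane
  convert! h1.mul h2 using 1
  rw [cpow_add _ _ h0, cpow_one]
  ring

theorem contourIntegrable_hermiteKernel_mul_cpow (z s : ℂ) :
    ContourIntegrable fun t => hermiteKernel z t * (-t) ^ s := by
  obtain ⟨C, hC⟩ := norm_hermiteKernel_mul_cpow_le s z
  have hcont : ∀ t, onContour t → ContinuousAt (fun t => hermiteKernel z t * (-t) ^ s) t :=
    fun t ht => (hasDerivAt_hermiteKernel_mul_cpow z s ht).continuousAt
  refine ⟨?_, ?_, ?_⟩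
  · refine integrableOn_Ioi_of_exp_bound (C := C) (fun x _ => ?_) fun x hx => ?_
    · exact (ContinuousAt.comp (f := fun x : ℝ => (x + I : ℂ)) (hcont _ (Or.inl (by simp)))
        (by fun_prop)).continuousWithinAt
    · simpa using hC (-1) (by simp) x 1 hx (by simp)
  · refine Continuous.intervalIntegrable (continuous_iff_continuousAt.2 fun y => ?_) _ _
    exact ContinuousAt.comp (f := fun y : ℝ => (-1 + y * I : ℂ))
      (hcont _ (Or.inr (Or.inr (by simp)))) (by fun_prop)
  · refine integrableOn_Ioi_of_exp_bound (C := C) (fun x _ => ?_) fun x hx => ?_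
    · exact (ContinuousAt.comp (f := fun x : ℝ => (x - I : ℂ)) (hcont _ (Or.inr (Or.inl (by simp))))
        (by fun_prop)).continuousWithinAt
    · simpa [sub_eq_add_neg] using hC (-1) (by simp) x (-1) hx (by simp)

/-- The integral of a total derivative over the contour vanishes. -/
theorem contourIntegral_deriv {G G' : ℂ → ℂ} (hG : ∀ t, onContour t → HasDerivAt G (G' t) t)
    (hint : ContourIntegrable G') (h1 : Tendsto (fun x : ℝ => G (x + I)) atTop (𝓝 0))
    (h2 : Tendsto (fun x : ℝ => G (x - I)) atTop (𝓝 0)) : contourIntegral G' = 0 := by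
  have hx : ∀ (c : ℂ) (x : ℝ), HasDerivAt (fun x : ℝ => (x : ℂ) + c) 1 x := fun c x =>
    (Complex.ofRealCLM.hasDerivAt (x := x)).add_const c
  have e1 := integral_Ioi_of_hasDerivAt_of_tendsto (f := fun x : ℝ => G (x + I))
    (f' := fun x : ℝ => G' (x + I)) (a := -1) (m := 0)
    (ContinuousAt.continuousWithinAt (((hG _ (Or.inl (by simp))).scomp (-1 : ℝ)
      (hx I (-1))).continuousAt))
    (fun x _ => by simpa [Function.comp_def] using (hG _ (Or.inl (by simp))).scomp x (hx I x)) hint.1 h1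
  have e2 := integral_Ioi_of_hasDerivAt_of_tendsto (f := fun x : ℝ => G (x + -I))
    (f' := fun x : ℝ => G' (x + -I)) (a := -1) (m := 0)
    (ContinuousAt.continuousWithinAt (((hG _ (Or.inr (Or.inl (by simp)))).scomp (-1 : ℝ)
      (hx (-I) (-1))).continuousAt))
    (fun x _ => by simpa [Function.comp_def] using (hG _ (Or.inr (Or.inl (by simp)))).scomp x (hx (-I) x)) hint.2.2 h2
  have e3 : ∫ y in (-1 : ℝ)..1, I * G' (-1 + y * I) = G (-1 + (1 : ℝ) * I) - G (-1 + (-1 : ℝ) * I) := by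
    refine intervalIntegral.integral_eq_sub_of_hasDerivAt (f := fun y : ℝ => G (-1 + y * I))
      (fun y _ => ?_) (hint.2.1.const_mul I)
    have hy : HasDerivAt (fun y : ℝ => -1 + (y : ℂ) * I) I y := by
      simpa using ((Complex.ofRealCLM.hasDerivAt (x := y)).mul_const I).const_add (-1)
    simpa [Function.comp_def] using (hG _ (Or.inr (Or.inr (by simp)))).scomp y hy
  rw [intervalIntegral.integral_const_mul] at e3
  simp only [← sub_eq_add_neg] at e2
  rw [contourIntegral, e1, e2, e3]
  simp [sub_eq_add_neg]

/-- The contour integral in the definition of the Hermite function. -/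
def hermiteJ (s z : ℂ) : ℂ := contourIntegral fun t => hermiteKernel z t * (-t) ^ s

/-- The total derivative of `e^{-zt-t²/2} (-t)^s` is a combination of the integrands with exponents
`s`, `s + 1` and `s - 1`. Its contour integral vanishes because the function decays at both ends. -/
theorem hermiteJ_recurrence (s z : ℂ) :
    hermiteJ (s + 1) z = z * hermiteJ s z + s * hermiteJ (s - 1) z := by
  have i0 := contourIntegrable_hermiteKernel_mul_cpow z s
  have i1 := contourIntegrable_hermiteKernel_mul_cpow z (s + 1)
  have i2 := contourIntegrable_hermiteKernel_mul_cpow z (s - 1)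
  obtain ⟨C, hC⟩ := norm_hermiteKernel_mul_cpow_le s z
  have hlim : ∀ f : ℝ → ℂ, (∀ x, 1 ≤ x → ‖f x‖ ≤ C * Real.exp (-x)) → Tendsto f atTop (𝓝 0) := by
    intro f hf
    have h0 : Tendsto (fun X : ℝ => C * Real.exp (-X)) atTop (𝓝 (C * 0)) :=
      tendsto_const_nhds.mul Real.tendsto_exp_neg_atTop_nhds_zero
    rw [mul_zero] at h0
    exact squeeze_zero_norm' (by filter_upwards [eventually_ge_atTop 1] with x hx using hf x hx) h0
  have h := contourIntegral_deriv (fun t ht => hasDerivAt_hermiteKernel_mul_cpow z s ht)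
    ((i0.const_mul (-z)).add (i1.add (i2.const_mul (-s))))
    (hlim _ fun x hx => by simpa using hC (-1) (by simp) x 1 hx (by simp))
    (hlim _ fun x hx => by
      simpa [sub_eq_add_neg] using hC (-1) (by simp) x (-1) hx (by simp))
  rw [contourIntegral_add (i0.const_mul _) (i1.add (i2.const_mul _)),
    contourIntegral_add i1 (i2.const_mul _), contourIntegral_const_mul,
    contourIntegral_const_mul] at h
  unfold hermiteJ
  linear_combination h

theorem hermiteContour_eq (ν z : ℂ) :
    hermiteContour ν z = -(Gamma (ν + 1) / (2 * Real.pi * I)) * hermiteJ (-ν - 1) z := rfl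

theorem hermiteContour_recurrence {ν : ℂ} (h0 : ν ≠ 0) (h1 : ν + 1 ≠ 0) (z : ℂ) :
    hermiteContour (ν + 1) z = z * hermiteContour ν z - ν * hermiteContour (ν - 1) z := by
  have h := hermiteJ_recurrence (-ν - 1) z
  rw [hermiteContour_eq, hermiteContour_eq, hermiteContour_eq, Complex.Gamma_add_one _ h1,
    Complex.Gamma_add_one _ h0, sub_add_cancel, show -(ν + 1) - 1 = -ν - 1 - 1 by ring,
    show -(ν - 1) - 1 = -ν - 1 + 1 by ring, h]
  ring

theorem sin_pi_mul_eventually_ne_zero (ν : ℂ) : ∀ᶠ μ in 𝓝[≠] ν, sin (Real.pi * μ) ≠ 0 := by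
  have hd : Differentiable ℂ fun μ : ℂ => sin (Real.pi * μ) := by fun_prop
  rcases (hd.analyticAt ν).eventually_eq_zero_or_eventually_ne_zero with h | h
  · exfalso
    have h1 : HasDerivAt (fun μ : ℂ => sin (Real.pi * μ)) (cos (Real.pi * ν) * (Real.pi * 1)) ν :=
      ((hasDerivAt_id ν).const_mul (Real.pi : ℂ)).csin
    have h2 : HasDerivAt (fun μ : ℂ => sin (Real.pi * μ)) 0 ν :=
      (hasDerivAt_const ν (0 : ℂ)).congr_of_eventuallyEq h
    have h3 : cos (Real.pi * ν) = 0 := by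
      have := h1.unique h2
      simpa [Real.pi_ne_zero] using this
    have h4 := h.self_of_nhds
    have := Complex.sin_sq_add_cos_sq (Real.pi * ν)
    rw [h3, h4] at this
    simp at this
  · exact h

/-- Euler's reflection formula turns `Γ(ν + 1) sin πν` into a multiple of `1 / Γ(-ν)`, which has no
singularity at the negative integers. -/
theorem hermiteContour_eq_laplace {ν : ℂ} (hν : ν.re < -1) (hs : sin (Real.pi * ν) ≠ 0) (z : ℂ) :
    hermiteContour ν z = hermiteLaplace (-ν - 1) z / Gamma (-ν) := by
  have h1 : 0 < (-ν - 1).re := by simp; linarith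
  have h2 : hermiteJ (-ν - 1) z = _ := contourIntegral_eq h1 z
  have h3 : sin (Real.pi * (-ν - 1)) = sin (Real.pi * ν) := by
    rw [show (Real.pi : ℂ) * (-ν - 1) = -(Real.pi * ν + Real.pi) by ring, Complex.sin_neg,
      Complex.sin_add_pi, neg_neg]
  have h4 := Complex.Gamma_mul_Gamma_one_sub (-ν)
  rw [show (Real.pi : ℂ) * -ν = -(Real.pi * ν) by ring, Complex.sin_neg,
    show (1 : ℂ) - -ν = ν + 1 by ring] at h4
  have hpi : (Real.pi : ℂ) ≠ 0 := ofReal_ne_zero.2 Real.pi_ne_zero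
  have h5 : Gamma (-ν) ≠ 0 := Gamma_ne_zero_of_re_pos (by simp; linarith)
  rw [hermiteContour_eq, h2, h3]
  have h6 : Gamma (-ν) * Gamma (ν + 1) * sin (Real.pi * ν) = -Real.pi := by
    rw [h4, div_neg, neg_mul, div_mul_cancel₀ _ hs]
  rw [eq_div_iff h5]
  rw [show -(Gamma (ν + 1) / (2 * Real.pi * I)) * (2 * I * sin (Real.pi * ν) *
    hermiteLaplace (-ν - 1) z) * Gamma (-ν) = -(Gamma (-ν) * Gamma (ν + 1) * sin (Real.pi * ν))
      * (2 * I) * hermiteLaplace (-ν - 1) z / (2 * Real.pi * I) by ring, h6]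
  field_simp

end GUE

namespace GUE

/-! ### Laplace-type integrals and rotation of the path of integration -/

theorem integrableOn_rpow_mul_exp_sub_sq {r R b : ℝ} (hr : -1 < r) (hb : 0 < b) :
    IntegrableOn (fun t : ℝ => t ^ r * Real.exp (R * t - b * t ^ 2)) (Ioi 0) := by
  have h1 : IntegrableOn (fun t : ℝ => Real.exp (R ^ 2 / (2 * b)) *
      (t ^ r * Real.exp (-(b / 2) * t ^ 2))) (Ioi 0) :=
    ((integrable_rpow_mul_exp_neg_mul_sq (half_pos hb) hr).integrableOn).const_mul _
  refine Integrable.mono' h1 ?_ ?_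
  · refine ContinuousOn.aestronglyMeasurable (fun t ht => ?_) measurableSet_Ioi
    exact ((Real.continuousAt_rpow_const _ _ (Or.inl (ne_of_gt ht))).mul
      (by fun_prop)).continuousWithinAt
  · refine (ae_restrict_iff' measurableSet_Ioi).2 (ae_of_all _ fun t ht => ?_)
    have ht' : (0 : ℝ) < t := ht
    rw [norm_mul, Real.norm_eq_abs, Real.norm_eq_abs, Real.abs_exp,
      abs_of_nonneg (Real.rpow_nonneg ht'.le _), mul_left_comm, ← Real.exp_add]
    gcongr
    have h2 : R ^ 2 / (2 * b) + -(b / 2) * t ^ 2 - (R * t - b * t ^ 2)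
        = (b * t - R) ^ 2 / (2 * b) := by
      field_simp
      ring
    have h3 : 0 ≤ (b * t - R) ^ 2 / (2 * b) := by positivity
    linarith

theorem integrableOn_rpow_mul_exp_neg_mul {r b : ℝ} (hr : -1 < r) (hb : 0 < b) :
    IntegrableOn (fun t : ℝ => t ^ r * Real.exp (-b * t)) (Ioi 0) := by
  have := integrableOn_rpow_mul_exp_neg_mul_rpow hr one_pos hb
  simpa using this

theorem norm_ofReal_cpow {t : ℝ} (ht : 0 < t) (s : ℂ) : ‖(t : ℂ) ^ s‖ = t ^ s.re :=
  norm_cpow_eq_rpow_re_of_pos ht s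

theorem continuousOn_comp_mul_mul_cpow {f : ℂ → ℂ} (hf : Continuous f) (a s : ℂ) :
    ContinuousOn (fun t : ℝ => f (a * t) * (t : ℂ) ^ s) (Ioi 0) := fun t ht =>
  ((by fun_prop : Continuous fun t : ℝ => f (a * t)).continuousAt.mul
    (continuousAt_ofReal_cpow_const _ _ (Or.inr (ne_of_gt ht)))).continuousWithinAt

/-- A function dominated by a weight with finite moments is integrable against powers. -/
theorem integrableOn_mul_cpow {f : ℝ → ℂ} {s : ℂ} {g : ℝ → ℝ}
    (hf : ContinuousOn (fun t : ℝ => f t * (t : ℂ) ^ s) (Ioi 0))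
    (hg : IntegrableOn (fun t : ℝ => t ^ s.re * g t) (Ioi 0))
    (hfg : ∀ t : ℝ, 0 < t → ‖f t‖ ≤ g t) :
    IntegrableOn (fun t : ℝ => f t * (t : ℂ) ^ s) (Ioi 0) := by
  refine Integrable.mono' hg (hf.aestronglyMeasurable measurableSet_Ioi) ?_
  refine (ae_restrict_iff' measurableSet_Ioi).2 (ae_of_all _ fun t ht => ?_)
  rw [norm_mul, norm_ofReal_cpow ht, mul_comm]
  exact mul_le_mul_of_nonneg_left (hfg t ht) (Real.rpow_nonneg (le_of_lt ht) _)

/-- Rotation of the path of integration `(0, ∞)` within a convex set of directions. -/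
theorem integral_rotate {f : ℂ → ℂ} (hf : Differentiable ℂ f) {s : ℂ} (hs : -1 < s.re) {U : Set ℂ}
    (hU : IsOpen U) (hUc : Convex ℝ U) (hUre : ∀ a ∈ U, 0 < a.re) (h1 : (1 : ℂ) ∈ U)
    (hdom : ∀ a₀ ∈ U, ∃ g : ℝ → ℝ,
      (∀ r : ℝ, -1 < r → IntegrableOn (fun t : ℝ => t ^ r * g t) (Ioi 0)) ∧
      ∀ᶠ a in 𝓝 a₀, ∀ t : ℝ, 0 < t → ‖f (a * t)‖ ≤ g t ∧ ‖deriv f (a * t)‖ ≤ g t)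
    {a : ℂ} (ha : a ∈ U) :
    a ^ (s + 1) * ∫ t in Ioi (0 : ℝ), f (a * t) * (t : ℂ) ^ s
      = ∫ t in Ioi (0 : ℝ), f t * (t : ℂ) ^ s := by
  set Φ : ℂ → ℂ := fun a => ∫ t in Ioi (0 : ℝ), f (a * t) * (t : ℂ) ^ s with hΦ
  have hslit : ∀ a ∈ U, a ∈ slitPlane := fun a ha => Or.inl (hUre a ha)
  have hderivcont : Continuous (deriv f) := (hf.contDiff (n := 1)).continuous_deriv le_rfl
  have hdiff : ∀ a₀ ∈ U, DifferentiableAt ℂ Φ a₀ := by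
    intro a₀ ha₀
    obtain ⟨g, hg, hbound⟩ := hdom a₀ ha₀
    have hmeas : ∀ a : ℂ, AEStronglyMeasurable (fun t : ℝ => f (a * t) * (t : ℂ) ^ s)
        (volume.restrict (Ioi 0)) := fun a =>
      (continuousOn_comp_mul_mul_cpow hf.continuous a s).aestronglyMeasurable measurableSet_Ioi
    refine (hasDerivAt_integral_of_dominated_loc_of_deriv_le (μ := volume.restrict (Ioi 0))
      (F := fun a t => f (a * t) * (t : ℂ) ^ s)
      (F' := fun a t => (deriv f (a * t) * t) * (t : ℂ) ^ s)
      (bound := fun t => t ^ (s.re + 1) * g t) hbound (Eventually.of_forall hmeas) ?_ ?_ ?_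
      (hg _ (by linarith)) ?_).2.differentiableAt
    · exact integrableOn_mul_cpow (continuousOn_comp_mul_mul_cpow hf.continuous a₀ s) (hg _ hs)
        fun t ht => (hbound.self_of_nhds t ht).1
    · have := (continuousOn_comp_mul_mul_cpow hderivcont a₀ s).mul
        (Complex.continuous_ofReal.continuousOn (s := Ioi (0 : ℝ)))
      refine AEStronglyMeasurable.congr (this.aestronglyMeasurable measurableSet_Ioi)
        (ae_of_all _ fun t => ?_)
      simp only [Pi.mul_apply]
      ring
    · refine (ae_restrict_iff' measurableSet_Ioi).2 (ae_of_all _ fun t ht a ha => ?_)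
      have ht' : (0 : ℝ) < t := ht
      rw [norm_mul, norm_mul, norm_ofReal_cpow ht', Complex.norm_real, Real.norm_eq_abs,
        abs_of_pos ht', Real.rpow_add ht', Real.rpow_one]
      calc ‖deriv f (a * t)‖ * t * t ^ s.re ≤ g t * t * t ^ s.re := by
            gcongr
            exact (ha t ht').2
        _ = t ^ s.re * t * g t := by ring
    · refine (ae_restrict_iff' measurableSet_Ioi).2 (ae_of_all _ fun t _ a _ => ?_)
      refine HasDerivAt.mul_const ?_ _
      have h := (hf (a * t)).hasDerivAt.comp a ((hasDerivAt_id a).mul_const (t : ℂ))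
      simpa [Function.comp_def] using h
  have hΨ : DifferentiableOn ℂ (fun a => a ^ (s + 1) * Φ a) U := fun a ha =>
    ((differentiableAt_id.cpow_const (hslit a ha)).mul (hdiff a ha)).differentiableWithinAt
  -- For real positive directions the claim is the substitution `t ↦ x t`.
  have hreal : ∀ x : ℝ, 0 < x → (x : ℂ) ^ (s + 1) * Φ x = Φ 1 := by
    intro x hx
    have h := integral_comp_mul_left_Ioi (fun t : ℝ => f t * (t : ℂ) ^ s) 0 hx
    rw [mul_zero] at h
    have h2 : ∫ t in Ioi (0 : ℝ), f ((x * t : ℝ) : ℂ) * ((x * t : ℝ) : ℂ) ^ s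
        = (x : ℂ) ^ s * Φ x := by
      rw [hΦ, ← integral_const_mul]
      refine setIntegral_congr_fun measurableSet_Ioi fun t ht => ?_
      rw [ofReal_mul, mul_cpow_ofReal_nonneg hx.le (le_of_lt ht)]
      ring
    rw [h2] at h
    have hx0 : (x : ℂ) ≠ 0 := ofReal_ne_zero.2 hx.ne'
    rw [cpow_add _ _ hx0, cpow_one, mul_right_comm, h, hΦ]
    simp only [one_mul, real_smul, ofReal_inv]
    field_simp
  -- The left-hand side is analytic in the direction and constant on positive reals; the identity
  -- theorem, with the points `1 + 1/(k+1)` accumulating at `1`, extends this to all of `U`.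
  have heq := AnalyticOnNhd.eqOn_of_preconnected_of_frequently_eq (hΨ.analyticOnNhd hU)
    (analyticOnNhd_const (v := Φ 1)) hUc.isPreconnected h1 (by
      have hseq : Tendsto (fun k : ℕ => ((1 + 1 / ((k : ℝ) + 1) : ℝ) : ℂ)) atTop (𝓝[≠] 1) := by
        refine tendsto_nhdsWithin_iff.2 ⟨?_, Eventually.of_forall fun k => ?_⟩
        · have := (tendsto_const_nhds (x := (1 : ℝ))).add tendsto_one_div_add_atTop_nhds_zero_nat
          rw [add_zero] at this
          have h2 := (Complex.continuous_ofReal.tendsto 1).comp this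
          simpa [Function.comp_def] using h2
        · have : (0 : ℝ) < 1 / ((k : ℝ) + 1) := by positivity
          intro h
          have h2 : (1 + 1 / ((k : ℝ) + 1) : ℝ) = 1 := ofReal_injective (h.trans ofReal_one.symm)
          linarith
      exact hseq.frequently (Frequently.of_forall fun k => hreal _ (by positivity)))
  have := heq ha
  simp only at this
  rw [this, hΦ]
  simp

/-- The complex Gamma integral with a complex scale. -/
theorem integral_cexp_neg_mul_mul_cpow {s : ℂ} (hs : -1 < s.re) {p : ℂ} (hp : 0 < p.re) :
    ∫ t in Ioi (0 : ℝ), cexp (-(p * t)) * (t : ℂ) ^ s = Gamma (s + 1) * (p ^ (s + 1))⁻¹ := by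
  have hp0 : p ≠ 0 := fun h => by simp [h] at hp
  have h := integral_rotate (f := fun t => cexp (-t)) (by fun_prop) hs
    (U := {a : ℂ | 0 < a.re}) (isOpen_lt continuous_const continuous_re)
    (convex_halfSpace_re_gt 0) (fun a ha => ha) (by simp) ?_ hp
  · have h2 : Gamma (s + 1) = ∫ t in Ioi (0 : ℝ), cexp (-t) * (t : ℂ) ^ s := by
      rw [Complex.Gamma_eq_integral (by simp; linarith), Complex.GammaIntegral]
      refine setIntegral_congr_fun measurableSet_Ioi fun t _ => ?_
      simp
    rw [h2, ← h]
    have := (cpow_ne_zero_iff_of_exponent_ne_zero (x := p) (y := s + 1) (fun h => by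
      have := congrArg re h
      simp at this
      linarith)).2 hp0
    field_simp
  · intro a₀ ha₀
    have ha₀' : 0 < a₀.re := ha₀
    refine ⟨fun t => Real.exp (-(a₀.re / 2) * t), fun r hr =>
      integrableOn_rpow_mul_exp_neg_mul hr (half_pos ha₀'), ?_⟩
    have hev : ∀ᶠ a : ℂ in 𝓝 a₀, a₀.re / 2 < a.re :=
      continuous_re.continuousAt.eventually (lt_mem_nhds (by linarith))
    filter_upwards [hev] with a ha t ht
    have hb : ‖cexp (-(a * t))‖ ≤ Real.exp (-(a₀.re / 2) * t) := by
      rw [Complex.norm_exp, Real.exp_le_exp, neg_re, re_mul_ofReal]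
      nlinarith
    refine ⟨hb, ?_⟩
    have hd : deriv (fun t : ℂ => cexp (-t)) = fun t => -cexp (-t) := by
      funext t
      have := (hasDerivAt_neg t).cexp
      simpa using this.deriv
    rw [hd]
    simpa using hb

/-- The directions along which `exp(-t² / 2)` decays. -/
def decayCone : Set ℂ := {a | |a.im| < a.re}

theorem norm_hermiteKernel_mul_le (z a : ℂ) (t : ℝ) (ht : 0 ≤ t) :
    ‖hermiteKernel z (a * t)‖ ≤ Real.exp (‖z‖ * ‖a‖ * t - (a ^ 2).re / 2 * t ^ 2) := by
  rw [hermiteKernel, Complex.norm_exp, Real.exp_le_exp]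
  have h1 : (-z * (a * t) - (a * t) ^ 2 / 2).re = -((z * a).re * t) - (a ^ 2).re / 2 * t ^ 2 := by
    have : -z * (a * t) - (a * t) ^ 2 / 2 = -((z * a) * (t : ℝ)) - (a ^ 2) * ((t ^ 2 / 2 : ℝ) : ℂ) := by
      push_cast; ring
    rw [this, sub_re, neg_re, re_mul_ofReal, re_mul_ofReal]
    ring
  rw [h1]
  have h2 : -(z * a).re ≤ ‖z‖ * ‖a‖ := by
    rw [← norm_mul]
    exact (neg_le_abs _).trans (abs_re_le_norm _)
  nlinarith

theorem decayCone_sq_re_pos {a : ℂ} (ha : a ∈ decayCone) : 0 < (a ^ 2).re := by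
  have h : |a.im| < a.re := ha
  rw [pow_two, mul_re]
  have h2 : a.im * a.im = |a.im| * |a.im| := (abs_mul_abs_self _).symm
  rw [h2]
  nlinarith [abs_nonneg a.im]

theorem deriv_hermiteKernel (z t : ℂ) :
    deriv (hermiteKernel z) t = hermiteKernel z t * (-z - t) := by
  have h : HasDerivAt (fun t : ℂ => -z * t - t ^ 2 / 2) (-z - t) t := by
    have := ((hasDerivAt_id t).const_mul (-z)).sub (((hasDerivAt_id t).pow 2).div_const 2)
    convert! this using 1
    simp
  exact h.cexp.deriv

/-- Rotation of the path of integration in `hermiteLaplace`. -/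
theorem hermiteLaplace_rotate {s : ℂ} (hs : -1 < s.re) (z : ℂ) {a : ℂ} (ha : a ∈ decayCone) :
    a ^ (s + 1) * ∫ t in Ioi (0 : ℝ), hermiteKernel z (a * t) * (t : ℂ) ^ s
      = hermiteLaplace s z := by
  have hpos : ∀ a ∈ decayCone, 0 < a.re := fun a ha => (abs_nonneg _).trans_lt ha
  refine integral_rotate (differentiable_hermiteKernel z) hs (U := decayCone)
    (isOpen_lt (by fun_prop) (by fun_prop)) ?_ hpos (by simp [decayCone]) ?_ ha
  · intro x hx y hy p q hp hq hpq
    have hx' : |x.im| < x.re := hx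
    have hy' : |y.im| < y.re := hy
    change |(p • x + q • y).im| < (p • x + q • y).re
    simp only [add_im, add_re, real_smul, im_ofReal_mul, re_ofReal_mul]
    have h1 : |p * x.im + q * y.im| ≤ p * |x.im| + q * |y.im| := by
      refine (abs_add_le _ _).trans_eq ?_
      rw [abs_mul, abs_mul, abs_of_nonneg hp, abs_of_nonneg hq]
    rcases hp.lt_or_eq with h | h
    · nlinarith
    · subst h
      rw [zero_add] at hpq
      subst hpq
      simpa using hy'
  · intro a₀ ha₀
    have hq := decayCone_sq_re_pos ha₀
    -- Half of the Gaussian rate at `a₀`; nearby directions keep at least this rate. The polynomial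
    -- factor in the dominating function accounts for the derivative of the kernel.
    set b := (a₀ ^ 2).re / 4 with hb
    set R := ‖z‖ * (‖a₀‖ + 1) with hR
    refine ⟨fun t => (1 + ‖z‖ + (‖a₀‖ + 1) * t) * Real.exp (R * t - b * t ^ 2), fun r hr => ?_, ?_⟩
    · have h1 := (integrableOn_rpow_mul_exp_sub_sq (R := R) hr (b := b) (by positivity)).const_mul
        (1 + ‖z‖)
      have h2 := (integrableOn_rpow_mul_exp_sub_sq (r := r + 1) (R := R) (b := b) (by linarith)
        (by positivity)).const_mul (‖a₀‖ + 1)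
      refine IntegrableOn.congr_fun (Integrable.add h1 h2) (fun t ht => ?_) measurableSet_Ioi
      simp only [Pi.add_apply]
      rw [Real.rpow_add ht, Real.rpow_one]
      ring
    · have hev1 : ∀ᶠ a : ℂ in 𝓝 a₀, (a₀ ^ 2).re / 2 < (a ^ 2).re :=
        (by fun_prop : Continuous fun a : ℂ => (a ^ 2).re).continuousAt.eventually
          (lt_mem_nhds (by linarith))
      have hev2 : ∀ᶠ a : ℂ in 𝓝 a₀, ‖a‖ < ‖a₀‖ + 1 :=
        continuous_norm.continuousAt.eventually (gt_mem_nhds (by linarith))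
      filter_upwards [hev1, hev2] with a h1 h2 t ht
      have hk : ‖hermiteKernel z (a * t)‖ ≤ Real.exp (R * t - b * t ^ 2) := by
        refine (norm_hermiteKernel_mul_le z a t ht.le).trans (Real.exp_le_exp.2 ?_)
        have h3 : ‖z‖ * ‖a‖ * t ≤ R * t := by
          rw [hR]; gcongr
        have h4 : b * t ^ 2 ≤ (a ^ 2).re / 2 * t ^ 2 := by
          gcongr; linarith
        linarith
      have hat : ‖a * t‖ ≤ (‖a₀‖ + 1) * t := by
        rw [norm_mul, Complex.norm_real, Real.norm_eq_abs, abs_of_pos ht]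
        gcongr
      have hnn : 0 ≤ (‖a₀‖ + 1) * t := by positivity
      constructor
      · refine hk.trans (le_mul_of_one_le_left (Real.exp_pos _).le ?_)
        linarith [norm_nonneg z]
      · rw [deriv_hermiteKernel, norm_mul, mul_comm]
        refine mul_le_mul ?_ hk (norm_nonneg _) (by positivity)
        calc ‖-z - a * t‖ ≤ ‖-z‖ + ‖a * t‖ := norm_sub_le _ _
          _ ≤ 1 + ‖z‖ + (‖a₀‖ + 1) * t := by rw [norm_neg]; linarith

end GUE

namespace GUE

/-! ### Asymptotic expansion of the Laplace-type integral -/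

/-- For `‖w‖ ≤ 1` this is the Taylor remainder. For `‖w‖ ≥ 1` every term, and the exponential itself
in the right half-plane, is at most `‖w‖^N`. The bound must hold for all `w`, since it is integrated
over an entire ray. -/
theorem norm_cexp_neg_sub_sum_le (N : ℕ) : ∃ C : ℝ, 0 ≤ C ∧ ∀ w : ℂ, 0 ≤ w.re →
    ‖cexp (-w) - ∑ m ∈ Finset.range N, (-w) ^ m / (m.factorial : ℂ)‖ ≤ C * ‖w‖ ^ N := by
  have hexp : ∀ w : ℂ, 0 ≤ w.re → ‖cexp (-w)‖ ≤ 1 := fun w hw => by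
    rw [Complex.norm_exp, Real.exp_le_one_iff, neg_re]; linarith
  refine ⟨N + 3, by positivity, fun w hw => ?_⟩
  have hN : (0 : ℝ) ≤ N := N.cast_nonneg
  rcases le_total ‖w‖ 1 with h | h
  · rcases Nat.eq_zero_or_pos N with rfl | hpos
    · simpa using (hexp w hw).trans (by norm_num)
    · have h1 := Complex.exp_bound (x := -w) (by rwa [norm_neg]) hpos
      rw [norm_neg] at h1
      refine h1.trans ?_
      rw [mul_comm]
      refine mul_le_mul_of_nonneg_right ?_ (by positivity)
      have h2 : ((N.factorial : ℝ) * N)⁻¹ ≤ 1 := by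
        apply inv_le_one_of_one_le₀
        have e1 : (1 : ℝ) ≤ N.factorial := by exact_mod_cast N.factorial_pos
        have e2 : (1 : ℝ) ≤ N := by exact_mod_cast hpos
        nlinarith
      calc (N.succ : ℝ) * ((N.factorial : ℝ) * N)⁻¹ ≤ (N.succ : ℝ) * 1 := by gcongr
        _ ≤ N + 3 := by push_cast; linarith
  · have h1 : ‖∑ m ∈ Finset.range N, (-w) ^ m / (m.factorial : ℂ)‖ ≤ N * ‖w‖ ^ N := by
      refine (norm_sum_le_of_le (n := fun _ => ‖w‖ ^ N) _ fun m hm => ?_).trans_eq ?_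
      · rw [norm_div, norm_pow, norm_neg, Complex.norm_natCast]
        refine (div_le_self (by positivity) (by exact_mod_cast m.factorial_pos)).trans ?_
        exact pow_le_pow_right₀ h (Finset.mem_range.1 hm).le
      · simp
    have h2 : 1 ≤ ‖w‖ ^ N := one_le_pow₀ h
    calc _ ≤ ‖cexp (-w)‖ + ‖∑ m ∈ Finset.range N, (-w) ^ m / (m.factorial : ℂ)‖ := norm_sub_le _ _
      _ ≤ ‖w‖ ^ N + N * ‖w‖ ^ N := add_le_add ((hexp w hw).trans h2) h1
      _ ≤ (N + 3) * ‖w‖ ^ N := by nlinarith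

theorem integrableOn_cexp_neg_mul_cpow {s p : ℂ} (hs : -1 < s.re) (hp : 0 < p.re) :
    IntegrableOn (fun t : ℝ => cexp (-(p * t)) * (t : ℂ) ^ s) (Ioi 0) := by
  refine integrableOn_mul_cpow (g := fun t => Real.exp (-p.re * t))
    (continuousOn_comp_mul_mul_cpow (f := fun t => cexp (-t)) (by fun_prop) p s)
    (integrableOn_rpow_mul_exp_neg_mul hs hp) fun t _ => ?_
  rw [Complex.norm_exp, neg_re, re_mul_ofReal, neg_mul]

theorem integrableOn_hermiteKernel_mul_cpow {s : ℂ} (hs : -1 < s.re) (z : ℂ) {a : ℂ}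
    (ha : a ∈ decayCone) :
    IntegrableOn (fun t : ℝ => hermiteKernel z (a * t) * (t : ℂ) ^ s) (Ioi 0) :=
  integrableOn_mul_cpow (g := fun t => Real.exp (‖z‖ * ‖a‖ * t - (a ^ 2).re / 2 * t ^ 2))
    (continuousOn_comp_mul_mul_cpow (differentiable_hermiteKernel z).continuous a s)
    (integrableOn_rpow_mul_exp_sub_sq hs (half_pos (decayCone_sq_re_pos ha)))
    fun t ht => norm_hermiteKernel_mul_le z a t ht.le

/-- Both `a⁻¹` and `a z` have argument in `(-π/2, π/2)`, so principal powers multiply. -/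
theorem cpow_eq_of_decayCone {a z : ℂ} (ha : a ∈ decayCone) (hz : 0 < (a * z).re) (w : ℂ) :
    z ^ w = (a * z) ^ w * (a ^ w)⁻¹ := by
  have hre : 0 < a.re := (abs_nonneg _).trans_lt ha
  have ha0 : a ≠ 0 := fun h => by simp [h] at hre
  have hz0 : a * z ≠ 0 := fun h => by simp [h] at hz
  have harg : |a.arg| < Real.pi / 2 := abs_arg_lt_pi_div_two_iff.2 (Or.inl hre)
  have hpi : a.arg ≠ Real.pi := fun h => by
    rw [h, abs_of_pos Real.pi_pos] at harg
    linarith [Real.pi_pos]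
  have h1 : z = a⁻¹ * (a * z) := by field_simp
  have h2 := abs_lt.1 (abs_arg_lt_pi_div_two_iff.2 (Or.inl hz))
  have h3 := abs_lt.1 harg
  conv_lhs => rw [h1]
  rw [mul_cpow_of_arg (inv_ne_zero ha0) hz0, inv_cpow _ _ hpi, mul_comm]
  rw [arg_inv, if_neg hpi]
  constructor <;> linarith [h2.1, h2.2, h3.1, h3.2]

/-- Watson's lemma for `hermiteLaplace`, in the cone `c ‖z‖ ≤ re (a z)`. -/
theorem hermiteLaplace_expansion {s : ℂ} (hs : -1 < s.re) {a : ℂ} (ha : a ∈ decayCone) {c : ℝ}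
    (hc : 0 < c) (N : ℕ) : ∃ C : ℝ, ∀ z : ℂ, 0 < ‖z‖ → c * ‖z‖ ≤ (a * z).re →
      ‖hermiteLaplace s z - z ^ (-(s + 1)) * ∑ m ∈ Finset.range N,
        ((-1 / 2) ^ m / (m.factorial : ℂ) * Gamma (s + 2 * m + 1)) * (z ^ (2 * m))⁻¹‖
      ≤ C * (‖z‖ ^ (s.re + 1 + 2 * N))⁻¹ := by
  obtain ⟨E, hE0, hE⟩ := norm_cexp_neg_sub_sum_le N
  set r : ℝ := s.re + 1 + 2 * N with hr
  have hr0 : 0 < r := by have : (0 : ℝ) ≤ N := N.cast_nonneg; linarith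
  set K : ℝ := E * (‖a‖ ^ 2 / 2) ^ N with hK
  refine ⟨‖a ^ (s + 1)‖ * (K * ((1 / c) ^ r * Real.Gamma r)), fun z hz0 hz => ?_⟩
  set p := a * z with hp
  have hcz : 0 < c * ‖z‖ := mul_pos hc hz0
  have hpre : 0 < p.re := hcz.trans_le hz
  have ha2 := decayCone_sq_re_pos ha
  have hare : 0 < a.re := (abs_nonneg _).trans_lt ha
  have ha0 : a ≠ 0 := fun h => by simp [h] at hare
  have hp0 : p ≠ 0 := fun h => by simp [h] at hpre
  set d : ℕ → ℂ := fun m => (-(a ^ 2 / 2)) ^ m / (m.factorial : ℂ) with hd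
  have hre : ∀ m : ℕ, -1 < (s + 2 * m).re := fun m => by
    have : (s + 2 * m).re = s.re + 2 * m := by simp
    rw [this]
    have : (0 : ℝ) ≤ m := m.cast_nonneg
    linarith
  -- Only the factor `exp(-a² t² / 2)` is expanded; the linear exponential stays as the weight and
  -- gives Gamma integrals.
  have hterm : ∀ t : ℝ, 0 < t →
      hermiteKernel z (a * t) * (t : ℂ) ^ s
        - ∑ m ∈ Finset.range N, d m * (cexp (-(p * t)) * (t : ℂ) ^ (s + 2 * m))
      = cexp (-(p * t)) * (t : ℂ) ^ s * (cexp (-(a ^ 2 / 2 * t ^ 2))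
        - ∑ m ∈ Finset.range N, (-(a ^ 2 / 2 * t ^ 2)) ^ m / (m.factorial : ℂ)) := by
    intro t ht
    have ht0 : (t : ℂ) ≠ 0 := ofReal_ne_zero.2 ht.ne'
    rw [mul_sub, Finset.mul_sum]
    congr 1
    · rw [hermiteKernel, mul_right_comm, ← Complex.exp_add]
      congr 2
      rw [hp]
      ring
    · refine Finset.sum_congr rfl fun m _ => ?_
      have : (t : ℂ) ^ (s + 2 * m) = (t : ℂ) ^ s * t ^ (2 * m) := by
        rw [cpow_add _ _ ht0]
        congr 1
        rw [← cpow_natCast]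
        push_cast
        rfl
      rw [this, hd]
      simp only
      rw [neg_mul_eq_neg_mul (a ^ 2 / 2) ((t : ℂ) ^ 2), mul_pow, ← pow_mul]
      ring
  have hint : ∀ m ∈ Finset.range N, IntegrableOn
      (fun t : ℝ => d m * (cexp (-(p * t)) * (t : ℂ) ^ (s + 2 * m))) (Ioi 0) := fun m _ =>
    (integrableOn_cexp_neg_mul_cpow (hre m) hpre).const_mul _
  have hmain : (∫ t in Ioi (0 : ℝ), hermiteKernel z (a * t) * (t : ℂ) ^ s)
      - ∑ m ∈ Finset.range N, d m * (Gamma (s + 2 * m + 1) * (p ^ (s + 2 * m + 1))⁻¹)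
      = ∫ t in Ioi (0 : ℝ), cexp (-(p * t)) * (t : ℂ) ^ s * (cexp (-(a ^ 2 / 2 * t ^ 2))
        - ∑ m ∈ Finset.range N, (-(a ^ 2 / 2 * t ^ 2)) ^ m / (m.factorial : ℂ)) := by
    rw [← setIntegral_congr_fun measurableSet_Ioi fun t ht => hterm t ht,
      integral_sub (integrableOn_hermiteKernel_mul_cpow hs z ha)
        (integrable_finsetSum _ hint), integral_finsetSum _ hint]
    congr 1
    refine Finset.sum_congr rfl fun m _ => ?_
    rw [integral_const_mul, integral_cexp_neg_mul_mul_cpow (hre m) hpre]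
  have hrem : ‖∫ t in Ioi (0 : ℝ), cexp (-(p * t)) * (t : ℂ) ^ s * (cexp (-(a ^ 2 / 2 * t ^ 2))
        - ∑ m ∈ Finset.range N, (-(a ^ 2 / 2 * t ^ 2)) ^ m / (m.factorial : ℂ))‖
      ≤ K * ((1 / c) ^ r * Real.Gamma r) * (‖z‖ ^ r)⁻¹ := by
    have hI : ∫ t in Ioi (0 : ℝ), K * (t ^ (r - 1) * Real.exp (-(c * ‖z‖ * t)))
        = K * ((1 / c) ^ r * Real.Gamma r) * (‖z‖ ^ r)⁻¹ := by
      rw [integral_const_mul, Real.integral_rpow_mul_exp_neg_mul_Ioi hr0 hcz, one_div, mul_inv,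
        Real.mul_rpow (by positivity) (by positivity), Real.inv_rpow (norm_nonneg z), one_div]
      ring
    rw [← hI]
    refine norm_integral_le_of_norm_le ?_ ?_
    · have := (integrableOn_rpow_mul_exp_neg_mul (r := r - 1) (b := c * ‖z‖) (by linarith)
        hcz).const_mul K
      simpa only [neg_mul] using this
    · refine (ae_restrict_iff' measurableSet_Ioi).2 (ae_of_all _ fun t ht => ?_)
      have ht' : (0 : ℝ) < t := ht
      have hw : 0 ≤ (a ^ 2 / 2 * (t : ℂ) ^ 2).re := by
        rw [← ofReal_pow, re_mul_ofReal, div_ofNat_re]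
        positivity
      have h1 := hE _ hw
      have h2 : ‖a ^ 2 / 2 * (t : ℂ) ^ 2‖ = ‖a‖ ^ 2 / 2 * t ^ 2 := by
        rw [norm_mul, norm_div, norm_pow, norm_pow, Complex.norm_real, Real.norm_eq_abs, sq_abs]
        norm_num
      rw [h2, mul_pow, ← mul_assoc, ← hK] at h1
      rw [norm_mul, norm_mul, norm_ofReal_cpow ht', Complex.norm_exp, neg_re, re_mul_ofReal]
      calc Real.exp (-(p.re * t)) * t ^ s.re * _
          ≤ Real.exp (-(c * ‖z‖ * t)) * t ^ s.re * (K * (t ^ 2) ^ N) := by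
            gcongr
        _ = K * (t ^ (r - 1) * Real.exp (-(c * ‖z‖ * t))) := by
            have : t ^ (r - 1) = t ^ s.re * (t ^ 2) ^ N := by
              rw [← pow_mul, ← Real.rpow_natCast, ← Real.rpow_add ht']
              congr 1
              rw [hr]
              push_cast
              ring
            rw [this]
            ring
  -- Undoing the rotation: the powers of `a` in `p = a z` cancel, so the series does not depend on
  -- the chosen direction.
  have hfin : hermiteLaplace s z - z ^ (-(s + 1)) * ∑ m ∈ Finset.range N,
        ((-1 / 2) ^ m / (m.factorial : ℂ) * Gamma (s + 2 * m + 1)) * (z ^ (2 * m))⁻¹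
      = a ^ (s + 1) * ((∫ t in Ioi (0 : ℝ), hermiteKernel z (a * t) * (t : ℂ) ^ s)
      - ∑ m ∈ Finset.range N, d m * (Gamma (s + 2 * m + 1) * (p ^ (s + 2 * m + 1))⁻¹)) := by
    rw [mul_sub, hermiteLaplace_rotate hs z ha, Finset.mul_sum, Finset.mul_sum]
    congr 1
    refine Finset.sum_congr rfl fun m _ => ?_
    have e1 : p ^ (s + 2 * m + 1) = p ^ (s + 1) * p ^ (2 * m) := by
      rw [show s + 2 * m + 1 = s + 1 + ((2 * m : ℕ) : ℂ) by push_cast; ring, cpow_add _ _ hp0,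
        cpow_natCast]
    have hpc : p ^ (s + 1) ≠ 0 := by simp [cpow_eq_zero_iff, hp0]
    have hac : a ^ (s + 1) ≠ 0 := by simp [cpow_eq_zero_iff, ha0]
    rw [cpow_eq_of_decayCone ha hpre, ← hp, cpow_neg, cpow_neg, e1, hd]
    have hz0' : z ≠ 0 := norm_pos_iff.1 hz0
    simp only
    rw [show p ^ (2 * m) = (a ^ 2) ^ m * z ^ (2 * m) by rw [hp, mul_pow, pow_mul a],
      show (-(a ^ 2 / 2)) ^ m = (-1 / 2) ^ m * (a ^ 2) ^ m by rw [← mul_pow]; congr 1; ring]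
    field_simp
  rw [hfin, hmain, norm_mul, mul_assoc]
  exact mul_le_mul_of_nonneg_left hrem (norm_nonneg _)

theorem continuous_hermiteLaplace {s : ℂ} (hs : -1 < s.re) : Continuous (hermiteLaplace s) := by
  refine continuous_iff_continuousAt.2 fun z₀ => ?_
  refine continuousAt_of_dominated (μ := volume.restrict (Ioi (0 : ℝ)))
    (bound := fun t => t ^ s.re * Real.exp ((‖z₀‖ + 1) * t - 1 / 2 * t ^ 2))
    (Eventually.of_forall fun z => ?_) ?_ (integrableOn_rpow_mul_exp_sub_sq hs one_half_pos) ?_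
  · have := continuousOn_comp_mul_mul_cpow (differentiable_hermiteKernel z).continuous 1 s
    simp only [one_mul] at this
    exact this.aestronglyMeasurable measurableSet_Ioi
  · have hev : ∀ᶠ z : ℂ in 𝓝 z₀, ‖z‖ < ‖z₀‖ + 1 :=
      continuous_norm.continuousAt.eventually (gt_mem_nhds (by linarith))
    filter_upwards [hev] with z hz
    refine (ae_restrict_iff' measurableSet_Ioi).2 (ae_of_all _ fun t ht => ?_)
    have ht' : (0 : ℝ) < t := ht
    rw [norm_mul, norm_ofReal_cpow ht', mul_comm]
    have h := norm_hermiteKernel_mul_le z 1 t ht'.le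
    simp only [one_mul, norm_one, mul_one, one_pow, one_re] at h
    gcongr
    refine h.trans (Real.exp_le_exp.2 ?_)
    gcongr
  · refine ae_of_all _ fun t => ?_
    unfold hermiteKernel
    fun_prop

theorem continuousAt_hermiteLaplace_index {s₀ : ℂ} (hs : -1 < s₀.re) (z : ℂ) :
    ContinuousAt (fun s => hermiteLaplace s z) s₀ := by
  -- The midpoint of `-1` and `re s₀`: below `re s₀` yet still integrable at the origin. Near `s₀`,
  -- `t^α` dominates for `t ≤ 1` and `t^β` for `t ≥ 1`.
  set α := (s₀.re - 1) / 2 with hα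
  set β := s₀.re + 1 with hβ
  set g : ℝ → ℝ := fun t => Real.exp (‖z‖ * t - 1 / 2 * t ^ 2) with hg
  have hint : Integrable (fun t => t ^ α * g t + t ^ β * g t) (volume.restrict (Ioi (0 : ℝ))) :=
    Integrable.add (integrableOn_rpow_mul_exp_sub_sq (by linarith) one_half_pos)
      (integrableOn_rpow_mul_exp_sub_sq (by linarith) one_half_pos)
  refine continuousAt_of_dominated (μ := volume.restrict (Ioi (0 : ℝ)))
    (Eventually.of_forall fun s => ?_) ?_ hint ?_
  · have := continuousOn_comp_mul_mul_cpow (differentiable_hermiteKernel z).continuous 1 s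
    simp only [one_mul] at this
    exact this.aestronglyMeasurable measurableSet_Ioi
  · have hev1 : ∀ᶠ s : ℂ in 𝓝 s₀, α < s.re :=
      continuous_re.continuousAt.eventually (lt_mem_nhds (by linarith))
    have hev2 : ∀ᶠ s : ℂ in 𝓝 s₀, s.re < β :=
      continuous_re.continuousAt.eventually (gt_mem_nhds (by linarith))
    filter_upwards [hev1, hev2] with s h1 h2
    refine (ae_restrict_iff' measurableSet_Ioi).2 (ae_of_all _ fun t ht => ?_)
    have ht' : (0 : ℝ) < t := ht
    have h := norm_hermiteKernel_mul_le z 1 t ht'.le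
    simp only [one_mul, norm_one, mul_one, one_pow, one_re] at h
    rw [norm_mul, norm_ofReal_cpow ht', mul_comm, ← add_mul]
    refine mul_le_mul ?_ h (norm_nonneg _) (by positivity)
    rcases le_total t 1 with h3 | h3
    · exact (Real.rpow_le_rpow_of_exponent_ge ht' h3 h1.le).trans
        (le_add_of_nonneg_right (by positivity))
    · exact (Real.rpow_le_rpow_of_exponent_le h3 h2.le).trans
        (le_add_of_nonneg_left (by positivity))
  · refine (ae_restrict_iff' measurableSet_Ioi).2 (ae_of_all _ fun t ht => ?_)
    have ht0 : (t : ℂ) ≠ 0 := ofReal_ne_zero.2 (ne_of_gt ht)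
    exact continuousAt_const.mul (_root_.continuousAt_const_cpow ht0)

end GUE

namespace GUE

/-! ### The Hermite functions -/

/-- The three-term recurrence propagates properties of the Hermite functions rightwards from the
half-plane where the Laplace integral represents them. -/
theorem induction_on_re {p : ℂ → Prop} (base : ∀ ν : ℂ, ν.re < -1 → p ν)
    (step : ∀ ν, p ν → p (ν - 1) → p (ν + 1)) (ν : ℂ) : p ν := by
  have key : ∀ k : ℕ, ∀ ν : ℂ, ν.re < -1 + k → p ν := by
    intro k
    induction k with
    | zero => intro ν hν; exact base ν (by simpa using hν)
    | succ k ih =>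
      intro ν hν
      push_cast at hν
      rw [← sub_add_cancel ν 1]
      refine step _ (ih _ ?_) (ih _ ?_) <;> simp <;> linarith
  obtain ⟨k, hk⟩ := exists_nat_gt (ν.re + 1)
  exact key k ν (by linarith)

theorem tendsto_hermiteContour_of_re_lt {ν : ℂ} (hν : ν.re < -1) (z : ℂ) :
    Tendsto (fun μ => hermiteContour μ z) (𝓝[≠] ν)
      (𝓝 (hermiteLaplace (-ν - 1) z / Gamma (-ν))) := by
  have hre : 0 < (-ν).re := by rw [neg_re]; linarith
  have hG : ContinuousAt Gamma (-ν) := by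
    refine (differentiableAt_Gamma _ fun m h => ?_).continuousAt
    rw [h] at hre
    have : (0 : ℝ) ≤ m := m.cast_nonneg
    simp at hre
    linarith
  have hL : ContinuousAt (fun s => hermiteLaplace s z) (-ν - 1) :=
    continuousAt_hermiteLaplace_index (by simp; linarith) z
  have h1 : ContinuousAt (fun μ : ℂ => hermiteLaplace (-μ - 1) z) ν :=
    ContinuousAt.comp (f := fun μ : ℂ => -μ - 1) (g := fun s => hermiteLaplace s z) hL
      (by fun_prop)
  have h2 : ContinuousAt (fun μ : ℂ => Gamma (-μ)) ν :=
    ContinuousAt.comp (f := fun μ : ℂ => -μ) (g := Gamma) hG (by fun_prop)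
  have h3 := (h1.div h2 (Gamma_ne_zero_of_re_pos hre)).tendsto.mono_left
    (nhdsWithin_le_nhds (s := {ν}ᶜ))
  refine h3.congr' ?_
  have hev : ∀ᶠ μ : ℂ in 𝓝[≠] ν, μ.re < -1 :=
    (continuous_re.continuousAt.eventually (gt_mem_nhds hν)).filter_mono nhdsWithin_le_nhds
  filter_upwards [hev, sin_pi_mul_eventually_ne_zero ν] with μ h1 h2
  exact (hermiteContour_eq_laplace h1 h2 z).symm

theorem tendsto_sub_const_punctured (ν c : ℂ) :
    Tendsto (fun μ : ℂ => μ - c) (𝓝[≠] ν) (𝓝[≠] (ν - c)) := by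
  refine tendsto_nhdsWithin_iff.2 ⟨?_, ?_⟩
  · exact ((by fun_prop : Continuous fun μ : ℂ => μ - c).tendsto ν).mono_left nhdsWithin_le_nhds
  · filter_upwards [self_mem_nhdsWithin] with μ hμ h
    exact hμ (sub_left_injective h)

theorem tendsto_hermiteContour_add_one {ν z y₀ y₁ : ℂ}
    (h0 : Tendsto (fun μ => hermiteContour μ z) (𝓝[≠] ν) (𝓝 y₀))
    (h1 : Tendsto (fun μ => hermiteContour μ z) (𝓝[≠] (ν - 1)) (𝓝 y₁)) :
    Tendsto (fun μ => hermiteContour μ z) (𝓝[≠] (ν + 1)) (𝓝 (z * y₀ - ν * y₁)) := by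
  have hs : Tendsto (fun μ : ℂ => μ - 1) (𝓝[≠] (ν + 1)) (𝓝[≠] ν) := by
    simpa using tendsto_sub_const_punctured (ν + 1) 1
  have hid : Tendsto (fun μ : ℂ => μ) (𝓝[≠] ν) (𝓝 ν) := nhdsWithin_le_nhds
  have h := ((h0.const_mul z).sub (hid.mul (h1.comp (tendsto_sub_const_punctured ν 1)))).comp hs
  refine h.congr' ?_
  filter_upwards [sin_pi_mul_eventually_ne_zero (ν + 1)] with μ hμ
  have e0 : μ - 1 ≠ 0 := fun h => hμ (by rw [sub_eq_zero.1 h]; simp)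
  have e1 : μ - 1 + 1 ≠ 0 := fun h => hμ (by rw [sub_add_cancel] at h; rw [h]; simp)
  have := hermiteContour_recurrence e0 e1 z
  rw [sub_add_cancel] at this
  simp only [Function.comp_apply]
  exact this.symm

/-- The `limUnder` in the definition is meaningful only where a limit exists. It exists for `re ν <
-1` by the Laplace form, and elsewhere by the recurrence. -/
theorem tendsto_hermiteContour (ν z : ℂ) :
    Tendsto (fun μ => hermiteContour μ z) (𝓝[≠] ν) (𝓝 (hermiteFun ν z)) :=
  tendsto_nhds_limUnder (induction_on_re
    (p := fun ν => ∃ y, Tendsto (fun μ => hermiteContour μ z) (𝓝[≠] ν) (𝓝 y))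
    (fun _ hν => ⟨_, tendsto_hermiteContour_of_re_lt hν z⟩)
    (fun _ ⟨_, h0⟩ ⟨_, h1⟩ => ⟨_, tendsto_hermiteContour_add_one h0 h1⟩) ν)

theorem hermiteFun_eq_laplace {ν : ℂ} (hν : ν.re < -1) (z : ℂ) :
    hermiteFun ν z = hermiteLaplace (-ν - 1) z / Gamma (-ν) :=
  (tendsto_hermiteContour_of_re_lt hν z).limUnder_eq

theorem hermiteFun_add_one (ν z : ℂ) :
    hermiteFun (ν + 1) z = z * hermiteFun ν z - ν * hermiteFun (ν - 1) z :=
  (tendsto_hermiteContour_add_one (tendsto_hermiteContour ν z)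
    (tendsto_hermiteContour (ν - 1) z)).limUnder_eq

theorem continuous_hermiteFun (ν : ℂ) : Continuous (hermiteFun ν) := by
  induction ν using induction_on_re with
  | base ν hν =>
    rw [funext (hermiteFun_eq_laplace hν)]
    exact (continuous_hermiteLaplace (by simp; linarith)).div_const _
  | step ν h0 h1 =>
    rw [funext (hermiteFun_add_one ν)]
    fun_prop

/-- The coefficients of the asymptotic series `He_ν(z) ∼ z^ν ∑ₘ hermiteCoeff ν m z^{-2m}`. -/
def hermiteCoeff (ν : ℂ) (m : ℕ) : ℂ :=
  (-1 / 2) ^ m / (m.factorial : ℂ) * ∏ j ∈ Finset.range (2 * m), (ν - j)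

theorem hermiteCoeff_zero (ν : ℂ) : hermiteCoeff ν 0 = 1 := by simp [hermiteCoeff]

/-- The recurrence `He_{ν+1} = z He_ν - ν He_{ν-1}` read on formal series, where `z^(ν-1)` is
`z^(ν+1)` shifted by one step in `z⁻²`. -/
theorem hermiteCoeff_add_one (ν : ℂ) (m : ℕ) : hermiteCoeff (ν + 1) (m + 1)
    = hermiteCoeff ν (m + 1) - ν * hermiteCoeff (ν - 1) m := by
  unfold hermiteCoeff
  set P := ∏ j ∈ Finset.range (2 * m), (ν - 1 - j) with hP
  have h1 : ∏ j ∈ Finset.range (2 * (m + 1)), (ν + 1 - j) = (ν + 1) * ν * P := by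
    rw [show 2 * (m + 1) = 2 * m + 1 + 1 by ring, Finset.prod_range_succ', Finset.prod_range_succ',
      hP]
    have : ∀ j : ℕ, ν + 1 - ((j + 1 + 1 : ℕ) : ℂ) = ν - 1 - j := fun j => by push_cast; ring
    simp only [this]
    push_cast
    ring
  have h2 : ∏ j ∈ Finset.range (2 * (m + 1)), (ν - j) = ν * (ν - 1 - 2 * m) * P := by
    rw [show 2 * (m + 1) = 2 * m + 1 + 1 by ring, Finset.prod_range_succ', Finset.prod_range_succ,
      hP]
    have : ∀ j : ℕ, ν - ((j + 1 : ℕ) : ℂ) = ν - 1 - j := fun j => by push_cast; ring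
    simp only [this]
    push_cast
    ring
  rw [h1, h2, Nat.factorial_succ, pow_succ]
  have h3 : (m : ℂ) + 1 ≠ 0 := Nat.cast_add_one_ne_zero m
  have h4 : (m.factorial : ℂ) ≠ 0 := Nat.cast_ne_zero.2 m.factorial_ne_zero
  push_cast
  field_simp
  ring

theorem Gamma_add_natCast {s : ℂ} (hs : 0 < s.re) (k : ℕ) :
    Gamma (s + k) = (∏ j ∈ Finset.range k, (s + j)) * Gamma s := by
  induction k with
  | zero => simp
  | succ k ih =>
    have h : s + k ≠ 0 := fun h => by
      have := congrArg re h
      simp at this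
      have : (0 : ℝ) ≤ k := k.cast_nonneg
      linarith
    rw [Finset.prod_range_succ, Nat.cast_succ, ← add_assoc, Gamma_add_one _ h, ih]
    ring

theorem prod_range_two_mul_neg_add (ν : ℂ) (m : ℕ) :
    ∏ j ∈ Finset.range (2 * m), (-ν + (j : ℂ)) = ∏ j ∈ Finset.range (2 * m), (ν - j) := by
  have : ∀ j ∈ Finset.range (2 * m), -ν + (j : ℂ) = -1 * (ν - j) := fun j _ => by ring
  rw [Finset.prod_congr rfl this, Finset.prod_mul_distrib]
  simp

theorem rpow_re_le_norm_cpow {z : ℂ} (hz : z ≠ 0) (ν : ℂ) :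
    ‖z‖ ^ ν.re ≤ Real.exp (Real.pi * |ν.im|) * ‖z ^ ν‖ := by
  rw [norm_cpow_of_ne_zero hz, mul_div_left_comm, ← Real.exp_sub]
  refine le_mul_of_one_le_right (by positivity) (Real.one_le_exp ?_)
  have h1 : z.arg * ν.im ≤ |z.arg| * |ν.im| := by rw [← abs_mul]; exact le_abs_self _
  have h2 := mul_le_mul_of_nonneg_right (abs_arg_le_pi z) (abs_nonneg ν.im)
  linarith

/-- Asymptotic expansion of the Hermite functions, in the cone `c ‖z‖ ≤ re (a z)`. -/
theorem hermiteFun_expansion {a : ℂ} (ha : a ∈ decayCone) {c : ℝ} (hc : 0 < c) (N : ℕ) (ν : ℂ) :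
    ∃ C : ℝ, ∀ z : ℂ, 1 ≤ ‖z‖ → c * ‖z‖ ≤ (a * z).re →
      ‖hermiteFun ν z - z ^ ν * ∑ m ∈ Finset.range N, hermiteCoeff ν m * (z ^ (2 * m))⁻¹‖
        ≤ C * ‖z ^ ν‖ * (‖z‖ ^ (2 * N))⁻¹ := by
  induction ν using induction_on_re with
  | base ν hν =>
    have hs : -1 < (-ν - 1).re := by simp; linarith
    have hre : 0 < (-ν).re := by rw [neg_re]; linarith
    have hG := Gamma_ne_zero_of_re_pos hre
    obtain ⟨C, hC⟩ := hermiteLaplace_expansion hs ha hc N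
    refine ⟨|C| * Real.exp (Real.pi * |ν.im|) * ‖(Gamma (-ν))⁻¹‖, fun z hz1 hz => ?_⟩
    have hz0 : 0 < ‖z‖ := zero_lt_one.trans_le hz1
    have h := hC z hz0 hz
    have e : hermiteFun ν z - z ^ ν * ∑ m ∈ Finset.range N, hermiteCoeff ν m * (z ^ (2 * m))⁻¹
        = (Gamma (-ν))⁻¹ * (hermiteLaplace (-ν - 1) z - z ^ (-(-ν - 1 + 1)) *
          ∑ m ∈ Finset.range N, ((-1 / 2) ^ m / (m.factorial : ℂ) * Gamma (-ν - 1 + 2 * m + 1))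
            * (z ^ (2 * m))⁻¹) := by
      rw [hermiteFun_eq_laplace hν, mul_sub, div_eq_inv_mul, mul_left_comm,
        show -(-ν - 1 + 1) = ν by ring]
      congr 2
      rw [Finset.mul_sum]
      refine Finset.sum_congr rfl fun m _ => ?_
      rw [show -ν - 1 + 2 * (m : ℂ) + 1 = -ν + ((2 * m : ℕ) : ℂ) by push_cast; ring,
        Gamma_add_natCast hre, prod_range_two_mul_neg_add, hermiteCoeff]
      field_simp
    rw [e, norm_mul]
    have hpow : (‖z‖ ^ ((-ν - 1).re + 1 + 2 * N))⁻¹ = ‖z‖ ^ ν.re * (‖z‖ ^ (2 * N))⁻¹ := by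
      rw [show (-ν - 1).re + 1 + 2 * (N : ℝ) = -ν.re + ((2 * N : ℕ) : ℝ) by simp,
        Real.rpow_add hz0, Real.rpow_neg hz0.le, mul_inv, inv_inv, Real.rpow_natCast]
    rw [hpow] at h
    calc ‖(Gamma (-ν))⁻¹‖ * _ ≤ ‖(Gamma (-ν))⁻¹‖ * (C * (‖z‖ ^ ν.re * (‖z‖ ^ (2 * N))⁻¹)) := by gcongr
      _ ≤ ‖(Gamma (-ν))⁻¹‖ * (|C| * ((Real.exp (Real.pi * |ν.im|) * ‖z ^ ν‖)
          * (‖z‖ ^ (2 * N))⁻¹)) := by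
        gcongr
        · exact le_abs_self C
        · exact rpow_re_le_norm_cpow (norm_pos_iff.1 hz0) ν
      _ = _ := by ring
  | step ν h0 h1 =>
    obtain ⟨C₀, hC₀⟩ := h0
    obtain ⟨C₁, hC₁⟩ := h1
    -- The coefficients for `ν - 1` shifted by one place. The shift pushes one term, `g N`, past the
    -- truncation, and it is absorbed into the error.
    let g : ℕ → ℂ := fun m => Nat.casesOn m 0 fun k => hermiteCoeff (ν - 1) k
    have hg0 : g 0 = 0 := rfl
    have hgs : ∀ k, g (k + 1) = hermiteCoeff (ν - 1) k := fun _ => rfl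
    refine ⟨C₀ + ‖ν‖ * |C₁| + ‖ν * g N‖, fun z hz1 hz => ?_⟩
    have hz0 : z ≠ 0 := norm_pos_iff.1 (zero_lt_one.trans_le hz1)
    have e0 : z ^ (ν + 1) = z * z ^ ν := by rw [cpow_add _ _ hz0, cpow_one, mul_comm]
    have e1 : z ^ (ν + 1) = z ^ 2 * z ^ (ν - 1) := by
      rw [e0, cpow_sub _ _ hz0, cpow_one]
      field_simp
    have hsum : ∑ m ∈ Finset.range N, hermiteCoeff (ν + 1) m * (z ^ (2 * m))⁻¹
        = ∑ m ∈ Finset.range N, hermiteCoeff ν m * (z ^ (2 * m))⁻¹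
          - ν * ((z ^ 2)⁻¹ * ∑ m ∈ Finset.range N, hermiteCoeff (ν - 1) m * (z ^ (2 * m))⁻¹)
          + ν * g N * (z ^ (2 * N))⁻¹ := by
      have h2 : (z ^ 2)⁻¹ * ∑ m ∈ Finset.range N, hermiteCoeff (ν - 1) m * (z ^ (2 * m))⁻¹
          = ∑ m ∈ Finset.range N, g m * (z ^ (2 * m))⁻¹ + g N * (z ^ (2 * N))⁻¹ := by
        rw [← Finset.sum_range_succ (fun m => g m * (z ^ (2 * m))⁻¹), Finset.sum_range_succ',
          Finset.mul_sum]
        rw [hg0, zero_mul, add_zero]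
        refine Finset.sum_congr rfl fun m _ => ?_
        rw [hgs, mul_add, pow_add, mul_inv]
        ring
      rw [h2, mul_add, mul_assoc, sub_add_eq_sub_sub, sub_add_cancel, Finset.mul_sum,
        ← Finset.sum_sub_distrib]
      refine Finset.sum_congr rfl fun m _ => ?_
      cases m with
      | zero => simp [hg0, hermiteCoeff_zero]
      | succ m => rw [hermiteCoeff_add_one, hgs]; ring
    have e : hermiteFun (ν + 1) z - z ^ (ν + 1) *
          ∑ m ∈ Finset.range N, hermiteCoeff (ν + 1) m * (z ^ (2 * m))⁻¹
        = z * (hermiteFun ν z - z ^ ν * ∑ m ∈ Finset.range N, hermiteCoeff ν m * (z ^ (2 * m))⁻¹)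
          - ν * (hermiteFun (ν - 1) z - z ^ (ν - 1) *
            ∑ m ∈ Finset.range N, hermiteCoeff (ν - 1) m * (z ^ (2 * m))⁻¹)
          - ν * g N * z ^ (ν + 1) * (z ^ (2 * N))⁻¹ := by
      have e2 : z ^ (ν - 1) = z ^ (ν + 1) * (z ^ 2)⁻¹ := by rw [e1]; field_simp
      rw [hermiteFun_add_one, hsum, e2, e0]
      ring
    have n0 : ‖z ^ (ν + 1)‖ = ‖z‖ * ‖z ^ ν‖ := by rw [e0, norm_mul]
    have n1 : ‖z ^ (ν - 1)‖ ≤ ‖z ^ (ν + 1)‖ := by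
      rw [e1, norm_mul, norm_pow]
      exact le_mul_of_one_le_left (norm_nonneg _) (one_le_pow₀ hz1)
    rw [e]
    refine (norm_sub_le _ _).trans ((add_le_add_left (norm_sub_le _ _) _).trans ?_)
    rw [norm_mul z, norm_mul ν, norm_mul, norm_mul _ (z ^ (ν + 1)), norm_inv, norm_pow]
    calc _ ≤ ‖z‖ * (C₀ * ‖z ^ ν‖ * (‖z‖ ^ (2 * N))⁻¹)
          + ‖ν‖ * (|C₁| * ‖z ^ (ν + 1)‖ * (‖z‖ ^ (2 * N))⁻¹)
          + ‖ν * g N‖ * ‖z ^ (ν + 1)‖ * (‖z‖ ^ (2 * N))⁻¹ := by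
          gcongr
          · exact hC₀ z hz1 hz
          · refine (hC₁ z hz1 hz).trans ?_
            gcongr
            exact le_abs_self C₁
      _ = _ := by rw [n0]; ring

end GUE

namespace GUE

/-! ### The expansion of the integrand -/

/-- The product of two truncations agrees with the truncated Cauchy product below degree `N`, so the
difference is `X^N` times a polynomial, which is bounded on the unit disc. -/
theorem norm_sum_mul_sum_sub_le (a b : ℕ → ℂ) (N : ℕ) : ∃ K : ℝ, 0 ≤ K ∧ ∀ x : ℂ, ‖x‖ ≤ 1 →
    ‖(∑ i ∈ Finset.range N, a i * x ^ i) * (∑ j ∈ Finset.range N, b j * x ^ j)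
      - ∑ m ∈ Finset.range N, (∑ p ∈ Finset.HasAntidiagonal.antidiagonal m, a p.1 * b p.2) * x ^ m‖
      ≤ K * ‖x‖ ^ N := by
  set A := PowerSeries.mk a with hA
  set B := PowerSeries.mk b with hB
  have heval : ∀ (f : PowerSeries ℂ) (x : ℂ), (PowerSeries.trunc N f).eval x
      = ∑ i ∈ Finset.range N, PowerSeries.coeff i f * x ^ i := fun f x => by
    simpa [Polynomial.eval₂_eq_eval_map] using
      PowerSeries.eval₂_trunc_eq_sum_range x (RingHom.id ℂ) N f
  obtain ⟨Q, hQ⟩ : Polynomial.X ^ N ∣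
      PowerSeries.trunc N A * PowerSeries.trunc N B - PowerSeries.trunc N (A * B) := by
    refine Polynomial.X_pow_dvd_iff.2 fun d hd => ?_
    rw [Polynomial.coeff_sub, PowerSeries.coeff_trunc, if_pos hd,
      PowerSeries.coeff_mul_eq_coeff_trunc_mul_trunc A B hd, ← Polynomial.coe_mul,
      Polynomial.coeff_coe, sub_self]
  obtain ⟨K, hK⟩ := (isCompact_closedBall (0 : ℂ) 1).exists_bound_of_continuousOn
    Q.continuous.continuousOn
  refine ⟨K, (norm_nonneg _).trans (hK 0 (by simp)), fun x hx => ?_⟩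
  have h := congrArg (Polynomial.eval x) hQ
  simp only [Polynomial.eval_sub, Polynomial.eval_mul, heval, Polynomial.eval_pow,
    Polynomial.eval_X, hA, hB, PowerSeries.coeff_mk, PowerSeries.coeff_mul] at h
  rw [h, norm_mul, norm_pow, mul_comm]
  exact mul_le_mul_of_nonneg_right (hK x (by simpa using hx)) (by positivity)

/-- The directions `u` with `arg u` in a closed subinterval of `(-3π/4, π/4)`. -/
def cone (c : ℝ) : Set ℂ := {u | c * ‖u‖ ≤ u.re - u.im}

theorem cone_antitone {c d : ℝ} (h : c ≤ d) : cone d ⊆ cone c := fun u hu =>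
  (mul_le_mul_of_nonneg_right h (norm_nonneg u)).trans hu

theorem arg_I_add_arg_mem {u : ℂ} (hu : 0 < u.re - u.im) :
    I.arg + u.arg ∈ Ioc (-Real.pi) Real.pi := by
  have h : u.arg ≤ Real.pi / 2 := by
    rw [arg_le_pi_div_two_iff]
    by_contra! h
    linarith [h.1, h.2]
  rw [arg_I]
  constructor <;> linarith [neg_pi_lt_arg u, Real.pi_pos]

/-- The single direction `a = 1 + (1 - c/2) i`, close to the edge of the decay cone, serves the
whole cone: `re (a u) = (re u - im u) + (c/2) im u ≥ (c/2) ‖u‖`. -/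
theorem hermiteFun_expansion_of_mem_cone {c : ℝ} (hc : 0 < c) (hc1 : c ≤ 1) (N : ℕ) (ν : ℂ) :
    ∃ C : ℝ, ∀ u : ℂ, 1 ≤ ‖u‖ → u ∈ cone c →
      ‖hermiteFun ν u - u ^ ν * ∑ m ∈ Finset.range N, hermiteCoeff ν m * (u ^ (2 * m))⁻¹‖
        ≤ C * ‖u ^ ν‖ * (‖u‖ ^ (2 * N))⁻¹ := by
  have ha : (1 + ((1 - c / 2 : ℝ) : ℂ) * I) ∈ decayCone := by
    rw [decayCone, mem_ofPred_eq]
    simp only [add_im, one_im, im_ofReal_mul, I_im, add_re, one_re, re_ofReal_mul, I_re]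
    rw [abs_lt]
    constructor <;> linarith
  obtain ⟨C, hC⟩ := hermiteFun_expansion ha (half_pos hc) N ν
  refine ⟨C, fun u hu1 hu => hC u hu1 ?_⟩
  have hu' : c * ‖u‖ ≤ u.re - u.im := hu
  have h1 : ((1 + ((1 - c / 2 : ℝ) : ℂ) * I) * u).re = (u.re - u.im) + c / 2 * u.im := by
    simp [mul_re]
    ring
  have h2 := (abs_le.1 (abs_im_le_norm u)).1
  rw [h1]
  nlinarith

/-- The conjugate direction works for the argument `iu`, and `i^{2m}` supplies the sign `(-1)^m`. -/
theorem hermiteFun_I_mul_expansion_of_mem_cone {c : ℝ} (hc : 0 < c) (hc1 : c ≤ 1) (N : ℕ) (ν : ℂ) :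
    ∃ C : ℝ, ∀ u : ℂ, 1 ≤ ‖u‖ → u ∈ cone c →
      ‖hermiteFun ν (I * u) - (I * u) ^ ν *
          ∑ m ∈ Finset.range N, (hermiteCoeff ν m * (-1) ^ m) * (u ^ (2 * m))⁻¹‖
        ≤ C * ‖(I * u) ^ ν‖ * (‖u‖ ^ (2 * N))⁻¹ := by
  have ha : (1 - ((1 - c / 2 : ℝ) : ℂ) * I) ∈ decayCone := by
    rw [decayCone, mem_ofPred_eq]
    simp only [sub_im, one_im, im_ofReal_mul, I_im, sub_re, one_re, re_ofReal_mul, I_re]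
    rw [abs_lt]
    constructor <;> linarith
  obtain ⟨C, hC⟩ := hermiteFun_expansion ha (half_pos hc) N ν
  refine ⟨C, fun u hu1 hu => ?_⟩
  have hu' : c * ‖u‖ ≤ u.re - u.im := hu
  have hn : ‖I * u‖ = ‖u‖ := by rw [norm_mul, norm_I, one_mul]
  have h1 : ((1 - ((1 - c / 2 : ℝ) : ℂ) * I) * (I * u)).re = (u.re - u.im) - c / 2 * u.re := by
    simp [mul_re]
    ring
  have h2 := (abs_le.1 (abs_re_le_norm u)).2
  have h := hC (I * u) (by rwa [hn]) (by rw [h1, hn]; nlinarith)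
  rw [hn] at h
  have e : ∀ m ∈ Finset.range N, hermiteCoeff ν m * ((I * u) ^ (2 * m))⁻¹
      = (hermiteCoeff ν m * (-1) ^ m) * (u ^ (2 * m))⁻¹ := fun m _ => by
    rw [mul_pow, pow_mul I, I_sq, mul_inv, ← inv_pow, inv_neg, inv_one, mul_assoc]
  rwa [Finset.sum_congr rfl e] at h

/-- The coefficients of the asymptotic series of `i^{n+1} He_{n-1}(u) He_{-n-1}(iu)`. -/
def productCoeff (n : ℂ) (m : ℕ) : ℂ :=
  ∑ p ∈ Finset.HasAntidiagonal.antidiagonal m,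
    hermiteCoeff (n - 1) p.1 * (hermiteCoeff (-n - 1) p.2 * (-1) ^ p.2)

/-- The meeting point of the two computations. With `l + m = q`, the leg factors `n - 1 - j` belong
to `He_{n-1}` and the arm factors `n + 1 + j` to `He_{-n-1}`; an even number of sign changes relates
`-n - 1 - j` to `n + 1 + j`, so the sums agree term by term. -/
theorem traceMoment_two_mul_eq_productCoeff (n ε : ℂ) (q : ℕ) :
    (2 * q + 1) * traceMoment n ε (2 * q) = n * productCoeff n q * ε ^ q := by
  have h0 : (2 * (q : ℂ) + 1) ≠ 0 := by exact_mod_cast (2 * q).succ_ne_zero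
  rw [traceMoment_two_mul, ← mul_assoc, mul_one_div_cancel h0, one_mul, productCoeff,
    Finset.Nat.sum_antidiagonal_eq_sum_range_succ_mk, Finset.mul_sum, Finset.sum_mul]
  refine Finset.sum_congr rfl fun m hm => ?_
  have hm' : m ≤ q := Nat.lt_succ_iff.1 (Finset.mem_range.1 hm)
  obtain ⟨l, rfl⟩ := Nat.exists_eq_add_of_le hm'
  simp only [Nat.add_sub_cancel_left, hookCoeff, hookProd, hermiteCoeff]
  have h1 : ∏ j ∈ Finset.range (2 * l), (-n - 1 - (j : ℂ))
      = ∏ j ∈ Finset.range (2 * l), (n + 1 + (j : ℂ)) := by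
    rw [← prod_range_two_mul_neg_add]
    refine Finset.prod_congr rfl fun j _ => ?_
    ring
  rw [h1, show (-1 / 2 : ℂ) = (-1) * (1 / 2) by ring, mul_pow, mul_pow, div_eq_mul_one_div ε 2,
    mul_pow, pow_add ε, pow_add (1 / 2 : ℂ), pow_add ε]
  have h2 : ((-1 : ℂ) ^ l) * (-1) ^ l = 1 := by rw [← mul_pow]; simp
  linear_combination (-(n * ((-1) ^ m * (1 / 2) ^ m / (m.factorial : ℂ)
    * ∏ j ∈ Finset.range (2 * m), (n - 1 - (j : ℂ))) * ((1 / 2) ^ l / (l.factorial : ℂ)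
    * ∏ j ∈ Finset.range (2 * l), (n + 1 + (j : ℂ))) * (ε ^ m * ε ^ l))) * h2

theorem norm_mul_sub_mul_le_of_le {A B X Y : ℂ} {d e s t : ℝ} (hA : ‖A - X‖ ≤ d)
    (hY : ‖B - Y‖ ≤ e) (hB : ‖B‖ ≤ s) (hX : ‖X‖ ≤ t) : ‖A * B - X * Y‖ ≤ d * s + t * e := by
  rw [show A * B - X * Y = (A - X) * B + X * (B - Y) by ring]
  refine (norm_add_le _ _).trans (add_le_add ?_ ?_) <;> rw [norm_mul]
  · exact mul_le_mul hA hB (norm_nonneg _) ((norm_nonneg _).trans hA)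
  · exact mul_le_mul hX hY (norm_nonneg _) ((norm_nonneg _).trans hX)

theorem product_expansion {c : ℝ} (hc : 0 < c) (hc1 : c ≤ 1) (N : ℕ) (n : ℂ) :
    ∃ C : ℝ, ∀ u : ℂ, 1 ≤ ‖u‖ → u ∈ cone c →
      ‖I ^ (n + 1) * (hermiteFun (n - 1) u * hermiteFun (-n - 1) (I * u))
        - ∑ m ∈ Finset.range N, productCoeff n m * (u ^ (2 * m + 2))⁻¹‖
        ≤ C * (‖u‖ ^ (2 * N + 2))⁻¹ := by
  obtain ⟨C₁, hC₁⟩ := hermiteFun_expansion_of_mem_cone hc hc1 N (n - 1)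
  obtain ⟨C₂, hC₂⟩ := hermiteFun_I_mul_expansion_of_mem_cone hc hc1 N (-n - 1)
  obtain ⟨K, hK0, hK⟩ := norm_sum_mul_sum_sub_le (hermiteCoeff (n - 1))
    (fun m => hermiteCoeff (-n - 1) m * (-1) ^ m) N
  set a := hermiteCoeff (n - 1) with ha
  set b : ℕ → ℂ := fun m => hermiteCoeff (-n - 1) m * (-1) ^ m with hb
  set M₁ := ∑ m ∈ Finset.range N, ‖a m‖ with hM₁
  set M₂ := ∑ m ∈ Finset.range N, ‖b m‖ with hM₂
  refine ⟨|C₁| * (|C₂| + M₂) + M₁ * |C₂| + K, fun u hu1 hu => ?_⟩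
  have hun : 0 < ‖u‖ := zero_lt_one.trans_le hu1
  have hu0 : u ≠ 0 := norm_pos_iff.1 hun
  have hu' : c * ‖u‖ ≤ u.re - u.im := hu
  set x := (u ^ 2)⁻¹ with hx
  have hxm : ∀ m, (u ^ (2 * m))⁻¹ = x ^ m := fun m => by rw [hx, pow_mul, inv_pow]
  have hx1 : ‖x‖ ≤ 1 := by
    rw [hx, norm_inv, norm_pow]
    exact inv_le_one_of_one_le₀ (one_le_pow₀ hu1)
  have hr : (‖u‖ ^ (2 * N))⁻¹ = ‖x‖ ^ N := by
    rw [hx, norm_inv, norm_pow, pow_mul, inv_pow]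
  have hr2 : (‖u‖ ^ (2 * N + 2))⁻¹ = ‖x‖ * ‖x‖ ^ N := by
    rw [← hr, hx, norm_inv, norm_pow, pow_add, mul_inv]
    ring
  have hr1 : ‖x‖ ^ N ≤ 1 := pow_le_one₀ (norm_nonneg x) hx1
  have e1 := hC₁ u hu1 hu
  have e2 := hC₂ u hu1 hu
  simp only [hxm, hr] at e1 e2
  have bound : ∀ f : ℕ → ℂ, ‖∑ m ∈ Finset.range N, f m * x ^ m‖
      ≤ ∑ m ∈ Finset.range N, ‖f m‖ := fun f =>
    norm_sum_le_of_le _ fun m _ => by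
      rw [norm_mul, norm_pow]
      exact mul_le_of_le_one_right (norm_nonneg _) (pow_le_one₀ (norm_nonneg x) hx1)
  have b1 := bound a
  have b2 := bound b
  have e3 := hK x hx1
  set S₁ := ∑ m ∈ Finset.range N, a m * x ^ m with hS₁
  set S₂ := ∑ m ∈ Finset.range N, b m * x ^ m with hS₂
  set A := hermiteFun (n - 1) u with hA
  set B := hermiteFun (-n - 1) (I * u) with hB
  set p := u ^ (n - 1) with hp
  set q := (I * u) ^ (-n - 1) with hq
  -- The exponents `n - 1` and `-n - 1` add up to `-2`, and the powers of `i` cancel. Membership in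
  -- the cone keeps `arg i + arg u` in the principal range.
  have hJ : I ^ (n + 1) * (p * q) = x := by
    rw [hp, hq, mul_cpow_of_arg I_ne_zero hu0 (arg_I_add_arg_mem ((by positivity : 0 < c * ‖u‖).trans_le hu')),
      show I ^ (n + 1) * (u ^ (n - 1) * (I ^ (-n - 1) * u ^ (-n - 1)))
        = (I ^ (n + 1) * I ^ (-n - 1)) * (u ^ (n - 1) * u ^ (-n - 1)) by ring,
      ← cpow_add _ _ I_ne_zero, ← cpow_add _ _ hu0, show n + 1 + (-n - 1) = 0 by ring,
      show n - 1 + (-n - 1) = -(2 : ℕ) by push_cast; ring, cpow_zero, one_mul, cpow_neg,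
      cpow_natCast, hx]
  have hnI : ‖I ^ (n + 1)‖ * (‖p‖ * ‖q‖) = ‖x‖ := by rw [← norm_mul, ← norm_mul, hJ]
  have hsum : ∑ m ∈ Finset.range N, productCoeff n m * (u ^ (2 * m + 2))⁻¹
      = x * ∑ m ∈ Finset.range N, (∑ p ∈ Finset.HasAntidiagonal.antidiagonal m, a p.1 * b p.2) * x ^ m := by
    rw [Finset.mul_sum]
    refine Finset.sum_congr rfl fun m _ => ?_
    rw [pow_add, mul_inv, hxm, ← hx, productCoeff]
    ring
  have e1' : ‖A - p * S₁‖ ≤ |C₁| * ‖p‖ * ‖x‖ ^ N := e1.trans (by gcongr; exact le_abs_self C₁)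
  have e2' : ‖B - q * S₂‖ ≤ |C₂| * ‖q‖ * ‖x‖ ^ N := e2.trans (by gcongr; exact le_abs_self C₂)
  have hBn : ‖B‖ ≤ ‖q‖ * (|C₂| + M₂) := by
    calc ‖B‖ = ‖(B - q * S₂) + q * S₂‖ := by rw [sub_add_cancel]
      _ ≤ ‖B - q * S₂‖ + ‖q * S₂‖ := norm_add_le _ _
      _ ≤ |C₂| * ‖q‖ * 1 + ‖q‖ * M₂ := by
        rw [norm_mul q]
        exact add_le_add (e2'.trans (mul_le_mul_of_nonneg_left hr1 (by positivity)))
          (mul_le_mul_of_nonneg_left b2 (norm_nonneg q))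
      _ = _ := by ring
  have hX : ‖p * S₁‖ ≤ ‖p‖ * M₁ := by
    rw [norm_mul]
    exact mul_le_mul_of_nonneg_left b1 (norm_nonneg p)
  have hin := norm_mul_sub_mul_le_of_le e1' e2' hBn hX
  have hdecomp : I ^ (n + 1) * (A * B)
      - ∑ m ∈ Finset.range N, productCoeff n m * (u ^ (2 * m + 2))⁻¹
      = I ^ (n + 1) * (A * B - p * S₁ * (q * S₂)) + x * (S₁ * S₂ -
        ∑ m ∈ Finset.range N, (∑ p ∈ Finset.HasAntidiagonal.antidiagonal m, a p.1 * b p.2)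
          * x ^ m) := by
    rw [hsum, ← hJ]
    ring
  rw [hdecomp, hr2]
  refine (norm_add_le _ _).trans ?_
  rw [norm_mul, norm_mul x]
  refine (add_le_add (mul_le_mul_of_nonneg_left hin (norm_nonneg _))
    (mul_le_mul_of_nonneg_left e3 (norm_nonneg x))).trans_eq ?_
  rw [← hnI]
  ring

end GUE

namespace GUE

/-! ### Integration along a ray -/

theorem integrableOn_and_integral_inv_pow {r s : ℝ} (hr : 0 < r) (hs : 0 < s) (k : ℕ) :
    IntegrableOn (fun t : ℝ => ((r + t * s) ^ (k + 2))⁻¹) (Ioi 0) ∧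
      ∫ t in Ioi (0 : ℝ), ((r + t * s) ^ (k + 2))⁻¹ = (r ^ (k + 1))⁻¹ / ((k + 1) * s) := by
  have hk : (0 : ℝ) < k + 1 := by positivity
  have hpos : ∀ t ∈ Ici (0 : ℝ), 0 < r + t * s := fun t ht =>
    add_pos_of_pos_of_nonneg hr (mul_nonneg ht hs.le)
  have hd : ∀ t ∈ Ici (0 : ℝ), HasDerivAt (fun t : ℝ => -(((r + t * s) ^ (k + 1))⁻¹ / ((k + 1) * s)))
      ((r + t * s) ^ (k + 2))⁻¹ t := fun t ht => by
    have h1 := ((((hasDerivAt_id t).mul_const s).const_add r).pow (k + 1)).inv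
      (pow_ne_zero _ (hpos t ht).ne')
    convert! (h1.div_const ((k + 1) * s)).neg using 1
    have := (hpos t ht).ne'
    simp only [id_eq, Pi.pow_apply, Nat.add_sub_cancel]
    push_cast
    field_simp
    ring
  have hl : Tendsto (fun t : ℝ => -(((r + t * s) ^ (k + 1))⁻¹ / ((k + 1) * s))) atTop (𝓝 0) := by
    have h1 : Tendsto (fun t : ℝ => r + t * s) atTop atTop :=
      tendsto_atTop_add_const_left _ _ (tendsto_id.atTop_mul_const hs)
    have h2 := tendsto_inv_atTop_zero.comp ((tendsto_pow_atTop (Nat.succ_ne_zero k)).comp h1)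
    simpa using (h2.div_const ((k + 1) * s)).neg
  have hnn : ∀ t ∈ Ioi (0 : ℝ), 0 ≤ ((r + t * s) ^ (k + 2))⁻¹ := fun t ht =>
    inv_nonneg.2 (pow_nonneg (hpos t (Ioi_subset_Ici_self ht)).le _)
  refine ⟨integrableOn_Ioi_deriv_of_nonneg' hd hnn hl, ?_⟩
  rw [integral_Ioi_of_hasDerivAt_of_nonneg' hd hnn hl]
  simp

/-- The functional `re - im` is linear and positive on the cone, so there is no cancellation along
the ray. -/
theorem ray_mem_cone_aux {c : ℝ} {u v : ℂ} (hu : u ∈ cone c) (hv : v ∈ cone c) {t : ℝ}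
    (ht : 0 ≤ t) : c * (‖u‖ + t * ‖v‖) ≤ (u + t * v).re - (u + t * v).im := by
  have hu' : c * ‖u‖ ≤ u.re - u.im := hu
  have hv' : c * ‖v‖ ≤ v.re - v.im := hv
  have h := mul_le_mul_of_nonneg_left hv' ht
  rw [add_re, add_im, re_ofReal_mul, im_ofReal_mul]
  linarith

theorem ray_mem_cone {c : ℝ} (hc : 0 ≤ c) {u v : ℂ} (hu : u ∈ cone c) (hv : v ∈ cone c) {t : ℝ}
    (ht : 0 ≤ t) : u + t * v ∈ cone c := by
  refine le_trans (mul_le_mul_of_nonneg_left ?_ hc) (ray_mem_cone_aux hu hv ht)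
  refine (norm_add_le _ _).trans_eq ?_
  rw [norm_mul, Complex.norm_real, Real.norm_eq_abs, abs_of_nonneg ht]

theorem le_norm_ray {c : ℝ} {u v : ℂ} (hu : u ∈ cone c) (hv : v ∈ cone c) {t : ℝ}
    (ht : 0 ≤ t) : c / 2 * (‖u‖ + t * ‖v‖) ≤ ‖u + t * v‖ := by
  have h := ray_mem_cone_aux hu hv ht
  have h1 := (abs_le.1 (abs_re_le_norm (u + t * v))).2
  have h2 := (abs_le.1 (abs_im_le_norm (u + t * v))).1
  linarith

theorem inv_pow_norm_ray_le {c : ℝ} (hc : 0 < c) {u v : ℂ} (hu0 : u ≠ 0) (hu : u ∈ cone c)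
    (hv : v ∈ cone c) {t : ℝ} (ht : 0 ≤ t) (k : ℕ) :
    (‖u + t * v‖ ^ k)⁻¹ ≤ ((c / 2) ^ k)⁻¹ * ((‖u‖ + t * ‖v‖) ^ k)⁻¹ := by
  rw [← mul_inv, ← mul_pow]
  have : 0 < ‖u‖ := norm_pos_iff.2 hu0
  have h : 0 < c / 2 * (‖u‖ + t * ‖v‖) := by positivity
  exact inv_anti₀ (pow_pos h k) (pow_le_pow_left₀ h.le (le_norm_ray hu hv ht) k)

theorem ray_ne_zero {c : ℝ} (hc : 0 < c) {u v : ℂ} (hu0 : u ≠ 0) (hu : u ∈ cone c)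
    (hv : v ∈ cone c) {t : ℝ} (ht : 0 ≤ t) : u + t * v ≠ 0 := by
  have : 0 < ‖u‖ := norm_pos_iff.2 hu0
  exact norm_pos_iff.1 ((by positivity : 0 < c / 2 * (‖u‖ + t * ‖v‖)).trans_le
    (le_norm_ray hu hv ht))

theorem integrableOn_and_integral_ray_inv_pow {c : ℝ} (hc : 0 < c) {u v : ℂ} (hu0 : u ≠ 0)
    (hv0 : v ≠ 0) (hu : u ∈ cone c) (hv : v ∈ cone c) (k : ℕ) :
    IntegrableOn (fun t : ℝ => ((u + t * v) ^ (k + 2))⁻¹ * v) (Ioi 0) ∧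
      ∫ t in Ioi (0 : ℝ), ((u + t * v) ^ (k + 2))⁻¹ * v = (u ^ (k + 1))⁻¹ / (k + 1) := by
  have hk : ((k : ℂ) + 1) ≠ 0 := Nat.cast_add_one_ne_zero k
  have hne : ∀ t ∈ Ici (0 : ℝ), u + t * v ≠ 0 := fun t ht => ray_ne_zero hc hu0 hu hv ht
  have hd : ∀ t ∈ Ici (0 : ℝ), HasDerivAt (fun t : ℝ => -(((u + t * v) ^ (k + 1))⁻¹ / ((k : ℂ) + 1)))
      (((u + t * v) ^ (k + 2))⁻¹ * v) t := fun t ht => by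
    have h0 : HasDerivAt (fun t : ℝ => u + (t : ℂ) * v) v t := by
      simpa using ((hasDerivAt_id t).ofReal_comp.mul_const v).const_add u
    have h1 := (h0.pow (k + 1)).inv (pow_ne_zero _ (hne t ht))
    convert! (h1.div_const ((k : ℂ) + 1)).neg using 1
    have := hne t ht
    simp only [Pi.pow_apply, Nat.add_sub_cancel]
    push_cast
    field_simp
    ring
  have hint : IntegrableOn (fun t : ℝ => ((u + t * v) ^ (k + 2))⁻¹ * v) (Ioi 0) := by
    refine Integrable.mono' (((integrableOn_and_integral_inv_pow (norm_pos_iff.2 hu0)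
      (norm_pos_iff.2 hv0) k).1.const_mul ((c / 2) ^ (k + 2))⁻¹).mul_const ‖v‖) ?_ ?_
    · refine ContinuousOn.aestronglyMeasurable (fun t ht => ?_) measurableSet_Ioi
      have : ContinuousAt (fun t : ℝ => (u + (t : ℂ) * v) ^ (k + 2)) t := by fun_prop
      exact ((this.inv₀ (pow_ne_zero _ (hne t (Ioi_subset_Ici_self ht)))).mul
        continuousAt_const).continuousWithinAt
    · refine (ae_restrict_iff' measurableSet_Ioi).2 (ae_of_all _ fun t ht => ?_)
      rw [norm_mul, norm_inv, norm_pow]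
      exact mul_le_mul_of_nonneg_right (inv_pow_norm_ray_le hc hu0 hu hv (le_of_lt ht) _)
        (norm_nonneg v)
  have hl : Tendsto (fun t : ℝ => -(((u + t * v) ^ (k + 1))⁻¹ / ((k : ℂ) + 1))) atTop (𝓝 0) := by
    have h1 : Tendsto (fun t : ℝ => c / 2 * (‖u‖ + t * ‖v‖)) atTop atTop :=
      (tendsto_atTop_add_const_left _ _ (tendsto_id.atTop_mul_const
        (norm_pos_iff.2 hv0))).const_mul_atTop (half_pos hc)
    have h2 : Tendsto (fun t : ℝ => ‖u + t * v‖) atTop atTop :=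
      tendsto_atTop_mono' _ ((eventually_ge_atTop 0).mono fun t ht => le_norm_ray hu hv ht) h1
    have h3 := tendsto_inv_atTop_zero.comp ((tendsto_pow_atTop (Nat.succ_ne_zero k)).comp h2)
    have h4 : Tendsto (fun t : ℝ => ((u + t * v) ^ (k + 1))⁻¹) atTop (𝓝 0) := by
      rw [tendsto_zero_iff_norm_tendsto_zero]
      simpa [Function.comp_def] using h3
    simpa using (h4.div_const ((k : ℂ) + 1)).neg
  refine ⟨hint, ?_⟩
  rw [integral_Ioi_of_hasDerivAt_of_tendsto' hd hint hl]
  simp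

theorem integrableOn_ray {F : ℂ → ℂ} (hF : Continuous F) {c C : ℝ} (hc : 0 < c)
    (hbound : ∀ u : ℂ, 1 ≤ ‖u‖ → u ∈ cone c → ‖F u‖ ≤ C * (‖u‖ ^ 2)⁻¹) {u v : ℂ} (hv0 : v ≠ 0)
    (hu : u ∈ cone c) (hv : v ∈ cone c) :
    IntegrableOn (fun t : ℝ => F (u + t * v) * v) (Ioi 0) := by
  have hvn := norm_pos_iff.2 hv0
  -- Beyond `T` the ray has norm at least one wherever it starts, even at the origin; on the compact
  -- initial piece continuity suffices.
  set T : ℝ := 2 / (c * ‖v‖) with hT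
  have hT0 : 0 < T := by positivity
  have hcont : Continuous fun t : ℝ => F (u + t * v) * v := by fun_prop
  rw [← Ioc_union_Ioi_eq_Ioi hT0.le]
  refine IntegrableOn.union (hcont.integrableOn_Icc.mono_set Ioc_subset_Icc_self) ?_
  have hint := ((integrableOn_and_integral_inv_pow one_pos one_pos 0).1.mono_set
    (Ioi_subset_Ioi hT0.le)).const_mul (|C| * (((c / 2 * ‖v‖ * (T / (T + 1))) ^ 2)⁻¹ * ‖v‖))
  refine Integrable.mono' hint hcont.aestronglyMeasurable ?_
  refine (ae_restrict_iff' measurableSet_Ioi).2 (ae_of_all _ fun t ht => ?_)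
  have ht' : T < t := ht
  have ht0 : 0 < t := hT0.trans ht'
  have h1 : c / 2 * ‖v‖ * t ≤ ‖u + t * v‖ := by
    refine le_trans ?_ (le_norm_ray hu hv ht0.le)
    have : 0 ≤ c / 2 * ‖u‖ := by positivity
    linarith
  have h2 : 1 ≤ ‖u + t * v‖ := by
    refine le_trans ?_ h1
    calc (1 : ℝ) = c / 2 * ‖v‖ * T := by rw [hT]; field_simp
      _ ≤ _ := by gcongr
  have h3 : c / 2 * ‖v‖ * (T / (T + 1)) * (1 + t * 1) ≤ ‖u + t * v‖ := by
    refine le_trans ?_ h1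
    rw [mul_assoc (c / 2 * ‖v‖)]
    gcongr
    rw [div_mul_eq_mul_div, div_le_iff₀ (by positivity)]
    nlinarith
  rw [norm_mul]
  calc ‖F (u + t * v)‖ * ‖v‖ ≤ (C * (‖u + t * v‖ ^ 2)⁻¹) * ‖v‖ := by
        gcongr
        exact hbound _ h2 (ray_mem_cone hc.le hu hv ht0.le)
    _ ≤ (|C| * ((c / 2 * ‖v‖ * (T / (T + 1)) * (1 + t * 1)) ^ 2)⁻¹) * ‖v‖ := by
        gcongr
        exact le_abs_self C
    _ = _ := by rw [mul_pow _ (1 + t * 1), mul_inv, zero_add]; ring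

/-- Termwise integration of an asymptotic expansion along a ray. -/
theorem integral_ray_expansion {F : ℂ → ℂ} {c C : ℝ} (hc : 0 < c) {b : ℕ → ℂ} {N : ℕ}
    (hF : ∀ u : ℂ, 1 ≤ ‖u‖ → u ∈ cone c →
      ‖F u - ∑ m ∈ Finset.range N, b m * (u ^ (2 * m + 2))⁻¹‖ ≤ C * (‖u‖ ^ (2 * N + 2))⁻¹)
    {v : ℂ} (hv0 : v ≠ 0) (hv : v ∈ cone c) : ∃ K : ℝ, ∀ u : ℂ, 2 / c ≤ ‖u‖ → u ∈ cone c →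
      IntegrableOn (fun t : ℝ => F (u + t * v) * v) (Ioi 0) →
      ‖(∫ t in Ioi (0 : ℝ), F (u + t * v) * v)
        - ∑ m ∈ Finset.range N, b m / (2 * m + 1) * (u ^ (2 * m + 1))⁻¹‖
        ≤ K * (‖u‖ ^ (2 * N + 1))⁻¹ := by
  refine ⟨|C| * ((c / 2) ^ (2 * N + 2))⁻¹ / (2 * N + 1), fun u hu1 hu hint => ?_⟩
  have hun : 0 < ‖u‖ := (by positivity : 0 < 2 / c).trans_le hu1
  have hu0 : u ≠ 0 := norm_pos_iff.1 hun
  have hvn := norm_pos_iff.2 hv0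
  have hterm := fun m : ℕ => integrableOn_and_integral_ray_inv_pow hc hu0 hv0 hu hv (2 * m)
  have hi : ∀ m ∈ Finset.range N,
      IntegrableOn (fun t : ℝ => b m * (((u + t * v) ^ (2 * m + 2))⁻¹ * v)) (Ioi 0) := fun m _ =>
    (hterm m).1.const_mul _
  have he : (∫ t in Ioi (0 : ℝ), F (u + t * v) * v)
        - ∑ m ∈ Finset.range N, b m / (2 * m + 1) * (u ^ (2 * m + 1))⁻¹
      = ∫ t in Ioi (0 : ℝ), (F (u + t * v)
        - ∑ m ∈ Finset.range N, b m * ((u + t * v) ^ (2 * m + 2))⁻¹) * v := by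
    have h1 : ∀ t : ℝ, (F (u + t * v) - ∑ m ∈ Finset.range N, b m * ((u + t * v) ^ (2 * m + 2))⁻¹) * v
        = F (u + t * v) * v
          - ∑ m ∈ Finset.range N, b m * (((u + t * v) ^ (2 * m + 2))⁻¹ * v) := fun t => by
      rw [sub_mul, Finset.sum_mul]
      simp only [mul_assoc]
    simp only [h1]
    rw [integral_sub hint (integrable_finsetSum _ hi), integral_finsetSum _ hi]
    congr 1
    refine Finset.sum_congr rfl fun m _ => ?_
    rw [integral_const_mul, (hterm m).2]
    push_cast
    ring
  obtain ⟨hri, hrv⟩ := integrableOn_and_integral_inv_pow hun hvn (2 * N)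
  rw [he]
  refine (norm_integral_le_of_norm_le
    (hri.const_mul (|C| * ((c / 2) ^ (2 * N + 2))⁻¹ * ‖v‖)) ?_).trans_eq ?_
  · refine (ae_restrict_iff' measurableSet_Ioi).2 (ae_of_all _ fun t ht => ?_)
    have ht0 : (0 : ℝ) ≤ t := le_of_lt ht
    -- The threshold `2 / c` on `‖u‖` places the whole ray in the region where the expansion holds.
    have h2 : 1 ≤ ‖u + t * v‖ := by
      refine le_trans ?_ (le_norm_ray hu hv ht0)
      calc (1 : ℝ) = c / 2 * (2 / c) := by field_simp
        _ ≤ c / 2 * (‖u‖ + t * ‖v‖) := by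
          gcongr
          exact hu1.trans (le_add_of_nonneg_right (by positivity))
    rw [norm_mul]
    calc _ ≤ (C * (‖u + t * v‖ ^ (2 * N + 2))⁻¹) * ‖v‖ := by
          gcongr
          exact hF _ h2 (ray_mem_cone hc.le hu hv ht0)
      _ ≤ (|C| * (((c / 2) ^ (2 * N + 2))⁻¹ * ((‖u‖ + t * ‖v‖) ^ (2 * N + 2))⁻¹)) * ‖v‖ := by
          gcongr ?_ * ‖v‖
          exact mul_le_mul (le_abs_self C) (inv_pow_norm_ray_le hc hu0 hu hv ht0 _)
            (by positivity) (abs_nonneg C)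
      _ = _ := by ring
  · rw [integral_const_mul, hrv]
    push_cast
    field_simp

end GUE

namespace GUE

/-! ### The asymptotic expansion of `I₁` -/

/-- The sector is the open half-plane bisected by the direction `-π/4`, and `re - im` measures the
angle to that bisector. -/
theorem re_sub_im_eq (u : ℂ) : u.re - u.im = √2 * Real.cos (u.arg + Real.pi / 4) * ‖u‖ := by
  rw [Real.cos_add, Real.cos_pi_div_four, Real.sin_pi_div_four]
  have h : √2 * √2 = (2 : ℝ) := Real.mul_self_sqrt zero_le_two
  linear_combination (-1 : ℝ) * norm_mul_cos_arg u + norm_mul_sin_arg u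
    - ‖u‖ * (Real.cos u.arg - Real.sin u.arg) / 2 * h

theorem exists_cone {α β : ℝ} (hα : -(3 * Real.pi / 4) < α) (hβ : β < Real.pi / 4) :
    ∃ c : ℝ, 0 < c ∧ ∀ u : ℂ, α ≤ u.arg → u.arg ≤ β → u ∈ cone c := by
  rcases lt_or_ge β α with hαβ | hαβ
  · exact ⟨1, one_pos, fun u h1 h2 => absurd (h1.trans h2) hαβ.not_ge⟩
  -- The largest deviation from the bisector. It is below `π/2`, so its cosine is a positive lower
  -- bound on the subsector.
  set M := max |α + Real.pi / 4| |β + Real.pi / 4| with hM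
  have hM2 : M < Real.pi / 2 := by
    refine max_lt ?_ ?_ <;> rw [abs_lt] <;> constructor <;> linarith
  have hM0 : 0 ≤ M := (abs_nonneg _).trans (le_max_left _ _)
  have hcos : 0 < Real.cos M := Real.cos_pos_of_mem_Ioo ⟨by linarith [Real.pi_pos], hM2⟩
  refine ⟨√2 * Real.cos M, by positivity, fun u h1 h2 => ?_⟩
  rw [cone, mem_ofPred_eq, re_sub_im_eq]
  gcongr
  rw [← Real.cos_abs (u.arg + Real.pi / 4)]
  refine Real.cos_le_cos_of_nonneg_of_le_pi (abs_nonneg _) (by linarith [Real.pi_pos]) ?_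
  have e1 := (abs_le.1 (le_max_left |α + Real.pi / 4| |β + Real.pi / 4|)).1
  have e2 := (abs_le.1 (le_max_right |α + Real.pi / 4| |β + Real.pi / 4|)).2
  exact abs_le.2 ⟨by linarith, by linarith⟩

theorem exists_cone_of_mem_sector {σ l : ℂ} (hl : l ∈ sector σ) :
    ∃ c : ℝ, 0 < c ∧ l / σ ∈ cone c := by
  obtain ⟨c, hc, h⟩ := exists_cone hl.1 hl.2
  exact ⟨c, hc, h _ le_rfl le_rfl⟩

theorem continuous_product (n : ℂ) :
    Continuous fun u => I ^ (n + 1) * (hermiteFun (n - 1) u * hermiteFun (-n - 1) (I * u)) :=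
  continuous_const.mul ((continuous_hermiteFun _).mul
    ((continuous_hermiteFun _).comp (continuous_const.mul continuous_id)))

theorem integrableOn_product_ray {c : ℝ} (hc : 0 < c) (hc1 : c ≤ 1) (n : ℂ) {u v : ℂ} (hv0 : v ≠ 0)
    (hu : u ∈ cone c) (hv : v ∈ cone c) :
    IntegrableOn (fun t : ℝ => (I ^ (n + 1) * (hermiteFun (n - 1) (u + t * v)
      * hermiteFun (-n - 1) (I * (u + t * v)))) * v) (Ioi 0) := by
  -- The expansion with no terms is the bound `O(|u|⁻²)`, which gives absolute convergence.
  obtain ⟨C, hC⟩ := product_expansion hc hc1 0 n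
  exact integrableOn_ray (continuous_product n) hc (C := C)
    (fun u h1 h2 => by simpa using hC u h1 h2) hv0 hu hv

theorem integrand_ray_eq {σ : ℂ} (hσ : σ ≠ 0) (n l w : ℂ) (t : ℝ) :
    integrand n σ (l + t * w) * w
      = ((I ^ (n + 1))⁻¹ * σ) * ((I ^ (n + 1) * (hermiteFun (n - 1) (l / σ + t * (w / σ))
        * hermiteFun (-n - 1) (I * (l / σ + t * (w / σ))))) * (w / σ)) := by
  have h : (l + t * w) / σ = l / σ + t * (w / σ) := by rw [add_div, mul_div_assoc]
  have hI : I ^ (n + 1) ≠ 0 := by simp [cpow_eq_zero_iff]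
  rw [integrand, h]
  field_simp

theorem integrableOn_integrand {σ w : ℂ} (hσ : σ ≠ 0) (n : ℂ) (hw0 : w ≠ 0) (hw : w ∈ sector σ)
    {l : ℂ} (hl : l ∈ sector σ) :
    IntegrableOn (fun t : ℝ => integrand n σ (l + (t : ℂ) * w) * w) (Ioi 0) := by
  obtain ⟨c, hc, hlc⟩ := exists_cone_of_mem_sector hl
  obtain ⟨d, hd, hwd⟩ := exists_cone_of_mem_sector hw
  simp only [integrand_ray_eq hσ]
  exact (integrableOn_product_ray (c := min (min c d) 1) (by positivity) (min_le_right _ _) n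
    (div_ne_zero hw0 hσ) (cone_antitone ((min_le_left _ _).trans (min_le_left _ _)) hlc)
    (cone_antitone ((min_le_left _ _).trans (min_le_right _ _)) hwd)).const_mul _

/-- The expansion of `I₁` in a cone, with an explicit form of the coefficients. -/
theorem I₁_expansion {ε σ w : ℂ} (hε : ε ≠ 0) (hσε : σ ^ 2 = ε) (hw0 : w ≠ 0) (n : ℂ) {c : ℝ}
    (hc : 0 < c) (hc1 : c ≤ 1) (hw : w / σ ∈ cone c) (N : ℕ) :
    ∃ K : ℝ, ∀ l : ℂ, 2 / c ≤ ‖l / σ‖ → l / σ ∈ cone c →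
      ‖I₁ n ε σ w l - ∑ m ∈ Finset.range N, traceMoment n ε (2 * m) * l⁻¹ ^ (2 * m + 1)‖
        ≤ K * ‖l⁻¹‖ ^ (2 * N + 1) := by
  have hσ : σ ≠ 0 := fun h => hε (by rw [← hσε, h]; simp)
  have hwσ : w / σ ≠ 0 := div_ne_zero hw0 hσ
  obtain ⟨C, hC⟩ := product_expansion hc hc1 N n
  obtain ⟨K, hK⟩ := integral_ray_expansion hc hC hwσ hw
  refine ⟨‖n * σ / ε‖ * (K * ‖σ‖ ^ (2 * N + 1)), fun l hl1 hl => ?_⟩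
  have h := hK _ hl1 hl (integrableOn_product_ray hc hc1 n hwσ hl hw)
  have hI : I ^ (n + 1) ≠ 0 := by simp [cpow_eq_zero_iff]
  have e1 : I₁ n ε σ w l = n * σ / ε * ∫ t in Ioi (0 : ℝ), (I ^ (n + 1) *
      (hermiteFun (n - 1) (l / σ + t * (w / σ)) *
        hermiteFun (-n - 1) (I * (l / σ + t * (w / σ))))) * (w / σ) := by
    rw [I₁]
    simp only [integrand_ray_eq hσ]
    rw [integral_const_mul, ← mul_assoc]
    congr 1
    field_simp
  have e2 : ∑ m ∈ Finset.range N, traceMoment n ε (2 * m) * l⁻¹ ^ (2 * m + 1)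
      = n * σ / ε * ∑ m ∈ Finset.range N,
        productCoeff n m / (2 * m + 1) * ((l / σ) ^ (2 * m + 1))⁻¹ := by
    rw [Finset.mul_sum]
    refine Finset.sum_congr rfl fun m _ => ?_
    have h0 : (2 * (m : ℂ) + 1) ≠ 0 := by exact_mod_cast (2 * m).succ_ne_zero
    have h1 := traceMoment_two_mul_eq_productCoeff n ε m
    -- The remaining odd power of `σ` pairs with the one in `n σ / ε`, and `σ² = ε` removes the
    -- choice of square root.
    have h2 : ((l / σ) ^ (2 * m + 1))⁻¹ = l⁻¹ ^ (2 * m + 1) * (ε ^ m * σ) := by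
      rw [← inv_pow, inv_div, div_eq_inv_mul, mul_pow, pow_succ σ, pow_mul, hσε]
    rw [h2, eq_div_iff h0 |>.2 ((mul_comm _ _).trans h1)]
    field_simp
    rw [← hσε]
  rw [e1, e2, ← mul_sub, norm_mul, mul_assoc]
  refine mul_le_mul_of_nonneg_left (h.trans_eq ?_) (norm_nonneg _)
  rw [← inv_pow, norm_div, inv_div, norm_inv, div_eq_mul_inv, mul_pow, mul_assoc]

theorem traceMoment_zero (n ε : ℂ) : traceMoment n ε 0 = n := by
  simp [traceMoment, hookCoeff, hookProd]

theorem traceMoment_two_mul_add_one (n ε : ℂ) (q : ℕ) : traceMoment n ε (2 * q + 1) = 0 := by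
  rw [traceMoment, if_neg]
  simp

/-- Odd moments vanish, so only odd powers of `x = λ⁻¹` occur. The series `C₁` starts at `i = 1`,
whence the zeroth moment `n x` is subtracted. -/
theorem sum_coeff_C₁ {P : ℕ+ → MvPolynomial (Fin 2) ℂ}
    (hP : ∀ i, IsCorrelatorContinuation i (P i)) (n ε x : ℂ) (N : ℕ) :
    ∑ j ∈ Finset.range (2 * N + 2), PowerSeries.coeff j (C₁ P n ε) * x ^ j
      = ∑ m ∈ Finset.range (N + 1), traceMoment n ε (2 * m) * x ^ (2 * m + 1) - n * x := by
  induction N with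
  | zero => simp [Finset.sum_range_succ, coeff_C₁ hP, traceMoment_zero]
  | succ N ih =>
    rw [show 2 * (N + 1) + 2 = 2 * N + 2 + 1 + 1 by ring, Finset.sum_range_succ,
      Finset.sum_range_succ, ih, Finset.sum_range_succ _ (N + 1), coeff_C₁ hP, coeff_C₁ hP,
      if_pos (by omega), if_pos (by omega), show 2 * N + 2 - 1 = 2 * N + 1 by omega,
      traceMoment_two_mul_add_one, show 2 * N + 2 + 1 - 1 = 2 * (N + 1) by omega,
      show 2 * (N + 1) + 1 = 2 * N + 2 + 1 by ring]
    ring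

theorem isAsymptoticTo_I₁ {P : ℕ+ → MvPolynomial (Fin 2) ℂ}
    (hP : ∀ i, IsCorrelatorContinuation i (P i)) {ε σ w : ℂ} (hε : ε ≠ 0) (hσε : σ ^ 2 = ε)
    (hw0 : w ≠ 0) (hw : w ∈ sector σ) (n : ℂ) :
    IsAsymptoticTo (fun l => I₁ n ε σ w l - n / l) (C₁ P n ε) σ := by
  intro α β hα hβ N
  have hσ : σ ≠ 0 := fun h => hε (by rw [← hσε, h]; simp)
  obtain ⟨c, hc, hlc⟩ := exists_cone hα hβ
  obtain ⟨d, hd, hwd⟩ := exists_cone_of_mem_sector hw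
  set e := min (min c d) 1 with he
  have he0 : 0 < e := by positivity
  -- Taking `N + 1` terms gives an error of order `2N + 3`, more than required. The surplus terms of
  -- orders `N` to `2N + 1` are each `O(|λ|^{-N})` and enter the constant.
  obtain ⟨K, hK⟩ := I₁_expansion hε hσε hw0 n he0 (min_le_right _ _)
    (cone_antitone ((min_le_left _ _).trans (min_le_right _ _)) hwd) (N + 1)
  refine IsBigO.of_bound (|K| + ∑ j ∈ Finset.Ico N (2 * N + 2), ‖PowerSeries.coeff j (C₁ P n ε)‖)
    (eventually_inf_principal.2 ?_)
  filter_upwards [eventually_cobounded_le_norm (E := ℂ) (2 / e * ‖σ‖),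
    eventually_cobounded_le_norm (E := ℂ) 1] with l hl1 hl2 hl
  have h := hK l (by rwa [norm_div, le_div_iff₀ (norm_pos_iff.2 hσ)])
    (cone_antitone ((min_le_left _ _).trans (min_le_left _ _)) (hlc _ hl.1 hl.2))
  set x := l⁻¹ with hx
  have hx1 : ‖x‖ ≤ 1 := by
    rw [hx, norm_inv]
    exact inv_le_one_of_one_le₀ hl2
  have hpow : ∀ j, N ≤ j → ‖x‖ ^ j ≤ ‖x‖ ^ N := fun j hj =>
    pow_le_pow_of_le_one (norm_nonneg x) hx1 hj
  have hs := Finset.sum_range_add_sum_Ico (fun j => PowerSeries.coeff j (C₁ P n ε) * x ^ j)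
    (show N ≤ 2 * N + 2 by omega)
  rw [sum_coeff_C₁ hP] at hs
  have e1 : I₁ n ε σ w l - n / l
      - ∑ j ∈ Finset.range N, PowerSeries.coeff j (C₁ P n ε) * x ^ j
      = (I₁ n ε σ w l - ∑ m ∈ Finset.range (N + 1), traceMoment n ε (2 * m) * x ^ (2 * m + 1))
        + ∑ j ∈ Finset.Ico N (2 * N + 2), PowerSeries.coeff j (C₁ P n ε) * x ^ j := by
    rw [div_eq_mul_inv, ← hx]
    linear_combination (-1 : ℂ) * hs
  rw [e1, norm_pow, add_mul, Finset.sum_mul]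
  refine (norm_add_le _ _).trans (add_le_add ?_ (norm_sum_le_of_le _ fun j hj => ?_))
  · refine h.trans (mul_le_mul (le_abs_self K) (hpow _ (by omega)) (by positivity) (abs_nonneg K))
  · rw [norm_mul, norm_pow]
    exact mul_le_mul_of_nonneg_left (hpow j (Finset.mem_Ico.1 hj).1) (norm_nonneg _)

end GUE

end

theorem mainTheorem11 :
    (∀ i : ℕ+, ∃! P : MvPolynomial (Fin 2) ℂ, GUE.IsCorrelatorContinuation i P) ∧
    ∀ P : ℕ+ → MvPolynomial (Fin 2) ℂ, (∀ i, GUE.IsCorrelatorContinuation i (P i)) →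
      ∀ n ε σ w : ℂ, ε ≠ 0 → σ ^ 2 = ε → w ≠ 0 → w ∈ GUE.sector σ →
        (∀ l ∈ GUE.sector σ,
          IntegrableOn (fun t : ℝ => GUE.integrand n σ (l + (t : ℂ) * w) * w) (Ioi 0)) ∧
        GUE.IsAsymptoticTo (fun l => GUE.I₁ n ε σ w l - n / l) (GUE.C₁ P n ε) σ := by
  refine ⟨GUE.existsUnique_correlatorContinuation, fun P hP n ε σ w hε hσε hw0 hw => ?_⟩
  have hσ : σ ≠ 0 := fun h => hε (by rw [← hσε, h]; simp)
  exact ⟨fun l hl => GUE.integrableOn_integrand hσ n hw0 hw hl,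
    GUE.isAsymptoticTo_I₁ hP hε hσε hw0 hw n⟩
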